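/- Let $\mathbb K$ be an algebraically closed field, $I$ a set, and $A=(a_{ij})_{i,j\in I}$ a symmetrizable Borcherds–Cartan matrix: the $a_{ij}$ are integers, $a_{ii}\in\{2,0,-2,-4,\dots\}$, $a_{ij}\le 0$ for $i\ne j$, and there are fixed positive integers $r_i$ with $r_ia_{ij}=r_ja_{ji}$. Put $(\alpha_i,\alpha_j)=r_ia_{ij}$. An index $i$ is real if $a_{ii}=2$ and imaginary if $a_{ii}\le 0$. For $i$ real put $q_i=q^{r_i}$, $[n]_i=\frac{q_i^n-q_i^{-n}}{q_i-q_i^{-1}}$ and $[n]_i!=[n]_i[n-1]_i\cdots[1]_i\in\mathbb N[q,q^{-1}]$. For $\nu\in\mathbb N[I]$ of height $m$ let $\mathrm{Seq}(\nu)$ be the set of words $\mathbf i=i_1\cdots i_m$ in $I$ with $i_1+\dots+i_m=\nu$, and let $R(\nu)$ be the $\mathbb Z$-graded unital $\mathbb K$-algebra generated by $1_{\mathbf i}$ (degree $0$), $x_{k,\mathbf i}=x_k1_{\mathbf i}=1_{\mathbf i}x_k$ (degree $2r_{i_k}$, $1\le k\le m$) and $\tau_{k,\mathbf i}=\tau_k1_{\mathbf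 i}=1_{s_k\mathbf i}\tau_k$ (degree $-(\alpha_{i_k},\alpha_{i_{k+1}})$, $1\le k<m$), for $\mathbf i\in\mathrm{Seq}(\nu)$, where $s_k$ exchanges the letters in positions $k$ and $k+1$, subject to the following relations. The $1_{\mathbf i}$ are orthogonal idempotents with sum $1$; $x_kx_l=x_lx_k$; $\tau_kx_l=x_l\tau_k$ for $l\ne k,k+1$; $\tau_k\tau_l=\tau_l\tau_k$ for $|k-l|>1$; and, on $1_{\mathbf i}$ with $i=i_k$, $j=i_{k+1}$, $h=i_{k+2}$: * $\tau_k^2$ is $0$ if $i=j$, is $1$ if $i\neq j$ and $(\alpha_i,\alpha_j)=0$, and is $x_k^{-a_{ij}}+x_{k+1}^{-a_{ji}}$ otherwise; * $x_k\tau_k-\tau_kx_{k+1}=\tau_kx_k-x_{k+1}\tau_k$, and this element is $1$ if $i=j$ is real, and $0$ otherwise; * $\tau_k\tau_{k+1}\tau_k-\tau_{k+1}\tau_k\tau_{k+1}$ is $\sum_{c=0}^{-a_{ij}-1}x_k^{c}x_{k+2}^{-a_{ij}-1-c}$ if $h=i$ is real, $i\ne j$ and $(\alpha_i,\alpha_j)\ne0$,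 and is $0$ otherwise. Modules are $\mathbb Z$-graded left modules, $\cong$ denotes degree-preserving isomorphism, $(M\{s\})_d=M_{d-s}$, and $M^{f}=\bigoplus_s (M\{s\})^{\oplus f_s}$ for $f=\sum_s f_sq^s\in\mathbb N[q,q^{-1}]$. A graded module is gr-irreducible if it is nonzero and has no graded submodules other than $0$ and itself; $\mathrm{soc}\,M$ is the sum of all gr-irreducible graded submodules of $M$. For $i\in I$ and a graded $R(\nu)$-module $M$ let $e_iM=1_{\nu-i,i}M$, where $1_{\nu-i,i}=\sum_{\mathbf j\in\mathrm{Seq}(\nu-i)}1_{\mathbf ji}$, regarded as a graded $R(\nu-i)$-module by adding a vertical strand $i$ at the far right ($e_iM=0$ if $i$ does not occur in $\nu$), and let $\tilde e_iM=\mathrm{soc}(e_iM)$. **Proposition.** Let $M$ be a finite-dimensional gr-irreducible $R(\nu)$-module, $i\in I$ and $n\ge 0$. If $i$ is real, then $$\mathrm{soc}(e_i^nM)\cong\Bigl((\tilde e_i^{\,n}M)\bigl\{-\tfrac{n(n-1)}2r_i\bigr\}\Bigr)^{[n]_i!},$$ so that $\mathrm{soc}(e_i^nM)$ is isomorphic to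 $(\tilde e_i^{\,n}M)^{[n]_i!}$ up to an overall degree shift. If $i$ is imaginary, then $\mathrm{soc}(e_i^nM)\cong\tilde e_i^{\,n}M$. -/

import Mathlib

universe u v w

noncomputable section

/-- A symmetrizable Borcherds-Cartan matrix `a`, together with the positive integers `r i`
for which `diag(r) * a` is symmetric. -/
structure BorcherdsCartanDatum (I : Type u) where
  a : I → I → ℤ
  r : I → ℕ
  diag : ∀ i, a i i = 2 ∨ (a i i ≤ 0 ∧ Even (a i i))
  offdiag : ∀ i j, i ≠ j → a i j ≤ 0
  r_pos : ∀ i, 0 < r i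
  symm : ∀ i j, (r i : ℤ) * a i j = (r j : ℤ) * a j i

namespace BorcherdsCartanDatum

variable {I : Type u} (D : BorcherdsCartanDatum I)

/-- `i` is a real index. -/
def IsReal (i : I) : Prop := D.a i i = 2

/-- `i` is an imaginary index. -/
def IsImaginary (i : I) : Prop := D.a i i ≤ 0

/-- The symmetric form on simple roots, `(α_i, α_j) = r_i a_ij`. -/
def form (i j : I) : ℤ := (D.r i : ℤ) * D.a i j

/-- `[n]_i = (q_i^n - q_i^(-n)) / (q_i - q_i^(-1)) = ∑_{k < n} q_i^(n - 1 - 2k)` with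
`q_i = q^(r_i)`, as an element of `ℕ[q, q⁻¹]`. -/
def qInt (i : I) (n : ℕ) : LaurentPolynomial ℕ :=
  ∑ k ∈ Finset.range n, LaurentPolynomial.T ((D.r i : ℤ) * ((n : ℤ) - 1 - 2 * (k : ℤ)))

/-- `[n]_i! = [n]_i [n-1]_i ⋯ [1]_i`. -/
def qFactorial (i : I) (n : ℕ) : LaurentPolynomial ℕ :=
  ∏ m ∈ Finset.range n, D.qInt i (m + 1)

end BorcherdsCartanDatum

/-- Elementary diagrams, read from bottom to top; words are written from left to right.
* `idem l`: vertical strands labelled by the word `l`;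
* `dot a i b`: vertical strands labelled by `a ++ i :: b`, with a dot on the displayed `i`
  (the generator `x_k` on this word, `k = a.length + 1`);
* `cross a i j b`: the displayed neighbouring strands `i`, `j` of the bottom word
  `a ++ i :: j :: b` cross, so that the top word is `a ++ j :: i :: b`
  (the generator `τ_k` on this word, `k = a.length + 1`). -/
inductive KLRGen (I : Type u) : Type u
  | idem (l : List I)
  | dot (a : List I) (i : I) (b : List I)
  | cross (a : List I) (i j : I) (b : List I)

namespace KLRGen

variable {I : Type u}

/-- The word at the bottom of an elementary diagram. -/
def bot : KLRGen I → List I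
  | idem l => l
  | dot a i b => a ++ i :: b
  | cross a i j b => a ++ i :: j :: b

/-- The word at the top of an elementary diagram. -/
def top : KLRGen I → List I
  | idem l => l
  | dot a i b => a ++ i :: b
  | cross a i j b => a ++ j :: i :: b

/-- The degrees `0`, `2 r_i`, `- (α_i, α_j)` of the elementary diagrams. -/
def deg (D : BorcherdsCartanDatum I) : KLRGen I → ℤ
  | idem _ => 0
  | dot _ i _ => 2 * (D.r i : ℤ)
  | cross _ i j _ => - D.form i j

/-- Add a vertical strand labelled `k` at the far right of an elementary diagram. -/
def addStrand (k : I) : KLRGen I → KLRGen I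
  | idem l => idem (l ++ [k])
  | dot a i b => dot a i (b ++ [k])
  | cross a i j b => cross a i j (b ++ [k])

end KLRGen

section KLRAlgebra

variable {I : Type u} [DecidableEq I]

/-- The finite set `Seq(ν)` of words of content `ν`. Here `ℕ[I]` is the monoid of finite
multisets in `I`, the element `∑ ν_i i` being the multiset that contains `i` with
multiplicity `ν_i`. -/
def wordsOf (ν : Multiset I) : Finset (List I) := ν.lists.toFinset

theorem mem_wordsOf {ν : Multiset I} {l : List I} : l ∈ wordsOf ν ↔ (l : Multiset I) = ν := by
  rw [wordsOf, Multiset.mem_toFinset, Multiset.mem_lists_iff]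
  exact eq_comm

variable (D : BorcherdsCartanDatum I) (K : Type v) [Field K]

/-- The quadratic polynomial in the dots on two neighbouring vertical strands `i`, `j` that
equals the double crossing of these strands: `0` if `i = j`, `1` if `i ≠ j` and
`(α_i, α_j) = 0`, and `x_k ^ (-a_ij) + x_(k+1) ^ (-a_ji)` otherwise. -/
def doubleCross (a : List I) (i j : I) (b : List I) : FreeAlgebra K (KLRGen I) :=
  if i = j then 0
  else if D.form i j = 0 then FreeAlgebra.ι K (.idem (a ++ i :: j :: b))
  else FreeAlgebra.ι K (.dot a i (j :: b)) ^ (-D.a i j).toNat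
    + FreeAlgebra.ι K (.dot (a ++ [i]) j b) ^ (-D.a j i).toNat

/-- The right-hand side of the dot-crossing relations: two vertical strands if `i = j` is
real, and `0` otherwise. -/
def slideTerm (a : List I) (i j : I) (b : List I) : FreeAlgebra K (KLRGen I) :=
  open Classical in
  if i = j ∧ D.IsReal i then FreeAlgebra.ι K (.idem (a ++ i :: j :: b)) else 0

/-- The right-hand side of the braid relation: `∑_{c=0}^{-a_ij-1} x_k^c x_(k+2)^(-a_ij-1-c)` on
the word `a ++ i :: j :: i :: b` if the three labels are `i`, `j`, `i` with `i` real, `i ≠ j`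
and `(α_i, α_j) ≠ 0`, and `0` otherwise. -/
def braidTerm (a : List I) (i j k : I) (b : List I) : FreeAlgebra K (KLRGen I) :=
  open Classical in
  if i = k ∧ D.IsReal i ∧ i ≠ j ∧ D.form i j ≠ 0 then
    ∑ c ∈ Finset.range (-D.a i j).toNat,
      FreeAlgebra.ι K (.dot a i (j :: k :: b)) ^ c
        * FreeAlgebra.ι K (.dot (a ++ [i, j]) k b) ^ ((-D.a i j).toNat - 1 - c)
        * FreeAlgebra.ι K (.idem (a ++ i :: j :: k :: b))
  else 0

/-- The defining relations of `R(ν)`. A product `y * z` is the diagram `y` on top of the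
diagram `z`. Elementary diagrams on words outside `Seq(ν)` are set to zero, so that the
generators are those attached to the words of `Seq(ν)`. -/
inductive KLRRel (ν : Multiset I) : FreeAlgebra K (KLRGen I) → FreeAlgebra K (KLRGen I) → Prop
  | outside (l : List I) (hl : l ∉ wordsOf ν) : KLRRel ν (FreeAlgebra.ι K (.idem l)) 0
  | idem_mul_self (l : List I) :
      KLRRel ν (FreeAlgebra.ι K (.idem l) * FreeAlgebra.ι K (.idem l)) (FreeAlgebra.ι K (.idem l))
  | idem_mul_idem (l m : List I) (h : l ≠ m) :
      KLRRel ν (FreeAlgebra.ι K (.idem l) * FreeAlgebra.ι K (.idem m)) 0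
  | sum_idem : KLRRel ν (∑ l ∈ wordsOf ν, FreeAlgebra.ι K (.idem l)) 1
  | mul_bot (g : KLRGen I) :
      KLRRel ν (FreeAlgebra.ι K g * FreeAlgebra.ι K (.idem g.bot)) (FreeAlgebra.ι K g)
  | top_mul (g : KLRGen I) :
      KLRRel ν (FreeAlgebra.ι K (.idem g.top) * FreeAlgebra.ι K g) (FreeAlgebra.ι K g)
  -- elementary diagrams on disjoint sets of strands commute
  | dot_dot (a b c : List I) (i j : I) :
      KLRRel ν
        (FreeAlgebra.ι K (.dot a i (b ++ j :: c)) * FreeAlgebra.ι K (.dot (a ++ i :: b) j c))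
        (FreeAlgebra.ι K (.dot (a ++ i :: b) j c) * FreeAlgebra.ι K (.dot a i (b ++ j :: c)))
  | dot_cross (a b c : List I) (i j k : I) :
      KLRRel ν
        (FreeAlgebra.ι K (.dot a k (b ++ j :: i :: c))
          * FreeAlgebra.ι K (.cross (a ++ k :: b) i j c))
        (FreeAlgebra.ι K (.cross (a ++ k :: b) i j c)
          * FreeAlgebra.ι K (.dot a k (b ++ i :: j :: c)))
  | cross_dot (a b c : List I) (i j k : I) :
      KLRRel ν
        (FreeAlgebra.ι K (.dot (a ++ j :: i :: b) k c)
          * FreeAlgebra.ι K (.cross a i j (b ++ k :: c)))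
        (FreeAlgebra.ι K (.cross a i j (b ++ k :: c))
          * FreeAlgebra.ι K (.dot (a ++ i :: j :: b) k c))
  | cross_cross (a b c : List I) (i j k l : I) :
      KLRRel ν
        (FreeAlgebra.ι K (.cross (a ++ j :: i :: b) k l c)
          * FreeAlgebra.ι K (.cross a i j (b ++ k :: l :: c)))
        (FreeAlgebra.ι K (.cross a i j (b ++ l :: k :: c))
          * FreeAlgebra.ι K (.cross (a ++ i :: j :: b) k l c))
  -- double crossing
  | quadratic (a b : List I) (i j : I) :
      KLRRel ν
        (FreeAlgebra.ι K (.cross a j i b) * FreeAlgebra.ι K (.cross a i j b))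
        (doubleCross D K a i j b)
  -- `x_k τ_k - τ_k x_(k+1)` and `τ_k x_k - x_(k+1) τ_k`
  | slide_left (a b : List I) (i j : I) :
      KLRRel ν
        (FreeAlgebra.ι K (.dot a j (i :: b)) * FreeAlgebra.ι K (.cross a i j b)
          - FreeAlgebra.ι K (.cross a i j b) * FreeAlgebra.ι K (.dot (a ++ [i]) j b))
        (slideTerm D K a i j b)
  | slide_right (a b : List I) (i j : I) :
      KLRRel ν
        (FreeAlgebra.ι K (.cross a i j b) * FreeAlgebra.ι K (.dot a i (j :: b))
          - FreeAlgebra.ι K (.dot (a ++ [j]) i b) * FreeAlgebra.ι K (.cross a i j b))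
        (slideTerm D K a i j b)
  -- `τ_k τ_(k+1) τ_k - τ_(k+1) τ_k τ_(k+1)`
  | braid (a b : List I) (i j k : I) :
      KLRRel ν
        (FreeAlgebra.ι K (.cross a j k (i :: b)) * FreeAlgebra.ι K (.cross (a ++ [j]) i k b)
            * FreeAlgebra.ι K (.cross a i j (k :: b))
          - FreeAlgebra.ι K (.cross (a ++ [k]) i j b) * FreeAlgebra.ι K (.cross a i k (j :: b))
            * FreeAlgebra.ι K (.cross (a ++ [i]) j k b))
        (braidTerm D K a i j k b)

/-- The Khovanov-Lauda-Rouquier algebra `R(ν)` over `K`. -/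
def KLR (ν : Multiset I) : Type (max u v) := RingQuot (KLRRel D K ν)

namespace KLR

variable (ν : Multiset I)

instance : Ring (KLR D K ν) := inferInstanceAs (Ring (RingQuot (KLRRel D K ν)))

instance : Algebra K (KLR D K ν) :=
  inferInstanceAs (Algebra K (RingQuot (KLRRel D K ν)))

/-- The quotient map from the free algebra. -/
def mk : FreeAlgebra K (KLRGen I) →ₐ[K] KLR D K ν :=
  RingQuot.mkAlgHom K (KLRRel D K ν)

theorem mk_rel {x y : FreeAlgebra K (KLRGen I)} (h : KLRRel D K ν x y) :
    mk D K ν x = mk D K ν y :=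
  RingQuot.mkAlgHom_rel K h

/-- The element of `R(ν)` given by an elementary diagram. -/
def gen (g : KLRGen I) : KLR D K ν := mk D K ν (FreeAlgebra.ι K g)

/-- The homogeneous part of `R(ν)` of degree `d`: the span of all products of elementary
diagrams whose degrees add up to `d`. -/
def homogeneous (d : ℤ) : Submodule K (KLR D K ν) :=
  Submodule.span K
    {z | ∃ s : List (KLRGen I), (s.map (KLRGen.deg D)).sum = d ∧ z = (s.map (gen D K ν)).prod}

theorem gen_mem_homogeneous (g : KLRGen I) : gen D K ν g ∈ homogeneous D K ν (g.deg D) :=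
  Submodule.subset_span ⟨[g], by simp, by simp⟩

end KLR

/-- A `ℤ`-graded left `R(ν)`-module: an `R(ν)`-module with a decomposition
`M = ⨁ d, gr d` such that `R(ν)_d • gr e ⊆ gr (d + e)`. -/
structure GrMod (ν : Multiset I) where
  carrier : Type w
  [addCommGroup : AddCommGroup carrier]
  [moduleK : Module K carrier]
  [module : Module (KLR D K ν) carrier]
  [tower : IsScalarTower K (KLR D K ν) carrier]
  gr : ℤ → Submodule K carrier
  isInternal : DirectSum.IsInternal gr
  smul_mem : ∀ (d e : ℤ) (z : KLR D K ν) (m : carrier),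
    z ∈ KLR.homogeneous D K ν d → m ∈ gr e → z • m ∈ gr (d + e)

end KLRAlgebra

attribute [instance] GrMod.addCommGroup GrMod.moduleK GrMod.module GrMod.tower

/-- A subspace which is spanned by its homogeneous elements is graded by the induced
subspaces. -/
theorem isInternal_comap_of_le {K : Type v} {V : Type w} [Field K] [AddCommGroup V] [Module K V]
    (gr : ℤ → Submodule K V) (h : DirectSum.IsInternal gr) (S : Submodule K V)
    (hS : S ≤ ⨆ d, S ⊓ gr d) : DirectSum.IsInternal fun d => (gr d).comap S.subtype := by
  have hinj : Function.Injective S.subtype := S.subtype_injective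
  have hmap : ∀ d, ((gr d).comap S.subtype).map S.subtype = S ⊓ gr d := fun d => by
    rw [Submodule.map_comap_subtype]
  rw [DirectSum.isInternal_submodule_iff_iSupIndep_and_iSup_eq_top] at h ⊢
  refine ⟨?_, ?_⟩
  · intro d
    rw [disjoint_iff, eq_bot_iff]
    rintro ⟨x, hx⟩ hxd
    obtain ⟨h1, h2⟩ := hxd
    have h3 : x ∈ gr d := h1
    have h4 : x ∈ ⨆ j, ⨆ (_ : j ≠ d), gr j := by
      have h5 := Submodule.mem_map_of_mem (f := S.subtype) h2
      simp only [Submodule.map_iSup, hmap] at h5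
      have h6 : (⨆ j, ⨆ (_ : j ≠ d), S ⊓ gr j) ≤ ⨆ j, ⨆ (_ : j ≠ d), gr j :=
        iSup₂_mono fun j _ => inf_le_right
      exact h6 h5
    have h6 := (disjoint_iff.mp (h.1 d)).le ⟨h3, h4⟩
    simpa using h6
  · apply Submodule.map_injective_of_injective hinj
    simp only [Submodule.map_iSup, hmap, Submodule.map_top, Submodule.range_subtype]
    exact le_antisymm (iSup_le fun _ => inf_le_left) hS

namespace GrMod

variable {I : Type u} [DecidableEq I] {D : BorcherdsCartanDatum I} {K : Type v} [Field K]
variable {ν : Multiset I}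

/-- Isomorphism in the category of graded modules: an `R(ν)`-linear bijection which preserves
degrees. -/
def Iso (M N : GrMod.{u, v, w} D K ν) : Prop :=
  ∃ f : M.carrier ≃ₗ[KLR D K ν] N.carrier, ∀ (d : ℤ) (m : M.carrier), m ∈ M.gr d ↔ f m ∈ N.gr d

/-- `S` is a graded submodule: it is the sum of its intersections with the homogeneous parts. -/
def IsGraded (M : GrMod.{u, v, w} D K ν) (S : Submodule (KLR D K ν) M.carrier) : Prop :=
  S.restrictScalars K ≤ ⨆ d, S.restrictScalars K ⊓ M.gr d

/-- `S` is a gr-irreducible graded submodule: it is graded, nonzero, and contains no graded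
submodules other than `0` and `S`. -/
def IsGrIrreducibleSub (M : GrMod.{u, v, w} D K ν) (S : Submodule (KLR D K ν) M.carrier) : Prop :=
  M.IsGraded S ∧ S ≠ ⊥ ∧ ∀ T ≤ S, M.IsGraded T → T = ⊥ ∨ T = S

/-- `M` is gr-irreducible: it is nonzero and its only graded submodules are `0` and `M`. -/
def IsGrIrreducible (M : GrMod.{u, v, w} D K ν) : Prop :=
  Nontrivial M.carrier ∧ ∀ T, M.IsGraded T → T = ⊥ ∨ T = ⊤

/-- The graded socle as a submodule: the sum of all gr-irreducible submodules. -/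
def socle (M : GrMod.{u, v, w} D K ν) : Submodule (KLR D K ν) M.carrier :=
  sSup {S | M.IsGrIrreducibleSub S}

theorem isGraded_sSup (M : GrMod.{u, v, w} D K ν) (A : Set (Submodule (KLR D K ν) M.carrier))
    (hA : ∀ S ∈ A, M.IsGraded S) : M.IsGraded (sSup A) := by
  intro x hx0
  have hx : x ∈ ⨆ S : A, S.1 := by rw [← sSup_eq_iSup']; exact hx0
  clear hx0
  induction hx using Submodule.iSup_induction' with
  | mem S x hx =>
    have h1 := hA S.1 S.2 hx
    have h2 : S.1.restrictScalars K ≤ (sSup A).restrictScalars K :=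
      fun y hy => (le_sSup S.2 : S.1 ≤ sSup A) hy
    exact (iSup_mono fun d => inf_le_inf_right _ h2) h1
  | zero => exact zero_mem _
  | add x y _ _ hx hy => exact add_mem hx hy

/-- The graded socle `soc M`, as a graded module. -/
def soc (M : GrMod.{u, v, w} D K ν) : GrMod.{u, v, w} D K ν where
  carrier := M.socle.restrictScalars K
  module := inferInstanceAs (Module (KLR D K ν) M.socle)
  tower := ⟨fun c z m => Subtype.ext (smul_assoc c z m.1)⟩
  gr d := (M.gr d).comap (M.socle.restrictScalars K).subtype
  isInternal := isInternal_comap_of_le M.gr M.isInternal (M.socle.restrictScalars K)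
    (M.isGraded_sSup _ fun _ hS => hS.1)
  smul_mem d e z m hz hm := by
    have h : z • m.1 ∈ M.gr (d + e) := M.smul_mem d e z m.1 hz hm
    exact h

/-- The degree shift `M{s}`, with `(M{s})_d = M_(d - s)`. -/
def shift (M : GrMod.{u, v, w} D K ν) (s : ℤ) : GrMod.{u, v, w} D K ν where
  carrier := M.carrier
  gr d := M.gr (d - s)
  isInternal := by
    have h := M.isInternal
    rw [DirectSum.isInternal_submodule_iff_iSupIndep_and_iSup_eq_top] at h ⊢
    refine ⟨h.1.comp (f := fun d : ℤ => d - s) sub_left_injective, ?_⟩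
    rw [← h.2]
    exact (Equiv.subRight s).iSup_comp (g := M.gr)
  smul_mem d e z m hz hm := by
    have := M.smul_mem d (e - s) z m hz hm
    rwa [← add_sub_assoc] at this

/-- `M^f = ⨁ s, (M{s})^(⊕ f_s)` for `f = ∑ s, f_s q^s` in `ℕ[q, q⁻¹]`: the direct sum of copies of
`M` indexed by the pairs `(s, t)` with `t < f_s`, the copy of index `(s, t)` being shifted
by `s`. -/
def multiple (M : GrMod.{u, v, w} D K ν) (f : LaurentPolynomial ℕ) :
    GrMod.{u, v, w} D K ν where
  carrier := (Σ s : ℤ, Fin (f.coeff s)) →₀ M.carrier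
  gr d := ⨅ p : (Σ s : ℤ, Fin (f.coeff s)), (M.gr (d - p.1)).comap (Finsupp.lapply p)
  isInternal := by
    have h := M.isInternal
    rw [DirectSum.isInternal_submodule_iff_iSupIndep_and_iSup_eq_top] at h ⊢
    refine ⟨?_, ?_⟩
    · intro d
      rw [disjoint_iff, eq_bot_iff]
      rintro x ⟨hx1, hx2⟩
      rw [Submodule.mem_bot]
      ext p
      have h1 : x p ∈ M.gr (d - p.1) := (Submodule.mem_iInf _).mp hx1 p
      have h2 : x p ∈ ⨆ j, ⨆ (_ : j ≠ d - p.1), M.gr j := by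
        have h3 := Submodule.mem_map_of_mem (f := Finsupp.lapply (R := K) p) hx2
        simp only [Submodule.map_iSup] at h3
        have h4 : ∀ y, y ∈ _ → y ∈ ⨆ j, ⨆ (_ : j ≠ d - p.1), M.gr j := SetLike.le_def.mp
          (iSup₂_le (a := ⨆ j, ⨆ (_ : j ≠ d - p.1), M.gr j) (f := fun j (_ : j ≠ d) =>
            (⨅ p : (Σ s : ℤ, Fin (f.coeff s)), (M.gr (j - p.1)).comap
              (Finsupp.lapply p)).map (Finsupp.lapply (R := K) p)) fun j hj => ?_)
        · exact h4 _ h3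
        refine le_trans ?_ (le_iSup₂_of_le (j - p.1) (fun hh => hj (sub_left_injective hh)) le_rfl)
        rw [Submodule.map_le_iff_le_comap]
        exact iInf_le _ p
      simpa using (disjoint_iff.mp (h.1 (d - p.1))).le ⟨h1, h2⟩
    · rw [eq_top_iff]
      rintro x -
      induction x using Finsupp.induction_linear with
      | zero => exact zero_mem _
      | add x y hx hy => exact add_mem hx hy
      | single p m =>
        have hm : m ∈ ⨆ d, M.gr d := h.2 ▸ Submodule.mem_top
        induction hm using Submodule.iSup_induction' with
        | zero => simp
        | add x y _ _ hx hy => rw [Finsupp.single_add]; exact add_mem hx hy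
        | mem d x hx =>
          refine Submodule.mem_iSup_of_mem (d + p.1) ((Submodule.mem_iInf _).mpr fun p' => ?_)
          rw [Submodule.mem_comap, Finsupp.lapply_apply]
          by_cases hp : p = p'
          · subst hp; simpa using hx
          · rw [Finsupp.single_eq_of_ne' hp]; exact zero_mem _
  smul_mem d e z m hz hm := by
    rw [Submodule.mem_iInf] at hm ⊢
    intro p
    have := M.smul_mem d (e - p.1) z (m p) hz (hm p)
    rwa [← add_sub_assoc] at this

/-- The idempotent `1_(ν-i, i)` of `R(ν)`: the sum of the idempotents of all words `l ++ [i]` with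
`l` in `Seq(ν - i)`. It is zero if `i` does not occur in `ν`. -/
def tailIdem (D : BorcherdsCartanDatum I) (K : Type v) [Field K] (ν : Multiset I) (i : I) :
    KLR D K ν :=
  ∑ l ∈ wordsOf (ν.erase i), KLR.gen D K ν (.idem (l ++ [i]))

theorem tailIdem_mul_gen (D : BorcherdsCartanDatum I) (K : Type v) [Field K] (ν : Multiset I)
    (i : I) (g : KLRGen I) :
    tailIdem D K ν i * KLR.gen D K ν (g.addStrand i) = KLR.gen D K ν (g.addStrand i) := by
  have htop : (g.addStrand i).top = g.top ++ [i] := by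
    cases g <;> simp [KLRGen.addStrand, KLRGen.top]
  have hg : KLR.gen D K ν (.idem (g.top ++ [i])) * KLR.gen D K ν (g.addStrand i)
      = KLR.gen D K ν (g.addStrand i) := by
    rw [← htop, KLR.gen, KLR.gen, ← map_mul]
    exact KLR.mk_rel D K ν (.top_mul _)
  rw [← hg, ← mul_assoc]
  congr 1
  by_cases h : g.top ∈ wordsOf (ν.erase i)
  · rw [tailIdem, Finset.sum_mul, Finset.sum_eq_single_of_mem g.top h]
    · rw [KLR.gen, ← map_mul]
      exact KLR.mk_rel D K ν (.idem_mul_self _)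
    · intro l _ hl
      rw [KLR.gen, KLR.gen, ← map_mul, KLR.mk_rel D K ν (.idem_mul_idem _ _ _), map_zero]
      simpa using hl
  · have h0 : KLR.gen D K ν (.idem (g.top ++ [i])) = 0 := by
      rw [KLR.gen, KLR.mk_rel D K ν (.outside _ _), map_zero]
      intro h1
      apply h
      rw [mem_wordsOf] at h1 ⊢
      rw [← h1, Multiset.coe_erase, Multiset.coe_eq_coe]
      simpa using ((List.perm_append_singleton i g.top).erase i).symm
    rw [h0, mul_zero]

/-- The subspace `1_(ν-i, i) M` of `M`. -/
def tailSpace (M : GrMod.{u, v, w} D K ν) (i : I) : Submodule K M.carrier where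
  carrier := {m | tailIdem D K ν i • m = m}
  zero_mem' := smul_zero _
  add_mem' := by
    intro x y hx hy
    simp only [Set.mem_ofPred_eq, smul_add] at *
    rw [hx, hy]
  smul_mem' := by
    intro c x hx
    simp only [Set.mem_ofPred_eq] at *
    rw [smul_comm, hx]

/-- The operator on `1_(ν-i, i) M` given by an elementary diagram with an additional vertical
strand `i` at the far right. -/
def tailOp (M : GrMod.{u, v, w} D K ν) (i : I) (g : KLRGen I) :
    Module.End K (M.tailSpace i) where
  toFun m := ⟨KLR.gen D K ν (g.addStrand i) • m.1, by
    change _ • _ • _ = _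
    rw [← mul_smul, tailIdem_mul_gen]⟩
  map_add' x y := Subtype.ext (smul_add _ _ _)
  map_smul' c x := Subtype.ext (smul_comm _ _ _)

theorem tailOp_coe (M : GrMod.{u, v, w} D K ν) (i : I) (g : KLRGen I) (m : M.tailSpace i) :
    (M.tailOp i g m : M.carrier) = KLR.gen D K ν (g.addStrand i) • (m : M.carrier) := rfl

/-- Add a vertical strand labelled `i` at the far right, on linear combinations of products of
elementary diagrams. -/
def freeAddStrand (K : Type v) [Field K] (i : I) :
    FreeAlgebra K (KLRGen I) →ₐ[K] FreeAlgebra K (KLRGen I) :=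
  FreeAlgebra.lift K fun g => FreeAlgebra.ι K (g.addStrand i)

theorem lift_tailOp_coe (M : GrMod.{u, v, w} D K ν) (i : I) (y : FreeAlgebra K (KLRGen I)) :
    ∀ m : M.tailSpace i, (FreeAlgebra.lift K (M.tailOp i) y m : M.carrier)
      = KLR.mk D K ν (freeAddStrand K i y) • (m : M.carrier) := by
  induction y using FreeAlgebra.induction with
  | grade0 c => intro m; simp [Module.algebraMap_end_apply]
  | grade1 g =>
    intro m
    rw [FreeAlgebra.lift_ι_apply, tailOp_coe, freeAddStrand, FreeAlgebra.lift_ι_apply, KLR.gen]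
  | mul y z hy hz =>
    intro m
    rw [map_mul, Module.End.mul_apply, hy, hz, map_mul, map_mul, mul_smul]
  | add y z hy hz =>
    intro m
    rw [map_add, LinearMap.add_apply, Submodule.coe_add, hy, hz, map_add, map_add, add_smul]

/-- These operators satisfy the defining relations of `R(ν - i)`. -/
theorem tailOp_rel (M : GrMod.{u, v, w} D K ν) (i : I) {y z : FreeAlgebra K (KLRGen I)}
    (h : KLRRel D K (ν.erase i) y z) :
    FreeAlgebra.lift K (M.tailOp i) y = FreeAlgebra.lift K (M.tailOp i) z := by
  ext m
  rw [lift_tailOp_coe, lift_tailOp_coe]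
  have key : ∀ {y' z'}, KLRRel D K ν y' z' → y' = freeAddStrand K i y → z' = freeAddStrand K i z →
      KLR.mk D K ν (freeAddStrand K i y) • (m : M.carrier)
        = KLR.mk D K ν (freeAddStrand K i z) • (m : M.carrier) := by
    rintro y' z' h1 rfl rfl
    rw [KLR.mk_rel D K ν h1]
  cases h with
  | outside l hl =>
    refine key (.outside (l ++ [i]) ?_) (by simp [freeAddStrand, KLRGen.addStrand]) (by simp)
    intro h1
    apply hl
    rw [mem_wordsOf] at h1 ⊢
    rw [← h1, Multiset.coe_erase, Multiset.coe_eq_coe]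
    simpa using ((List.perm_append_singleton i l).erase i).symm
  | idem_mul_self l =>
    exact key (.idem_mul_self (l ++ [i])) (by simp [freeAddStrand, KLRGen.addStrand])
      (by simp [freeAddStrand, KLRGen.addStrand])
  | idem_mul_idem l l' h =>
    exact key (.idem_mul_idem (l ++ [i]) (l' ++ [i]) (by simpa using h))
      (by simp [freeAddStrand, KLRGen.addStrand]) (by simp)
  | sum_idem =>
    have hm : tailIdem D K ν i • (m : M.carrier) = m := m.2
    simpa [freeAddStrand, KLRGen.addStrand, tailIdem, KLR.gen] using hm
  | mul_bot g =>
    exact key (.mul_bot (g.addStrand i))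
      (by cases g <;> simp [freeAddStrand, KLRGen.addStrand, KLRGen.bot])
      (by simp [freeAddStrand])
  | top_mul g =>
    exact key (.top_mul (g.addStrand i))
      (by cases g <;> simp [freeAddStrand, KLRGen.addStrand, KLRGen.top])
      (by simp [freeAddStrand])
  | dot_dot a b c j k =>
    exact key (.dot_dot a b (c ++ [i]) j k) (by simp [freeAddStrand, KLRGen.addStrand])
      (by simp [freeAddStrand, KLRGen.addStrand])
  | dot_cross a b c j k l =>
    exact key (.dot_cross a b (c ++ [i]) j k l) (by simp [freeAddStrand, KLRGen.addStrand])
      (by simp [freeAddStrand, KLRGen.addStrand])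
  | cross_dot a b c j k l =>
    exact key (.cross_dot a b (c ++ [i]) j k l) (by simp [freeAddStrand, KLRGen.addStrand])
      (by simp [freeAddStrand, KLRGen.addStrand])
  | cross_cross a b c j k l l' =>
    exact key (.cross_cross a b (c ++ [i]) j k l l') (by simp [freeAddStrand, KLRGen.addStrand])
      (by simp [freeAddStrand, KLRGen.addStrand])
  | quadratic a b j k =>
    refine key (.quadratic a (b ++ [i]) j k) (by simp [freeAddStrand, KLRGen.addStrand]) ?_
    unfold doubleCross
    split_ifs <;> simp [freeAddStrand, KLRGen.addStrand]
  | slide_left a b j k =>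
    refine key (.slide_left a (b ++ [i]) j k) (by simp [freeAddStrand, KLRGen.addStrand]) ?_
    unfold slideTerm
    split_ifs <;> simp [freeAddStrand, KLRGen.addStrand]
  | slide_right a b j k =>
    refine key (.slide_right a (b ++ [i]) j k) (by simp [freeAddStrand, KLRGen.addStrand]) ?_
    unfold slideTerm
    split_ifs <;> simp [freeAddStrand, KLRGen.addStrand]
  | braid a b j k l =>
    refine key (.braid a (b ++ [i]) j k l) (by simp [freeAddStrand, KLRGen.addStrand]) ?_
    unfold braidTerm
    split_ifs <;> simp [freeAddStrand, KLRGen.addStrand]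

/-- The action of `R(ν - i)` on `1_(ν-i, i) M` through `R(ν - i) → R(ν)`, which adds a vertical
strand `i` at the far right of each diagram. -/
def tailAction (M : GrMod.{u, v, w} D K ν) (i : I) :
    KLR D K (ν.erase i) →ₐ[K] Module.End K (M.tailSpace i) :=
  RingQuot.liftAlgHom K ⟨FreeAlgebra.lift K (M.tailOp i), fun _ _ h => M.tailOp_rel i h⟩

theorem tailAction_gen (M : GrMod.{u, v, w} D K ν) (i : I) (g : KLRGen I) :
    M.tailAction i (KLR.gen D K _ g) = M.tailOp i g := by
  rw [tailAction, KLR.gen, KLR.mk]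
  erw [RingQuot.liftAlgHom_mkAlgHom_apply]
  rw [FreeAlgebra.lift_ι_apply]

theorem tailIdem_mem (D : BorcherdsCartanDatum I) (K : Type v) [Field K] (ν : Multiset I) (i : I) :
    tailIdem D K ν i ∈ KLR.homogeneous D K ν 0 :=
  Submodule.sum_mem _ fun _ _ => KLR.gen_mem_homogeneous D K ν (.idem _)

theorem tailSpace_le (M : GrMod.{u, v, w} D K ν) (i : I) :
    M.tailSpace i ≤ ⨆ d, M.tailSpace i ⊓ M.gr d := by
  have hidem : tailIdem D K ν i * tailIdem D K ν i = tailIdem D K ν i := by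
    conv_lhs => rhs; rw [tailIdem]
    rw [Finset.mul_sum]
    exact Finset.sum_congr rfl fun l _ => tailIdem_mul_gen D K ν i (.idem l)
  have hall : ∀ m : M.carrier, tailIdem D K ν i • m ∈ ⨆ d, M.tailSpace i ⊓ M.gr d := by
    intro m
    have hm : m ∈ ⨆ d, M.gr d := by
      rw [((DirectSum.isInternal_submodule_iff_iSupIndep_and_iSup_eq_top _).mp M.isInternal).2]
      exact Submodule.mem_top
    induction hm using Submodule.iSup_induction' with
    | zero => rw [smul_zero]; exact zero_mem _
    | add x y _ _ hx hy => rw [smul_add]; exact add_mem hx hy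
    | mem d x hx =>
      refine Submodule.mem_iSup_of_mem d ⟨?_, ?_⟩
      · change _ • _ • _ = _
        rw [← mul_smul, hidem]
      · have := M.smul_mem 0 d _ x (tailIdem_mem D K ν i) hx
        rwa [zero_add] at this
  intro m hm
  have h1 : tailIdem D K ν i • m = m := hm
  rw [← h1]
  exact hall m

theorem tailAction_mem (M : GrMod.{u, v, w} D K ν) (i : I) (d e : ℤ) (z : KLR D K (ν.erase i))
    (m : M.tailSpace i) (hz : z ∈ KLR.homogeneous D K (ν.erase i) d)
    (hm : (m : M.carrier) ∈ M.gr e) : (M.tailAction i z m : M.carrier) ∈ M.gr (d + e) := by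
  induction hz using Submodule.span_induction with
  | zero => simp
  | add x y _ _ hx hy =>
    rw [map_add, LinearMap.add_apply, Submodule.coe_add]
    exact add_mem hx hy
  | smul c x _ hx =>
    rw [map_smul, LinearMap.smul_apply, Submodule.coe_smul]
    exact Submodule.smul_mem _ c hx
  | mem x hx =>
    obtain ⟨s, rfl, rfl⟩ := hx
    induction s with
    | nil => simpa using hm
    | cons g s ih =>
      rw [List.map_cons, List.map_cons, List.sum_cons, List.prod_cons, map_mul,
        Module.End.mul_apply, tailAction_gen, tailOp_coe, add_assoc]
      refine M.smul_mem _ _ _ _ ?_ ih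
      have hdeg : (g.addStrand i).deg D = g.deg D := by cases g <;> rfl
      rw [← hdeg]
      exact KLR.gen_mem_homogeneous D K ν _

/-- The functor `e_i`: the graded `R(ν - i)`-module `e_i M = 1_(ν-i, i) M`. If `i` does not occur
in `ν`, then `1_(ν-i, i) = 0`, so that `e_i M = 0` (in this case `ν.erase i = ν`). -/
def e (M : GrMod.{u, v, w} D K ν) (i : I) : GrMod.{u, v, w} D K (ν.erase i) where
  carrier := M.tailSpace i
  module := Module.compHom _ (M.tailAction i).toRingHom
  tower := by
    let _ : Module (KLR D K (ν.erase i)) (M.tailSpace i) :=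
      Module.compHom _ (M.tailAction i).toRingHom
    refine ⟨fun c z m => ?_⟩
    change M.tailAction i (c • z) m = c • M.tailAction i z m
    rw [map_smul, LinearMap.smul_apply]
  gr d := (M.gr d).comap (M.tailSpace i).subtype
  isInternal := isInternal_comap_of_le M.gr M.isInternal (M.tailSpace i) (M.tailSpace_le i)
  smul_mem d e z m hz hm := M.tailAction_mem i d e z m hz hm

/-- The crystal operator `ẽ_i M = soc (e_i M)`. -/
def eTilde (M : GrMod.{u, v, w} D K ν) (i : I) : GrMod.{u, v, w} D K (ν.erase i) := (M.e i).soc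

/-- `e_i^n M`, a graded module over `R(ν - n i)`. -/
def ePow (i : I) : ∀ (n : ℕ) {ν : Multiset I} (_ : GrMod.{u, v, w} D K ν),
    GrMod.{u, v, w} D K ((fun μ => μ.erase i)^[n] ν)
  | 0, _, M => M
  | n + 1, _, M => ePow i n (M.e i)

/-- `ẽ_i^n M`, a graded module over `R(ν - n i)`. -/
def eTildePow (i : I) : ∀ (n : ℕ) {ν : Multiset I} (_ : GrMod.{u, v, w} D K ν),
    GrMod.{u, v, w} D K ((fun μ => μ.erase i)^[n] ν)
  | 0, _, M => M
  | n + 1, _, M => eTildePow i n (M.eTilde i)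

end GrMod

end

set_option linter.unusedSectionVars false

noncomputable section

namespace KLRGen

variable {I : Type u}

/-- Add vertical strands labelled by the word `w` at the right of an elementary diagram. -/
def app (w : List I) : KLRGen I → KLRGen I
  | idem l => idem (l ++ w)
  | dot a i b => dot a i (b ++ w)
  | cross a i j b => cross a i j (b ++ w)

/-- Add vertical strands labelled by the word `w` at the left of an elementary diagram. -/
def pre (w : List I) : KLRGen I → KLRGen I
  | idem l => idem (w ++ l)
  | dot a i b => dot (w ++ a) i b
  | cross a i j b => cross (w ++ a) i j b

@[simp] theorem bot_idem (l : List I) : (idem l).bot = l := rfl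
@[simp] theorem bot_dot (a b : List I) (i : I) : (dot a i b).bot = a ++ i :: b := rfl
@[simp] theorem bot_cross (a b : List I) (i j : I) : (cross a i j b).bot = a ++ i :: j :: b := rfl
@[simp] theorem top_idem (l : List I) : (idem l).top = l := rfl
@[simp] theorem top_dot (a b : List I) (i : I) : (dot a i b).top = a ++ i :: b := rfl
@[simp] theorem top_cross (a b : List I) (i j : I) : (cross a i j b).top = a ++ j :: i :: b := rfl
@[simp] theorem app_idem (l w : List I) : (idem l).app w = idem (l ++ w) := rfl
@[simp] theorem app_dot (a b w : List I) (i : I) : (dot a i b).app w = dot a i (b ++ w) := rfl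
@[simp] theorem app_cross (a b w : List I) (i j : I) :
    (cross a i j b).app w = cross a i j (b ++ w) := rfl
@[simp] theorem pre_idem (l w : List I) : (idem l).pre w = idem (w ++ l) := rfl
@[simp] theorem pre_dot (a b w : List I) (i : I) : (dot a i b).pre w = dot (w ++ a) i b := rfl
@[simp] theorem pre_cross (a b w : List I) (i j : I) :
    (cross a i j b).pre w = cross (w ++ a) i j b := rfl

@[simp] theorem bot_app (w : List I) (g : KLRGen I) : (g.app w).bot = g.bot ++ w := by
  cases g <;> simp [app, bot]

@[simp] theorem top_app (w : List I) (g : KLRGen I) : (g.app w).top = g.top ++ w := by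
  cases g <;> simp [app, top]

@[simp] theorem bot_pre (w : List I) (g : KLRGen I) : (g.pre w).bot = w ++ g.bot := by
  cases g <;> simp [pre, bot]

@[simp] theorem top_pre (w : List I) (g : KLRGen I) : (g.pre w).top = w ++ g.top := by
  cases g <;> simp [pre, top]

@[simp] theorem app_app (w w' : List I) (g : KLRGen I) : (g.app w).app w' = g.app (w ++ w') := by
  cases g <;> simp [app]

@[simp] theorem app_nil (g : KLRGen I) : g.app [] = g := by
  cases g <;> simp [app]

@[simp] theorem pre_pre (w w' : List I) (g : KLRGen I) : (g.pre w).pre w' = g.pre (w' ++ w) := by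
  cases g <;> simp [pre]

theorem app_pre (w w' : List I) (g : KLRGen I) : (g.app w).pre w' = (g.pre w').app w := by
  cases g <;> simp [pre, app]

theorem addStrand_eq_app (i : I) (g : KLRGen I) : g.addStrand i = g.app [i] := by
  cases g <;> rfl

end KLRGen

namespace KLR

variable {I : Type u} [DecidableEq I] (D : BorcherdsCartanDatum I) (K : Type v) [Field K]
  (ν : Multiset I)

theorem gen_mul_bot (g : KLRGen I) : gen D K ν g * gen D K ν (.idem g.bot) = gen D K ν g := by
  rw [gen, gen, ← map_mul]; exact mk_rel D K ν (.mul_bot g)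

theorem top_mul_gen (g : KLRGen I) : gen D K ν (.idem g.top) * gen D K ν g = gen D K ν g := by
  rw [gen, gen, ← map_mul]; exact mk_rel D K ν (.top_mul g)

theorem idem_mul_self (l : List I) :
    gen D K ν (.idem l) * gen D K ν (.idem l) = gen D K ν (.idem l) :=
  gen_mul_bot D K ν (.idem l)

theorem idem_mul_idem {l m : List I} (h : l ≠ m) :
    gen D K ν (.idem l) * gen D K ν (.idem m) = 0 := by
  rw [gen, gen, ← map_mul, mk_rel D K ν (.idem_mul_idem l m h), map_zero]

theorem gen_mul_idem {g : KLRGen I} {l : List I} (h : g.bot ≠ l) :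
    gen D K ν g * gen D K ν (.idem l) = 0 := by
  rw [← gen_mul_bot, mul_assoc, idem_mul_idem D K ν h, mul_zero]

theorem idem_mul_gen {g : KLRGen I} {l : List I} (h : l ≠ g.top) :
    gen D K ν (.idem l) * gen D K ν g = 0 := by
  rw [← top_mul_gen D K ν g, ← mul_assoc, idem_mul_idem D K ν h, zero_mul]

theorem idem_outside {l : List I} (h : l ∉ wordsOf ν) : gen D K ν (.idem l) = 0 := by
  rw [gen, mk_rel D K ν (.outside l h), map_zero]

theorem sum_idem : ∑ l ∈ wordsOf ν, gen D K ν (.idem l) = 1 := by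
  rw [← map_one (mk D K ν), ← mk_rel D K ν .sum_idem, map_sum]; rfl

theorem idem_mul_gen_self {g : KLRGen I} {l : List I} (h : l = g.top) :
    gen D K ν (.idem l) * gen D K ν g = gen D K ν g := by
  subst h; exact top_mul_gen D K ν g

theorem gen_mul_idem_self {g : KLRGen I} {l : List I} (h : l = g.bot) :
    gen D K ν g * gen D K ν (.idem l) = gen D K ν g := by
  subst h; exact gen_mul_bot D K ν g

/-- Diagrams on disjoint sets of strands commute. -/
theorem app_mul_pre (g h : KLRGen I) :
    gen D K ν (g.app h.top) * gen D K ν (h.pre g.bot)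
      = gen D K ν (h.pre g.top) * gen D K ν (g.app h.bot) := by
  have key : ∀ {x y z t : KLRGen I}, KLRRel D K ν (FreeAlgebra.ι K x * FreeAlgebra.ι K y)
      (FreeAlgebra.ι K z * FreeAlgebra.ι K t) →
      gen D K ν x * gen D K ν y = gen D K ν z * gen D K ν t := by
    intro x y z t hr
    simp only [gen, ← map_mul]
    exact mk_rel D K ν hr
  rcases g with l | ⟨a, i, b⟩ | ⟨a, i, j, b⟩ <;> rcases h with m | ⟨c, k, d⟩ | ⟨c, k, p, d⟩
  · rfl
  · rw [KLRGen.app_idem, KLRGen.app_idem, idem_mul_gen_self, gen_mul_idem_self] <;> simp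
  · rw [KLRGen.app_idem, KLRGen.app_idem, idem_mul_gen_self, gen_mul_idem_self] <;> simp
  · rw [KLRGen.pre_idem, KLRGen.pre_idem, idem_mul_gen_self, gen_mul_idem_self] <;> simp
  · simpa using
      key (.dot_dot (ν := ν) a (b ++ c) d i k)
  · simpa using
      key (.dot_cross (ν := ν) a (b ++ c) d k p i)
  · rw [KLRGen.pre_idem, KLRGen.pre_idem, idem_mul_gen_self, gen_mul_idem_self] <;> simp
  · simpa using
      (key (.cross_dot (ν := ν) a (b ++ c) d i j k)).symm
  · simpa using
      (key (.cross_cross (ν := ν) a (b ++ c) d i j k p)).symm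

theorem quadratic (a b : List I) (i j : I) :
    gen D K ν (.cross a j i b) * gen D K ν (.cross a i j b)
      = mk D K ν (doubleCross D K a i j b) := by
  simp only [gen, ← map_mul]; exact mk_rel D K ν (.quadratic a b i j)

theorem slide_left (a b : List I) (i j : I) :
    gen D K ν (.dot a j (i :: b)) * gen D K ν (.cross a i j b)
      = gen D K ν (.cross a i j b) * gen D K ν (.dot (a ++ [i]) j b)
        + mk D K ν (slideTerm D K a i j b) := by
  rw [← mk_rel D K ν (.slide_left a b i j), map_sub, map_mul, map_mul]
  simp only [gen]; abel

theorem slide_right (a b : List I) (i j : I) :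
    gen D K ν (.dot (a ++ [j]) i b) * gen D K ν (.cross a i j b)
      = gen D K ν (.cross a i j b) * gen D K ν (.dot a i (j :: b))
        - mk D K ν (slideTerm D K a i j b) := by
  rw [← mk_rel D K ν (.slide_right a b i j), map_sub, map_mul, map_mul]
  simp only [gen]; abel

theorem braid (a b : List I) (i j k : I) :
    gen D K ν (.cross (a ++ [k]) i j b) * gen D K ν (.cross a i k (j :: b))
        * gen D K ν (.cross (a ++ [i]) j k b)
      = gen D K ν (.cross a j k (i :: b)) * gen D K ν (.cross (a ++ [j]) i k b)
        * gen D K ν (.cross a i j (k :: b)) - mk D K ν (braidTerm D K a i j k b) := by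
  rw [← mk_rel D K ν (.braid a b i j k), map_sub]
  simp only [gen, map_mul]; abel

theorem homogeneous_mul {d e : ℤ} {y z : KLR D K ν} (hy : y ∈ homogeneous D K ν d)
    (hz : z ∈ homogeneous D K ν e) : y * z ∈ homogeneous D K ν (d + e) := by
  have h := Submodule.mul_mem_mul hy hz
  rw [homogeneous, homogeneous, Submodule.span_mul_span] at h
  refine Submodule.span_mono ?_ h
  rintro _ ⟨_, ⟨s, rfl, rfl⟩, _, ⟨t, rfl, rfl⟩, rfl⟩
  exact ⟨s ++ t, by simp, by simp⟩

theorem induction {p : KLR D K ν → Prop} (h0 : ∀ c : K, p (algebraMap K _ c))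
    (hg : ∀ g, p (gen D K ν g)) (hm : ∀ y z, p y → p z → p (y * z))
    (ha : ∀ y z, p y → p z → p (y + z)) (z : KLR D K ν) : p z := by
  obtain ⟨y, rfl⟩ := RingQuot.mkAlgHom_surjective K (KLRRel D K ν) z
  change p (mk D K ν y)
  induction y using FreeAlgebra.induction with
  | grade0 c => rw [AlgHom.commutes]; exact h0 c
  | grade1 g => exact hg g
  | mul y z hy hz => rw [map_mul]; exact hm _ _ hy hz
  | add y z hy hz => rw [map_add]; exact ha _ _ hy hz

/-- The strand labelled `i` at the right of the word `a ++ b` moves to the left across `b`;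
strands labelled by `w` remain at the far right. -/
def strand (i : I) (w : List I) : List I → List I → KLR D K ν
  | a, [] => gen D K ν (.idem (a ++ i :: w))
  | a, c :: b => gen D K ν (.cross a c i (b ++ w)) * strand i w (a ++ [c]) b

variable (i : I) (w : List I)

theorem idem_mul_strand (a b : List I) :
    gen D K ν (.idem (a ++ i :: (b ++ w))) * strand D K ν i w a b = strand D K ν i w a b := by
  cases b with
  | nil => exact idem_mul_self D K ν _
  | cons c b =>
    rw [strand, ← mul_assoc, idem_mul_gen_self]
    simp

theorem strand_mul_idem (a b : List I) :
    strand D K ν i w a b * gen D K ν (.idem (a ++ (b ++ i :: w))) = strand D K ν i w a b := by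
  induction b generalizing a with
  | nil => exact idem_mul_self D K ν _
  | cons c b ih =>
    have := ih (a ++ [c])
    rw [strand, mul_assoc]
    simp only [List.append_assoc, List.nil_append, List.cons_append] at this ⊢
    rw [this]

theorem strand_left (g : KLRGen I) (b : List I) :
    gen D K ν (g.app (i :: (b ++ w))) * strand D K ν i w g.bot b
      = strand D K ν i w g.top b * gen D K ν (g.app (b ++ i :: w)) := by
  induction b generalizing g with
  | nil =>
    have h1 := gen_mul_bot D K ν (g.app (i :: w))
    have h2 := top_mul_gen D K ν (g.app (i :: w))
    simp only [KLRGen.bot_app, KLRGen.top_app] at h1 h2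
    simp only [strand, List.nil_append, h1, h2]
  | cons c b ih =>
    have h1 := app_mul_pre D K ν g (.cross [] c i (b ++ w))
    have h2 := ih (g.app [c])
    simp only [KLRGen.top_cross, KLRGen.bot_cross, KLRGen.pre_cross, List.append_nil,
      List.nil_append, KLRGen.app_app, KLRGen.bot_app, KLRGen.top_app, List.cons_append] at h1 h2
    rw [strand, strand, ← mul_assoc, List.cons_append, h1, mul_assoc, h2, ← mul_assoc,
      List.cons_append]

theorem strand_right (h : KLRGen I) (a b : List I) :
    gen D K ν (h.pre (a ++ i :: b)) * strand D K ν i h.bot a b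
      = strand D K ν i h.top a b * gen D K ν (h.pre (a ++ (b ++ [i]))) := by
  induction b generalizing a with
  | nil =>
    have h1 := gen_mul_bot D K ν (h.pre (a ++ [i]))
    have h2 := top_mul_gen D K ν (h.pre (a ++ [i]))
    simp only [KLRGen.bot_pre, KLRGen.top_pre, List.append_assoc, List.singleton_append] at h1 h2
    simp only [strand, List.nil_append, h1, h2]
  | cons c b ih =>
    have h1 := app_mul_pre D K ν (.cross a c i b) h
    have h2 := ih (a ++ [c])
    simp only [KLRGen.top_cross, KLRGen.bot_cross, KLRGen.app_cross, List.append_assoc,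
      List.cons_append, List.nil_append] at h1 h2 ⊢
    rw [strand, strand, ← mul_assoc, ← h1, mul_assoc, h2, ← mul_assoc]

theorem exists_strand_mem_homogeneous (a b : List I) :
    ∃ d, strand D K ν i w a b ∈ homogeneous D K ν d := by
  induction b generalizing a with
  | nil => exact ⟨_, gen_mem_homogeneous D K ν _⟩
  | cons c b ih =>
    obtain ⟨d, hd⟩ := ih (a ++ [c])
    exact ⟨_, homogeneous_mul D K ν (gen_mem_homogeneous D K ν _) hd⟩

section StrandSpan

variable {V : Type w} [AddCommGroup V] [Module K V] [Module (KLR D K ν) V]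
  [IsScalarTower K (KLR D K ν) V]

theorem smul_mem_span_of_forall {s : Set V} {T : Submodule K V} (z : KLR D K ν)
    (h : ∀ x ∈ s, z • x ∈ T) {x : V} (hx : x ∈ Submodule.span K s) : z • x ∈ T := by
  induction hx using Submodule.span_induction with
  | mem x hx => exact h x hx
  | zero => rw [smul_zero]; exact zero_mem _
  | add x y _ _ hx hy => rw [smul_add]; exact add_mem hx hy
  | smul c x _ hx => rw [smul_comm]; exact T.smul_mem c hx

/-- A subspace which is stable under dots and idempotents is stable under the right-hand sides of
the defining relations. -/
theorem doubleCross_smul_mem {S : Submodule K V} (a b : List I) (j k : I) {x : V} (hx : x ∈ S)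
    (hi : ∀ l, ∀ y ∈ S, gen D K ν (.idem l) • y ∈ S)
    (hd : ∀ (p : List I) (c : I) (q : List I), ∀ y ∈ S, gen D K ν (.dot p c (q ++ b)) • y ∈ S) :
    mk D K ν (doubleCross D K a j k b) • x ∈ S := by
  have hpow : ∀ z : KLR D K ν, (∀ y ∈ S, z • y ∈ S) → ∀ n : ℕ, z ^ n • x ∈ S := by
    intro z hz n
    induction n with
    | zero => simpa using hx
    | succ n ih => rw [pow_succ', mul_smul]; exact hz _ ih
  unfold doubleCross
  split_ifs
  · simp
  · exact hi _ _ hx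
  · rw [map_add, map_pow, map_pow, add_smul]
    exact add_mem (hpow _ (hd a j [k]) _) (hpow _ (hd (a ++ [j]) k []) _)

theorem slideTerm_smul_mem {S : Submodule K V} (a b : List I) (j k : I) {x : V} (hx : x ∈ S)
    (hi : ∀ l, ∀ y ∈ S, gen D K ν (.idem l) • y ∈ S) :
    mk D K ν (slideTerm D K a j k b) • x ∈ S := by
  unfold slideTerm
  split_ifs
  · exact hi _ _ hx
  · simp

theorem braidTerm_smul_mem {S : Submodule K V} (a b : List I) (j k l : I) {x : V} (hx : x ∈ S)
    (hi : ∀ l, ∀ y ∈ S, gen D K ν (.idem l) • y ∈ S)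
    (hd : ∀ (p : List I) (c : I) (q : List I), ∀ y ∈ S, gen D K ν (.dot p c (q ++ b)) • y ∈ S) :
    mk D K ν (braidTerm D K a j k l b) • x ∈ S := by
  have hpow : ∀ z : KLR D K ν, (∀ y ∈ S, z • y ∈ S) → ∀ n : ℕ, ∀ y ∈ S, z ^ n • y ∈ S := by
    intro z hz n
    induction n with
    | zero => simp
    | succ n ih => intro y hy; rw [pow_succ', mul_smul]; exact hz _ (ih y hy)
  unfold braidTerm
  split_ifs
  · rw [map_sum, Finset.sum_smul]
    refine sum_mem fun c _ => ?_
    rw [map_mul, map_mul, map_pow, map_pow, mul_smul, mul_smul]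
    exact hpow _ (hd a j [k, l]) _ _ (hpow _ (hd (a ++ [j, k]) l []) _ _ (hi _ _ hx))
  · simp

/-- The subspace spanned by the images of `N` under the diagrams `strand a b` with `b` of length at
most `k`. -/
def strandSpan (N : Submodule K V) (k : ℕ) : Submodule K V :=
  Submodule.span K {x | ∃ a b : List I, ∃ m ∈ N, b.length ≤ k ∧ x = strand D K ν i w a b • m}

variable {D K ν i w}

theorem strand_smul_mem {N : Submodule K V} {k : ℕ} {a b : List I} {m : V} (hm : m ∈ N)
    (hb : b.length ≤ k) : strand D K ν i w a b • m ∈ strandSpan D K ν i w N k :=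
  Submodule.subset_span ⟨a, b, m, hm, hb, rfl⟩

theorem strandSpan_mono (N : Submodule K V) : Monotone (strandSpan D K ν i w N) := by
  intro k k' h
  apply Submodule.span_mono
  rintro x ⟨a, b, m, hm, hb, rfl⟩
  exact ⟨a, b, m, hm, hb.trans h, rfl⟩

theorem idem_smul_strandSpan {N : Submodule K V} {k : ℕ} (l : List I) {x : V}
    (hx : x ∈ strandSpan D K ν i w N k) :
    gen D K ν (.idem l) • x ∈ strandSpan D K ν i w N k := by
  refine smul_mem_span_of_forall D K ν _ ?_ hx
  rintro _ ⟨a, b, m, hm, hb, rfl⟩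
  rw [← mul_smul]
  by_cases h : l = a ++ i :: (b ++ w)
  · rw [h, idem_mul_strand]
    exact strand_smul_mem hm hb
  · rw [← idem_mul_strand, ← mul_assoc, idem_mul_idem D K ν h, zero_mul, zero_smul]
    exact zero_mem _

end StrandSpan

end KLR

end

noncomputable section

namespace KLR

section StrandStable

variable {I : Type u} [DecidableEq I] {D : BorcherdsCartanDatum I} {K : Type v} [Field K]
  {ν : Multiset I} {i : I} {w : List I}
variable {V : Type w} [AddCommGroup V] [Module K V] [Module (KLR D K ν) V]
  [IsScalarTower K (KLR D K ν) V]

theorem gen_smul_strand_of_ne {g : KLRGen I} {a b : List I} (h : g.bot ≠ a ++ i :: (b ++ w))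
    (m : V) : gen D K ν g • strand D K ν i w a b • m = 0 := by
  rw [← idem_mul_strand, ← mul_smul, ← mul_assoc, gen_mul_idem D K ν h, zero_mul, zero_smul]

theorem dot_smul_mem_of_forall {N : Submodule K V} {k : ℕ}
    (h : ∀ b : List I, b.length ≤ k → ∀ (a p q : List I) (j : I), ∀ m ∈ N,
      gen D K ν (.dot p j (q ++ w)) • strand D K ν i w a b • m ∈ strandSpan D K ν i w N b.length)
    (p q : List I) (j : I) {x : V} (hx : x ∈ strandSpan D K ν i w N k) :
    gen D K ν (.dot p j (q ++ w)) • x ∈ strandSpan D K ν i w N k := by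
  refine smul_mem_span_of_forall D K ν _ ?_ hx
  rintro _ ⟨a, b, m, hm, hb, rfl⟩
  exact strandSpan_mono N hb (h b hb a p q j m hm)

theorem cross_smul_mem_of_forall {N : Submodule K V} {k : ℕ}
    (h : ∀ b : List I, b.length ≤ k → ∀ (a p q : List I) (j j' : I), ∀ m ∈ N,
      gen D K ν (.cross p j j' (q ++ w)) • strand D K ν i w a b • m
        ∈ strandSpan D K ν i w N (b.length + 1))
    (p q : List I) (j j' : I) {x : V} (hx : x ∈ strandSpan D K ν i w N k) :
    gen D K ν (.cross p j j' (q ++ w)) • x ∈ strandSpan D K ν i w N (k + 1) := by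
  refine smul_mem_span_of_forall D K ν _ ?_ hx
  rintro _ ⟨a, b, m, hm, hb, rfl⟩
  exact strandSpan_mono N (by omega) (h b hb a p q j j' m hm)

/-- Strong form of the stability of `∑ strand a b • N`, with control on the length of `b`. -/
theorem strand_stable_aux {N : Submodule K V}
    (hN : ∀ g, ∀ m ∈ N, gen D K ν (KLRGen.app (i :: w) g) • m ∈ N)
    (hd : ∀ l, ∀ m ∈ N, gen D K ν (.dot l i w) • m ∈ N) (n : ℕ) :
    ∀ b : List I, b.length ≤ n →
      (∀ (a p q : List I) (j : I), ∀ m ∈ N,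
        gen D K ν (.dot p j (q ++ w)) • strand D K ν i w a b • m
          ∈ strandSpan D K ν i w N b.length) ∧
      (∀ (a p q : List I) (j j' : I), ∀ m ∈ N,
        gen D K ν (.cross (a ++ i :: p) j j' (q ++ w)) • strand D K ν i w a b • m
          ∈ strandSpan D K ν i w N b.length) ∧
      (∀ (a p q : List I) (j j' : I), ∀ m ∈ N,
        gen D K ν (.cross p j j' (q ++ w)) • strand D K ν i w a b • m
          ∈ strandSpan D K ν i w N (b.length + 1)) := by
  induction n using Nat.strong_induction_on with
  | _ n ih =>
  intro b hbn
  have hdot : ∀ b' : List I, b'.length < b.length → ∀ (k : ℕ), k = b'.length →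
      ∀ (p q : List I) (j : I), ∀ x ∈ strandSpan D K ν i w N k,
      gen D K ν (.dot p j (q ++ w)) • x ∈ strandSpan D K ν i w N k := by
    rintro b' hb' k rfl p q j x hx
    exact dot_smul_mem_of_forall
      (fun b'' hb'' => (ih b'.length (by omega) b'' hb'').1) p q j hx
  have hcross : ∀ b' : List I, b'.length < b.length → ∀ (k : ℕ), k = b'.length →
      ∀ (p q : List I) (j j' : I), ∀ x ∈ strandSpan D K ν i w N k,
      gen D K ν (.cross p j j' (q ++ w)) • x ∈ strandSpan D K ν i w N (k + 1) := by
    rintro b' hb' k rfl p q j j' x hx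
    exact cross_smul_mem_of_forall
      (fun b'' hb'' => (ih b'.length (by omega) b'' hb'').2.2) p q j j' hx
  have hD : ∀ (a p q : List I) (j : I), ∀ m ∈ N,
        gen D K ν (.dot p j (q ++ w)) • strand D K ν i w a b • m
          ∈ strandSpan D K ν i w N b.length := by
    intro a p q j m hm
    by_cases hw : p ++ j :: (q ++ w) = a ++ i :: (b ++ w)
    swap
    · rw [gen_smul_strand_of_ne (by simpa using hw)]; exact zero_mem _
    have hw' : p ++ j :: q = a ++ i :: b := by
      apply List.append_cancel_right (bs := w); simpa using hw
    have on_i : gen D K ν (.dot a i (b ++ w)) • strand D K ν i w a b • m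
        ∈ strandSpan D K ν i w N b.length := by
      cases b with
      | nil =>
        have h1 : gen D K ν (.idem (a ++ i :: w)) • m ∈ N := hN (.idem a) m hm
        have h2 := idem_mul_gen_self D K ν (g := .dot a i w) (l := a ++ i :: w) rfl
        rw [strand, List.nil_append, ← h2, mul_smul]
        exact strand_smul_mem (b := []) (hd a _ h1) le_rfl
      | cons c b =>
        rw [strand, mul_smul, ← mul_smul, List.cons_append, slide_left, add_smul, mul_smul]
        have h1 : strand D K ν i w (a ++ [c]) b • m ∈ strandSpan D K ν i w N b.length :=
          strand_smul_mem hm le_rfl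
        refine add_mem ?_ ?_
        · exact hcross b (by simp) _ rfl _ _ _ _ _ (hdot b (by simp) _ rfl _ _ _ _ h1)
        · exact strandSpan_mono N (by simp) (slideTerm_smul_mem D K ν a (b ++ w) c i h1
            fun l y hy => idem_smul_strandSpan l hy)
    rcases List.append_eq_append_iff.mp hw' with ⟨s, hs1, hs2⟩ | ⟨s, hs1, hs2⟩
    · rcases s with _ | ⟨c, s⟩
      · simp only [List.nil_append, List.cons.injEq, List.append_nil] at hs1 hs2
        obtain ⟨rfl, rfl⟩ := hs2
        subst hs1
        exact on_i
      · simp only [List.cons_append, List.cons.injEq] at hs2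
        obtain ⟨rfl, rfl⟩ := hs2
        subst hs1
        have h1 := strand_left D K ν i w (.dot p j s) b
        simp only [KLRGen.app_dot, KLRGen.bot_dot, KLRGen.top_dot] at h1
        rw [← mul_smul, List.append_assoc, List.cons_append, h1, mul_smul]
        refine strand_smul_mem ?_ le_rfl
        simpa using hN (.dot p j (s ++ b)) m hm
    · rcases s with _ | ⟨c, s⟩
      · simp only [List.nil_append, List.cons.injEq, List.append_nil] at hs1 hs2
        obtain ⟨rfl, rfl⟩ := hs2
        subst hs1
        exact on_i
      · simp only [List.cons_append, List.cons.injEq] at hs2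
        obtain ⟨rfl, rfl⟩ := hs2
        subst hs1
        rcases s with _ | ⟨c, s⟩
        · have h1 : strand D K ν i w (a ++ [j]) q • m ∈ strandSpan D K ν i w N q.length :=
            strand_smul_mem hm le_rfl
          rw [List.nil_append, strand, mul_smul, ← mul_smul, slide_right, sub_smul, mul_smul]
          refine sub_mem ?_ ?_
          · exact hcross q (by simp) _ rfl _ _ _ _ _
              (hdot q (by simp) _ rfl _ (i :: q) _ _ h1)
          · exact strandSpan_mono N (by simp) (slideTerm_smul_mem D K ν a (q ++ w) j i h1
              fun l y hy => idem_smul_strandSpan l hy)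
        · have h1 := app_mul_pre D K ν (.cross a c i s) (.dot [] j (q ++ w))
          simp only [KLRGen.app_cross, KLRGen.pre_dot, KLRGen.top_cross, KLRGen.bot_cross,
            KLRGen.top_dot, KLRGen.bot_dot, List.nil_append, List.append_nil] at h1
          have h2 : strand D K ν i w (a ++ [c]) (s ++ j :: q) • m
              ∈ strandSpan D K ν i w N (s ++ j :: q).length := strand_smul_mem hm le_rfl
          rw [List.cons_append, strand, mul_smul, ← mul_smul, List.append_assoc,
            List.cons_append, ← h1, mul_smul]
          refine hcross (s ++ j :: q) (by simp) _ rfl a (s ++ j :: q) c i _ ?_ |> fun h => by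
            simpa using h
          exact hdot (s ++ j :: q) (by simp) _ rfl _ _ _ _ h2
  have hB : ∀ (a p q : List I) (j j' : I), ∀ m ∈ N,
        gen D K ν (.cross (a ++ i :: p) j j' (q ++ w)) • strand D K ν i w a b • m
          ∈ strandSpan D K ν i w N b.length := by
    intro a p q j j' m hm
    by_cases hw : (a ++ i :: p) ++ j :: j' :: (q ++ w) = a ++ i :: (b ++ w)
    swap
    · rw [gen_smul_strand_of_ne (by simpa using hw)]; exact zero_mem _
    obtain rfl : b = p ++ j :: j' :: q := by
      apply List.append_cancel_right (bs := w); simpa using hw.symm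
    rcases p with _ | ⟨c, p⟩
    · have h1 := braid D K ν a (q ++ w) j j' i
      have h3 := strand_left D K ν i w (.cross a j j' []) q
      simp only [KLRGen.app_cross, KLRGen.top_cross, KLRGen.bot_cross, List.nil_append] at h3
      have h2 : strand D K ν i w (a ++ [j, j']) q • m ∈ strandSpan D K ν i w N q.length :=
        strand_smul_mem hm le_rfl
      have h4 : gen D K ν (.cross a j j' (q ++ i :: w)) • m ∈ N := by
        simpa using hN (.cross a j j' q) m hm
      have h5 : gen D K ν (.cross (a ++ i :: []) j j' (q ++ w)) •
          strand D K ν i w a ([] ++ j :: j' :: q) • m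
          = strand D K ν i w a (j' :: j :: q) • gen D K ν (.cross a j j' (q ++ i :: w)) • m
            - mk D K ν (braidTerm D K a j j' i (q ++ w)) • strand D K ν i w (a ++ [j, j']) q • m := by
        simp only [List.nil_append, strand, List.append_assoc, List.cons_append, ← mul_smul]
        rw [← sub_smul]
        congr 1
        simp only [← mul_assoc]
        rw [h1, sub_mul, sub_left_inj]
        simp only [mul_assoc]
        rw [h3]
      rw [h5]
      refine sub_mem (strand_smul_mem h4 (by simp)) ?_
      refine strandSpan_mono N (by simp; omega) (braidTerm_smul_mem D K ν a (q ++ w) j j' i h2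
        (fun l y hy => idem_smul_strandSpan l hy) ?_)
      intro p' c q' y hy
      rw [← List.append_assoc]
      exact hdot q (by simp) _ rfl _ _ _ _ hy
    · have h1 := app_mul_pre D K ν (.cross a c i p) (.cross [] j j' (q ++ w))
      simp only [KLRGen.app_cross, KLRGen.pre_cross, KLRGen.top_cross, KLRGen.bot_cross,
        List.nil_append, List.append_nil] at h1
      have h2 := (ih (p ++ j :: j' :: q).length (by simp at hbn ⊢; omega) (p ++ j :: j' :: q)
        le_rfl).2.1 (a ++ [c]) p q j j' m hm
      rw [List.cons_append, strand, mul_smul, ← mul_smul, List.append_assoc,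
        List.cons_append, List.cons_append, ← h1, mul_smul]
      refine hcross (p ++ j :: j' :: q) (by simp) _ rfl a (p ++ j' :: j :: q) c i _ ?_ |> fun h => by
            simpa using h
      simpa using h2
  refine ⟨hD, hB, ?_⟩
  intro a p q j j' m hm
  by_cases hw : p ++ j :: j' :: (q ++ w) = a ++ i :: (b ++ w)
  swap
  · rw [gen_smul_strand_of_ne (by simpa using hw)]; exact zero_mem _
  have hw' : p ++ j :: j' :: q = a ++ i :: b := by
    apply List.append_cancel_right (bs := w); simpa using hw
  have at_i : ∀ q', b = j' :: q' → gen D K ν (.cross a i j' (q' ++ w)) • strand D K ν i w a b • m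
      ∈ strandSpan D K ν i w N (b.length + 1) := by
    rintro q' rfl
    have h1 : strand D K ν i w (a ++ [j']) q' • m ∈ strandSpan D K ν i w N q'.length :=
      strand_smul_mem hm le_rfl
    rw [strand, mul_smul, ← mul_smul, quadratic]
    refine strandSpan_mono N (by simp; omega) (doubleCross_smul_mem D K ν a (q' ++ w) j' i h1
      (fun l y hy => idem_smul_strandSpan l hy) fun p' c q'' y hy => ?_)
    rw [← List.append_assoc]
    exact hdot q' (by simp) _ rfl _ _ _ _ hy
  rcases List.append_eq_append_iff.mp hw' with ⟨s, hs1, hs2⟩ | ⟨s, hs1, hs2⟩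
  · rcases s with _ | ⟨c, s⟩
    · simp only [List.nil_append, List.cons.injEq, List.append_nil] at hs1 hs2
      obtain ⟨rfl, hb⟩ := hs2
      subst hs1
      exact at_i q hb.symm
    · simp only [List.cons_append, List.cons.injEq] at hs2
      obtain ⟨rfl, hs2⟩ := hs2
      subst hs1
      rcases s with _ | ⟨c, s⟩
      · simp only [List.nil_append, List.cons.injEq] at hs2
        obtain ⟨rfl, rfl⟩ := hs2
        rw [← mul_smul]
        exact strand_smul_mem (a := p) (b := j :: q) hm (by simp)
      · simp only [List.cons_append, List.cons.injEq] at hs2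
        obtain ⟨rfl, rfl⟩ := hs2
        have h1 := strand_left D K ν i w (.cross p j j' s) b
        simp only [KLRGen.app_cross, KLRGen.bot_cross, KLRGen.top_cross] at h1
        rw [← mul_smul, List.append_assoc, List.cons_append, h1, mul_smul]
        refine strand_smul_mem ?_ (by simp)
        simpa using hN (.cross p j j' (s ++ b)) m hm
  · rcases s with _ | ⟨c, s⟩
    · simp only [List.nil_append, List.cons.injEq, List.append_nil] at hs1 hs2
      obtain ⟨rfl, hb⟩ := hs2
      subst hs1
      exact at_i q hb
    · simp only [List.cons_append, List.cons.injEq] at hs2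
      obtain ⟨rfl, rfl⟩ := hs2
      subst hs1
      exact strandSpan_mono N (by simp) (hB a s q j j' m hm)

variable (D K ν i w) in
/-- The subspace `∑ strand a b • N`. -/
def strandImage (N : Submodule K V) : Submodule K V :=
  ⨆ k, strandSpan D K ν i w N k

theorem mem_strandImage {N : Submodule K V} {x : V} :
    x ∈ strandImage D K ν i w N ↔ ∃ k, x ∈ strandSpan D K ν i w N k :=
  Submodule.mem_iSup_of_directed _ (strandSpan_mono N).directed_le

theorem strandImage_induction {N : Submodule K V} {T : Submodule K V}
    (h : ∀ a b : List I, ∀ m ∈ N, strand D K ν i w a b • m ∈ T) : strandImage D K ν i w N ≤ T := by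
  refine iSup_le fun k => Submodule.span_le.mpr ?_
  rintro _ ⟨a, b, m, hm, -, rfl⟩
  exact h a b m hm

theorem strand_smul_mem_strandImage {N : Submodule K V} {a b : List I} {m : V} (hm : m ∈ N) :
    strand D K ν i w a b • m ∈ strandImage D K ν i w N :=
  mem_strandImage.mpr ⟨_, strand_smul_mem hm le_rfl⟩

theorem smul_mem_strandImage {N T : Submodule K V} (z : KLR D K ν)
    (h : ∀ a b : List I, ∀ m ∈ N, z • strand D K ν i w a b • m ∈ T) {x : V}
    (hx : x ∈ strandImage D K ν i w N) : z • x ∈ T := by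
  obtain ⟨k, hk⟩ := mem_strandImage.mp hx
  refine smul_mem_span_of_forall D K ν z ?_ hk
  rintro _ ⟨a, b, m, hm, -, rfl⟩
  exact h a b m hm

/-- If `N` is stable under diagrams with fixed strands `i :: w` at the right and under dots on the
strand `i`, then `∑ strand a b • N` is stable under diagrams with fixed strands `w` at the
right. -/
theorem strandImage_stable {N : Submodule K V}
    (hN : ∀ g, ∀ m ∈ N, gen D K ν (KLRGen.app (i :: w) g) • m ∈ N)
    (hd : ∀ l, ∀ m ∈ N, gen D K ν (.dot l i w) • m ∈ N) (g : KLRGen I) {x : V}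
    (hx : x ∈ strandImage D K ν i w N) :
    gen D K ν (g.app w) • x ∈ strandImage D K ν i w N := by
  refine smul_mem_strandImage _ (fun a b m hm => ?_) hx
  have h := strand_stable_aux hN hd b.length b le_rfl
  rcases g with l | ⟨p, j, q⟩ | ⟨p, j, j', q⟩
  · exact mem_strandImage.mpr ⟨_, idem_smul_strandSpan _ (strand_smul_mem hm le_rfl)⟩
  · exact mem_strandImage.mpr ⟨_, h.1 a p q j m hm⟩
  · exact mem_strandImage.mpr ⟨_, h.2.2 a p q j j' m hm⟩

end StrandStable

end KLR

end

noncomputable section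

/-- Deleting a letter `i` from a word which ends in `i ^ (n + 1)`. -/
theorem append_cons_eq_append_replicate {I : Type u} {i : I} {a b l : List I} {n : ℕ}
    (h : a ++ i :: b = l ++ List.replicate (n + 1) i) :
    (∃ j k, j + k = n ∧ b = List.replicate j i ∧ a = l ++ List.replicate k i) ∨
      ∃ l', a ++ b = l' ++ List.replicate (n + 1) i := by
  rcases List.append_eq_append_iff.mp h with ⟨s, hs1, hs2⟩ | ⟨s, hs1, hs2⟩
  · rcases s with _ | ⟨c, s⟩
    · left
      rw [List.replicate_succ] at hs2
      simp only [List.nil_append, List.cons.injEq, true_and, List.append_nil] at hs1 hs2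
      exact ⟨n, 0, rfl, hs2, by simp [hs1]⟩
    · right
      simp only [List.cons_append, List.cons.injEq] at hs2
      exact ⟨a ++ s, by rw [hs2.2, List.append_assoc]⟩
  · left
    have h1 := List.eq_replicate_iff.mp hs2.symm
    have hlen := h1.1
    simp only [List.length_append, List.length_cons] at hlen
    refine ⟨b.length, s.length, by omega, ?_, ?_⟩
    · exact List.eq_replicate_iff.mpr ⟨rfl, fun c hc => h1.2 c (by simp [hc])⟩
    · rw [hs1]
      congr 1
      exact List.eq_replicate_iff.mpr ⟨rfl, fun c hc => h1.2 c (by simp [hc])⟩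

namespace KLR

variable {I : Type u} [DecidableEq I] (D : BorcherdsCartanDatum I) (K : Type v) [Field K]
  (ν : Multiset I)

/-- The sum of all diagrams in `R(ν)` which are obtained from `h` by adding vertical strands at
the left. -/
def rightOp (h : KLRGen I) : KLR D K ν :=
  ∑ l ∈ wordsOf (ν - (h.bot : Multiset I)), gen D K ν (h.pre l)

theorem mem_wordsOf_sub {l u : List I} (h : l ++ u ∈ wordsOf ν) :
    l ∈ wordsOf (ν - (u : Multiset I)) := by
  rw [mem_wordsOf] at h ⊢
  rw [← h, ← Multiset.coe_add, add_tsub_cancel_right]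

theorem coe_top (h : KLRGen I) : (h.top : Multiset I) = h.bot := by
  rcases h with l | ⟨a, i, b⟩ | ⟨a, i, j, b⟩
  · rfl
  · rfl
  · rw [Multiset.coe_eq_coe]
    exact (List.Perm.swap i j b).append_left a

theorem rightOp_mul_gen {h x : KLRGen I} {l : List I} (hx : x.top = l ++ h.bot) :
    rightOp D K ν h * gen D K ν x = gen D K ν (h.pre l) * gen D K ν x := by
  rw [← top_mul_gen D K ν x, ← mul_assoc, ← mul_assoc]
  congr 1
  rw [hx]
  by_cases hl : l ∈ wordsOf (ν - (h.bot : Multiset I))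
  · rw [rightOp, Finset.sum_mul, Finset.sum_eq_single_of_mem l hl]
    intro m _ hm
    apply gen_mul_idem
    simpa using hm
  · rw [idem_outside, mul_zero, mul_zero]
    exact fun h1 => hl (mem_wordsOf_sub ν h1)

theorem gen_mul_rightOp {h x : KLRGen I} {l : List I} (hx : x.bot = l ++ h.top) :
    gen D K ν x * rightOp D K ν h = gen D K ν x * gen D K ν (h.pre l) := by
  rw [← gen_mul_bot D K ν x, mul_assoc, mul_assoc]
  congr 1
  rw [hx]
  by_cases hl : l ∈ wordsOf (ν - (h.bot : Multiset I))
  · rw [rightOp, Finset.mul_sum, Finset.sum_eq_single_of_mem l hl]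
    intro m _ hm
    apply idem_mul_gen
    simpa using hm.symm
  · rw [idem_outside, zero_mul, zero_mul]
    intro h1
    apply hl
    rw [← coe_top]
    exact mem_wordsOf_sub ν h1

theorem rightOp_mul_idem (h : KLRGen I) (l : List I) :
    rightOp D K ν h * gen D K ν (.idem (l ++ h.bot)) = gen D K ν (h.pre l) := by
  rw [rightOp_mul_gen D K ν (l := l) rfl, gen_mul_idem_self]
  simp

theorem gen_app_mul_rightOp (g h : KLRGen I) :
    gen D K ν (g.app h.top) * rightOp D K ν h = rightOp D K ν h * gen D K ν (g.app h.bot) := by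
  rw [gen_mul_rightOp D K ν (l := g.bot) (by simp), app_mul_pre,
    rightOp_mul_gen D K ν (l := g.top) (by simp)]

theorem rightOp_mul_strand (i : I) (u : List I) {h : KLRGen I} (hh : h.top = h.bot)
    (a b : List I) :
    rightOp D K ν h * strand D K ν i (u ++ h.bot) a b
      = strand D K ν i (u ++ h.bot) a b * rightOp D K ν h := by
  have h1 := strand_right D K ν i (h.pre u) a b
  simp only [KLRGen.bot_pre, KLRGen.top_pre, hh, KLRGen.pre_pre] at h1
  have h2 := rightOp_mul_gen D K ν (h := h)
    (x := .idem (a ++ i :: (b ++ (u ++ h.bot)))) (l := a ++ i :: b ++ u) (by simp)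
  have h3 := gen_mul_rightOp D K ν (h := h)
    (x := .idem (a ++ (b ++ i :: (u ++ h.bot)))) (l := a ++ (b ++ [i]) ++ u) (by simp [hh])
  rw [← idem_mul_strand, ← mul_assoc, h2, mul_assoc, idem_mul_strand, h1, ← strand_mul_idem,
    mul_assoc, mul_assoc, h3]

theorem rightOp_mem_homogeneous (h : KLRGen I) :
    rightOp D K ν h ∈ homogeneous D K ν (h.deg D) := by
  refine sum_mem fun l _ => ?_
  have : (h.pre l).deg D = h.deg D := by cases h <;> rfl
  rw [← this]
  exact gen_mem_homogeneous D K ν _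

/-- The sum of all diagrams with a dot on the strand `s` from the right, this strand and all
strands to its right having the label `i`. -/
def tailDot (i : I) (s : ℕ) : KLR D K ν := rightOp D K ν (.dot [] i (List.replicate s i))

/-- The sum of all diagrams with a crossing of the strands `s` and `s + 1` from the right, these
strands and all strands to their right having the label `i`. -/
def tailCross (i : I) (s : ℕ) : KLR D K ν := rightOp D K ν (.cross [] i i (List.replicate s i))

theorem tailDot_mem (i : I) (s : ℕ) :
    tailDot D K ν i s ∈ homogeneous D K ν (2 * (D.r i : ℤ)) := by
  have h := rightOp_mem_homogeneous D K ν (.dot [] i (List.replicate s i))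
  rwa [KLRGen.deg] at h

theorem tailCross_mem (i : I) (s : ℕ) :
    tailCross D K ν i s ∈ homogeneous D K ν (- D.form i i) := by
  have h := rightOp_mem_homogeneous D K ν (.cross [] i i (List.replicate s i))
  rwa [KLRGen.deg] at h

end KLR

namespace GrMod

open KLR

variable {I : Type u} [DecidableEq I] {D : BorcherdsCartanDatum I} {K : Type v} [Field K]
variable {ν : Multiset I} (M : GrMod.{u, v, w} D K ν)

/-- The subspace of `M` spanned by the images of the idempotents of all words ending in `w`. -/
def tailSpan (w : List I) : Submodule K M.carrier :=
  Submodule.span K {x | ∃ l m, x = gen D K ν (.idem (l ++ w)) • m}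

variable {M}

theorem idem_smul_mem_tailSpan (l w : List I) (m : M.carrier) :
    gen D K ν (.idem (l ++ w)) • m ∈ M.tailSpan w :=
  Submodule.subset_span ⟨l, m, rfl⟩

theorem eq_sum_idem (x : M.carrier) : x = ∑ u ∈ wordsOf ν, gen D K ν (.idem u) • x := by
  rw [← Finset.sum_smul, sum_idem, one_smul]

theorem idem_smul_eq_zero_of_mem_tailSpan {w u : List I} (h : ∀ l, u ≠ l ++ w) {x : M.carrier}
    (hx : x ∈ M.tailSpan w) : gen D K ν (.idem u) • x = 0 := by
  rw [← Submodule.mem_bot K]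
  refine smul_mem_span_of_forall D K ν _ ?_ hx
  rintro _ ⟨l, m, rfl⟩
  rw [← mul_smul, idem_mul_idem D K ν (h l), zero_smul]
  exact zero_mem _

/-- A vector of `M.tailSpan w` is the sum of its components for the words ending in `w`. -/
theorem mem_of_idem_smul_mem {w : List I} {x : M.carrier} (hx : x ∈ M.tailSpan w)
    {S : Submodule K M.carrier} (h : ∀ l, gen D K ν (.idem (l ++ w)) • x ∈ S) : x ∈ S := by
  rw [eq_sum_idem x]
  refine sum_mem fun u _ => ?_
  by_cases hu : ∃ l, u = l ++ w
  · obtain ⟨l, rfl⟩ := hu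
    exact h l
  · push Not at hu
    rw [idem_smul_eq_zero_of_mem_tailSpan hu hx]
    exact zero_mem _

theorem eq_zero_of_idem_smul {w : List I} {x : M.carrier} (hx : x ∈ M.tailSpan w)
    (h : ∀ l, gen D K ν (.idem (l ++ w)) • x = 0) : x = 0 := by
  rw [← Submodule.mem_bot K]
  exact mem_of_idem_smul_mem hx fun l => (Submodule.mem_bot K).mpr (h l)

theorem tailSpan_append_le (u w : List I) : M.tailSpan (u ++ w) ≤ M.tailSpan w := by
  refine Submodule.span_le.mpr ?_
  rintro _ ⟨l, m, rfl⟩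
  rw [← List.append_assoc]
  exact idem_smul_mem_tailSpan _ _ _

theorem tailSpan_replicate_le (i : I) {m n : ℕ} (h : m ≤ n) :
    M.tailSpan (List.replicate n i) ≤ M.tailSpan (List.replicate m i) := by
  have := M.tailSpan_append_le (List.replicate (n - m) i) (List.replicate m i)
  rwa [List.replicate_append_replicate, Nat.sub_add_cancel h] at this

theorem gen_app_smul_mem_tailSpan (w : List I) (g : KLRGen I) (x : M.carrier) :
    gen D K ν (g.app w) • x ∈ M.tailSpan w := by
  rw [← idem_mul_gen_self D K ν (KLRGen.top_app w g).symm, mul_smul]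
  exact idem_smul_mem_tailSpan _ _ _

/-- Two elements of `R(ν)` which agree on the idempotents of all words ending in `w` act in the same
way on `M.tailSpan w`. -/
theorem smul_congr_of_mem_tailSpan {w : List I} {y z : KLR D K ν}
    (h : ∀ l, y * gen D K ν (.idem (l ++ w)) = z * gen D K ν (.idem (l ++ w))) {x : M.carrier}
    (hx : x ∈ M.tailSpan w) : y • x = z • x := by
  induction hx using Submodule.span_induction with
  | mem x hx => obtain ⟨l, m, rfl⟩ := hx; rw [← mul_smul, h, mul_smul]
  | zero => simp
  | add x y _ _ hx hy => rw [smul_add, smul_add, hx, hy]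
  | smul c x _ hx => rw [smul_comm, hx, smul_comm]

variable (M) in
/-- A subspace which is spanned by its homogeneous elements. -/
def IsHomog (S : Submodule K M.carrier) : Prop := S ≤ ⨆ d, S ⊓ M.gr d

theorem iSup_gr : ⨆ d, M.gr d = ⊤ :=
  ((DirectSum.isInternal_submodule_iff_iSupIndep_and_iSup_eq_top _).mp M.isInternal).2

theorem IsHomog.smul_mem_iSup {S T : Submodule K M.carrier} (hS : M.IsHomog S) {e : ℤ}
    {z : KLR D K ν} (hz : z ∈ homogeneous D K ν e) (h : ∀ m ∈ S, z • m ∈ T) {m : M.carrier}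
    (hm : m ∈ S) : z • m ∈ ⨆ d, T ⊓ M.gr d := by
  have hm' := hS hm
  induction hm' using Submodule.iSup_induction' with
  | mem d x hx => exact Submodule.mem_iSup_of_mem (e + d) ⟨h x hx.1, M.smul_mem e d z x hz hx.2⟩
  | zero => simp
  | add x y hx' hy' hx hy =>
    have hle : ⨆ d, S ⊓ M.gr d ≤ S := iSup_le fun _ => inf_le_left
    rw [smul_add]
    exact add_mem (hx (hle hx')) (hy (hle hy'))

theorem isHomog_top : M.IsHomog ⊤ := by
  simp only [IsHomog, top_inf_eq, iSup_gr, le_refl]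

theorem isHomog_iSup {ι : Sort*} {S : ι → Submodule K M.carrier} (h : ∀ j, M.IsHomog (S j)) :
    M.IsHomog (⨆ j, S j) :=
  iSup_le fun j => (h j).trans (iSup_mono fun _ => inf_le_inf_right _ (le_iSup S j))

theorem isHomog_span {s : Set M.carrier} (h : ∀ x ∈ s, x ∈ ⨆ d, Submodule.span K s ⊓ M.gr d) :
    M.IsHomog (Submodule.span K s) :=
  Submodule.span_le.mpr h

theorem isHomog_tailSpan (w : List I) : M.IsHomog (M.tailSpan w) := by
  apply isHomog_span
  rintro _ ⟨l, m, rfl⟩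
  exact isHomog_top.smul_mem_iSup (T := M.tailSpan w) (gen_mem_homogeneous D K ν _)
    (fun m _ => idem_smul_mem_tailSpan l w m) Submodule.mem_top

variable (M) in
/-- The subspaces of `M` which correspond to the graded submodules of the restriction of `M` to
diagrams with vertical strands labelled `w` at the far right. -/
structure IsLevelSub (w : List I) (S : Submodule K M.carrier) : Prop where
  le : S ≤ M.tailSpan w
  stable : ∀ g, ∀ m ∈ S, gen D K ν (KLRGen.app w g) • m ∈ S
  homog : M.IsHomog S

theorem IsLevelSub.idem_smul_mem {w : List I} {S : Submodule K M.carrier}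
    (hS : M.IsLevelSub w S) (u : List I) {x : M.carrier} (hx : x ∈ S) :
    gen D K ν (.idem u) • x ∈ S := by
  by_cases hu : ∃ l, u = l ++ w
  · obtain ⟨l, rfl⟩ := hu
    exact hS.stable (.idem l) x hx
  · push Not at hu
    rw [idem_smul_eq_zero_of_mem_tailSpan hu (hS.le hx)]
    exact zero_mem _

theorem isLevelSub_tailSpan (w : List I) : M.IsLevelSub w (M.tailSpan w) where
  le := le_rfl
  stable g m _ := gen_app_smul_mem_tailSpan w g m
  homog := isHomog_tailSpan w

theorem IsLevelSub.strandImage {i : I} {w : List I} {S : Submodule K M.carrier}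
    (hS : M.IsLevelSub (i :: w) S) (hd : ∀ l, ∀ m ∈ S, gen D K ν (.dot l i w) • m ∈ S) :
    M.IsLevelSub w (strandImage D K ν i w S) where
  le := by
    refine strandImage_induction fun a b m _ => ?_
    rw [← idem_mul_strand, mul_smul]
    have : a ++ i :: (b ++ w) = (a ++ i :: b) ++ w := by simp
    rw [this]
    exact idem_smul_mem_tailSpan _ _ _
  stable g m hm := strandImage_stable hS.stable hd g hm
  homog := by
    refine strandImage_induction fun a b m hm => ?_
    obtain ⟨d, hd⟩ := exists_strand_mem_homogeneous D K ν i w a b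
    exact hS.homog.smul_mem_iSup hd (fun m hm => strand_smul_mem_strandImage hm) hm

theorem IsLevelSub.le_strandImage {i : I} {w : List I} {S : Submodule K M.carrier}
    (hS : M.IsLevelSub (i :: w) S) : S ≤ KLR.strandImage D K ν i w S := by
  intro x hx
  refine mem_of_idem_smul_mem (hS.le hx) fun l => ?_
  exact strand_smul_mem_strandImage (a := l) (b := []) hx

section Replicate

variable {i : I}

theorem tailDot_smul_idem {s : ℕ} (l : List I) (x : M.carrier) :
    tailDot D K ν i s • gen D K ν (.idem (l ++ List.replicate (s + 1) i)) • x
      = gen D K ν (.dot l i (List.replicate s i)) • x := by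
  have := rightOp_mul_idem D K ν (.dot [] i (List.replicate s i)) l
  simp only [KLRGen.bot_dot, KLRGen.pre_dot, List.nil_append, List.append_nil] at this
  rw [tailDot, List.replicate_succ, ← mul_smul, this]

theorem tailCross_smul_idem {s : ℕ} (l : List I) (x : M.carrier) :
    tailCross D K ν i s • gen D K ν (.idem (l ++ List.replicate (s + 2) i)) • x
      = gen D K ν (.cross l i i (List.replicate s i)) • x := by
  have := rightOp_mul_idem D K ν (.cross [] i i (List.replicate s i)) l
  simp only [KLRGen.bot_cross, KLRGen.pre_cross, List.nil_append, List.append_nil] at this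
  rw [tailCross, List.replicate_succ, List.replicate_succ, ← mul_smul, this]

theorem gen_app_mul_tailDot (g : KLRGen I) {s n : ℕ} (h : s < n) :
    gen D K ν (g.app (List.replicate n i)) * tailDot D K ν i s
      = tailDot D K ν i s * gen D K ν (g.app (List.replicate n i)) := by
  have h1 := gen_app_mul_rightOp D K ν (g.app (List.replicate (n - (s + 1)) i))
    (.dot [] i (List.replicate s i))
  simp only [KLRGen.top_dot, KLRGen.bot_dot, List.nil_append, ← List.replicate_succ,
    KLRGen.app_app, List.replicate_append_replicate, Nat.sub_add_cancel (show s + 1 ≤ n from h)] at h1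
  exact h1

theorem gen_app_mul_tailCross (g : KLRGen I) {s n : ℕ} (h : s + 1 < n) :
    gen D K ν (g.app (List.replicate n i)) * tailCross D K ν i s
      = tailCross D K ν i s * gen D K ν (g.app (List.replicate n i)) := by
  have h1 := gen_app_mul_rightOp D K ν (g.app (List.replicate (n - (s + 2)) i))
    (.cross [] i i (List.replicate s i))
  simp only [KLRGen.top_cross, KLRGen.bot_cross, List.nil_append, ← List.replicate_succ,
    KLRGen.app_app, List.replicate_append_replicate,
    Nat.sub_add_cancel (show s + 1 + 1 ≤ n from h)] at h1
  exact h1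

theorem tailDot_mul_strand {s n : ℕ} (h : s < n) (a b : List I) :
    tailDot D K ν i s * strand D K ν i (List.replicate n i) a b
      = strand D K ν i (List.replicate n i) a b * tailDot D K ν i s := by
  have h1 := rightOp_mul_strand D K ν i (List.replicate (n - (s + 1)) i)
    (h := .dot [] i (List.replicate s i)) rfl a b
  simp only [KLRGen.bot_dot, List.nil_append, ← List.replicate_succ,
    List.replicate_append_replicate, Nat.sub_add_cancel (show s + 1 ≤ n from h)] at h1
  exact h1

/-- If no word of `S` ends in `i ^ q`, then the same holds for `∑ strand a b • S`. -/
theorem idem_smul_strandImage_eq_zero {S : Submodule K M.carrier} {n q : ℕ} (hq : n + 1 < q)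
    (hS : ∀ l, ∀ m ∈ S, gen D K ν (.idem (l ++ List.replicate q i)) • m = 0) (l : List I)
    {x : M.carrier} (hx : x ∈ strandImage D K ν i (List.replicate n i) S) :
    gen D K ν (.idem (l ++ List.replicate q i)) • x = 0 := by
  rw [← Submodule.mem_bot K]
  refine smul_mem_strandImage _ (fun a b m hm => ?_) hx
  rw [Submodule.mem_bot]
  obtain ⟨p, rfl⟩ : ∃ p, q = p + 1 + 1 + n := ⟨q - 2 - n, by omega⟩
  by_cases h : l ++ List.replicate (p + 1 + 1 + n) i = a ++ i :: (b ++ List.replicate n i)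
  swap
  · exact gen_smul_strand_of_ne (g := .idem _) h m
  have h' : a ++ i :: b = l ++ List.replicate (p + 1 + 1) i := by
    apply List.append_cancel_right (bs := List.replicate n i)
    rw [List.append_assoc l, List.replicate_append_replicate, h]; simp
  obtain ⟨l', hl'⟩ : ∃ l', a ++ b = l' ++ List.replicate (p + 1) i := by
    rcases append_cons_eq_append_replicate h' with ⟨j, k, hjk, rfl, rfl⟩ | ⟨l', hl'⟩
    · exact ⟨l, by rw [List.append_assoc, List.replicate_append_replicate, add_comm k, hjk]⟩
    · exact ⟨l' ++ [i], by rw [hl', List.replicate_succ]; simp⟩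
  have h2 : a ++ (b ++ i :: List.replicate n i) = l' ++ List.replicate (p + 1 + 1 + n) i := by
    rw [← List.append_assoc, hl', ← List.replicate_succ, List.append_assoc,
      List.replicate_append_replicate]
    congr 2; omega
  rw [← strand_mul_idem, mul_smul, h2, hS l' m hm, smul_zero, smul_zero]

theorem exists_isLevelSub_nil_of_idem_smul_eq_zero {q n : ℕ} (hq : n < q)
    {S : Submodule K M.carrier} (hS : M.IsLevelSub (List.replicate n i) S)
    (h : ∀ l, ∀ m ∈ S, gen D K ν (.idem (l ++ List.replicate q i)) • m = 0) :
    ∃ T, M.IsLevelSub [] T ∧ S ≤ T ∧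
      ∀ l, ∀ m ∈ T, gen D K ν (.idem (l ++ List.replicate q i)) • m = 0 := by
  induction n generalizing S with
  | zero => exact ⟨S, hS, le_rfl, h⟩
  | succ n ih =>
    set y := tailDot D K ν i n with hy
    let N : Submodule K M.carrier :=
      ⨆ k : ℕ, Submodule.span K {x | ∃ m ∈ S, x = y ^ k • m}
    have hmem : ∀ (k : ℕ), ∀ m ∈ S, y ^ k • m ∈ N := fun k m hm =>
      Submodule.mem_iSup_of_mem k (Submodule.subset_span ⟨m, hm, rfl⟩)
    have hind : ∀ (z : KLR D K ν) (T : Submodule K M.carrier),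
        (∀ (k : ℕ), ∀ m ∈ S, z • y ^ k • m ∈ T) → ∀ x ∈ N, z • x ∈ T := by
      intro z T hz x hx
      induction hx using Submodule.iSup_induction' with
      | zero => simp
      | add x y _ _ hx hy => rw [smul_add]; exact add_mem hx hy
      | mem k x hx =>
        refine smul_mem_span_of_forall D K ν z ?_ hx
        rintro _ ⟨m, hm, rfl⟩
        exact hz k m hm
    have hcomm : ∀ (g : KLRGen I) (k : ℕ), gen D K ν (g.app (List.replicate (n + 1) i)) * y ^ k
        = y ^ k * gen D K ν (g.app (List.replicate (n + 1) i)) := by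
      intro g k
      have h1 : Commute (gen D K ν (g.app (List.replicate (n + 1) i))) y :=
        gen_app_mul_tailDot g (Nat.lt_succ_self n)
      exact (h1.pow_right k).eq
    have hypow : ∀ k : ℕ, ∃ d, y ^ k ∈ homogeneous D K ν d := by
      intro k
      induction k with
      | zero => exact ⟨0, Submodule.subset_span ⟨[], rfl, by simp⟩⟩
      | succ k ih =>
        obtain ⟨d, hd⟩ := ih
        refine ⟨d + 2 * (D.r i : ℤ), ?_⟩
        rw [pow_succ]
        exact homogeneous_mul D K ν hd (tailDot_mem D K ν i n)
    have hstable : ∀ g, ∀ m ∈ N, gen D K ν (KLRGen.app (List.replicate (n + 1) i) g) • m ∈ N := by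
      intro g
      refine hind _ _ fun k m hm => ?_
      rw [← mul_smul, hcomm, mul_smul]
      exact hmem k _ (hS.stable g m hm)
    have hle : N ≤ M.tailSpan (List.replicate (n + 1) i) := by
      refine iSup_le fun k => Submodule.span_le.mpr ?_
      rintro _ ⟨m, hm, rfl⟩
      have h1 : ∀ u ∈ wordsOf ν, y ^ k • gen D K ν (.idem u) • m
          ∈ M.tailSpan (List.replicate (n + 1) i) := by
        intro u _
        by_cases hu : ∃ l, u = l ++ List.replicate (n + 1) i
        · obtain ⟨l, rfl⟩ := hu
          have := hcomm (.idem l) k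
          rw [KLRGen.app_idem] at this
          rw [← mul_smul, ← this, mul_smul]
          exact idem_smul_mem_tailSpan _ _ _
        · push Not at hu
          rw [idem_smul_eq_zero_of_mem_tailSpan hu (hS.le hm), smul_zero]
          exact zero_mem _
      change y ^ k • m ∈ _
      rw [eq_sum_idem m, Finset.smul_sum]
      exact sum_mem h1
    have hN : M.IsLevelSub (i :: List.replicate n i) N := by
      rw [← List.replicate_succ]
      refine ⟨hle, hstable, isHomog_iSup fun k => isHomog_span ?_⟩
      rintro _ ⟨m, hm, rfl⟩
      obtain ⟨d, hd⟩ := hypow k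
      exact hS.homog.smul_mem_iSup (T := Submodule.span K {x | ∃ m ∈ S, x = y ^ k • m}) hd
        (fun m hm => Submodule.subset_span ⟨m, hm, rfl⟩) hm
    have hdot : ∀ l, ∀ m ∈ N, gen D K ν (.dot l i (List.replicate n i)) • m ∈ N := by
      intro l
      refine hind _ _ fun k m hm => ?_
      rw [← tailDot_smul_idem, ← hy, ← mul_smul (gen D K ν _)]
      have := hcomm (.idem l) k
      rw [KLRGen.app_idem] at this
      rw [this, mul_smul, ← mul_smul, ← pow_succ']
      exact hmem _ _ (hS.stable (.idem l) m hm)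
    have hzero : ∀ l, ∀ m ∈ N, gen D K ν (.idem (l ++ List.replicate q i)) • m = 0 := by
      intro l m hm
      rw [← Submodule.mem_bot K]
      refine hind _ _ (fun k m hm => ?_) m hm
      have := hcomm (.idem (l ++ List.replicate (q - (n + 1)) i)) k
      rw [KLRGen.app_idem, List.append_assoc, List.replicate_append_replicate,
        Nat.sub_add_cancel hq.le] at this
      rw [← mul_smul, this, mul_smul, h l m hm, smul_zero]
      exact zero_mem _
    obtain ⟨T, hT, hNT, hT0⟩ := ih (by omega) (hN.strandImage hdot)
      (fun l m hm => idem_smul_strandImage_eq_zero hq hzero l hm)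
    refine ⟨T, hT, fun x hx => hNT (hN.le_strandImage ?_), hT0⟩
    simpa using hmem 0 x hx

theorem strand_replicate_smul_mem {N : Submodule K M.carrier} {n k : ℕ}
    (hN : M.IsLevelSub (List.replicate n i) N)
    (hc : ∀ s, s + 1 < n → ∀ m ∈ N, tailCross D K ν i s • m ∈ N) {j : ℕ} (hj : j + k < n)
    (a : List I) {x : M.carrier} (hx : x ∈ N) :
    strand D K ν i (List.replicate k i) a (List.replicate j i) • x ∈ N := by
  induction j generalizing a with
  | zero => exact hN.idem_smul_mem _ hx
  | succ j ih =>
    rw [List.replicate_succ, strand, mul_smul, List.replicate_append_replicate,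
      ← tailCross_smul_idem]
    exact hc _ (by omega) _ (hN.idem_smul_mem _ (ih (by omega) _))

theorem exists_isLevelSub_nil_of_idem_smul_mem {n k : ℕ} {N T : Submodule K M.carrier}
    (hN : M.IsLevelSub (List.replicate n i) N)
    (hc : ∀ s, s + 1 < n → ∀ m ∈ N, tailCross D K ν i s • m ∈ N) (hkn : k ≤ n)
    (hT : M.IsLevelSub (List.replicate k i) T)
    (hd : ∀ s < k, ∀ m ∈ T, tailDot D K ν i s • m ∈ T)
    (h0 : ∀ l, ∀ m ∈ T, gen D K ν (.idem (l ++ List.replicate (n + 1) i)) • m = 0)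
    (h1 : ∀ l, ∀ m ∈ T, gen D K ν (.idem (l ++ List.replicate n i)) • m ∈ N) :
    ∃ T', M.IsLevelSub [] T' ∧ T ≤ T' ∧
      ∀ l, ∀ m ∈ T', gen D K ν (.idem (l ++ List.replicate n i)) • m ∈ N := by
  induction k generalizing T with
  | zero => exact ⟨T, hT, le_rfl, h1⟩
  | succ k ih =>
    have hT' : M.IsLevelSub (i :: List.replicate k i) T := by rwa [← List.replicate_succ]
    have hdot : ∀ l, ∀ m ∈ T, gen D K ν (.dot l i (List.replicate k i)) • m ∈ T := by
      intro l m hm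
      rw [← tailDot_smul_idem]
      exact hd k (Nat.lt_succ_self k) _ (hT.idem_smul_mem _ hm)
    suffices h : _ ∧ _ by
      obtain ⟨T', h⟩ := ih (by omega) (hT'.strandImage hdot) h.1
        (fun l m hm => idem_smul_strandImage_eq_zero (by omega) h0 l hm) h.2
      exact ⟨T', h.1, hT'.le_strandImage.trans h.2.1, h.2.2⟩
    constructor
    · intro s hs m hm
      refine smul_mem_strandImage _ (fun a b m hm => ?_) hm
      rw [← mul_smul, tailDot_mul_strand hs, mul_smul]
      exact strand_smul_mem_strandImage (hd s (by omega) m hm)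
    · intro l m hm
      refine smul_mem_strandImage _ (fun a b m hm => ?_) hm
      obtain ⟨t, rfl⟩ : ∃ t, n = t + 1 + k := ⟨n - 1 - k, by omega⟩
      by_cases h : l ++ List.replicate (t + 1 + k) i = a ++ i :: (b ++ List.replicate k i)
      swap
      · rw [gen_smul_strand_of_ne (g := .idem _) h m]
        exact zero_mem _
      have h' : a ++ i :: b = l ++ List.replicate (t + 1) i := by
        apply List.append_cancel_right (bs := List.replicate k i)
        rw [List.append_assoc l, List.replicate_append_replicate, h]; simp
      rw [h, ← mul_smul, idem_mul_strand]
      rcases append_cons_eq_append_replicate h' with ⟨j, j', hj, rfl, rfl⟩ | ⟨l', hl'⟩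
      · rw [← strand_mul_idem, mul_smul]
        refine strand_replicate_smul_mem hN hc (by omega) _ ?_
        have h2 : l ++ List.replicate j' i ++ (List.replicate j i ++ i :: List.replicate k i)
            = l ++ List.replicate (t + 1 + k) i := by
          rw [← List.replicate_succ, List.replicate_append_replicate, List.append_assoc,
            List.replicate_append_replicate]
          congr 2; omega
        rw [h2]
        exact h1 l m hm
      · have h2 : a ++ (b ++ i :: List.replicate k i)
            = l' ++ List.replicate (t + 1 + k + 1) i := by
          rw [← List.append_assoc, hl', ← List.replicate_succ, List.append_assoc,
            List.replicate_append_replicate]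
          congr 2
        rw [← strand_mul_idem, mul_smul, h2, h0 l' m hm, smul_zero]
        exact zero_mem _

end Replicate

end GrMod

end

/-- Elements `t 0, …, t (n - 2)` of a ring which satisfy the relations of the nilCoxeter algebra of
the symmetric group on `n` letters. -/
structure NilCoxeter {B : Type u} [Ring B] (n : ℕ) (t : ℕ → B) : Prop where
  sq : ∀ s, s + 1 < n → t s * t s = 0
  comm : ∀ s s', s + 1 < s' → s' + 1 < n → t s * t s' = t s' * t s
  braid : ∀ s, s + 2 < n → t s * t (s + 1) * t s = t (s + 1) * t s * t (s + 1)

/-- Elements `x 0, …, x (n - 1)` and `t 0, …, t (n - 2)` of a ring which satisfy the relations of the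
nilHecke algebra on `n` strands. -/
structure NilHecke {B : Type u} [Ring B] (n : ℕ) (x t : ℕ → B) : Prop extends NilCoxeter n t where
  dot_comm : ∀ s s', s < n → s' < n → x s * x s' = x s' * x s
  cross_dot_comm : ∀ s s', s + 1 < n → s' < n → s' ≠ s → s' ≠ s + 1 → t s * x s' = x s' * t s
  slide_left : ∀ s, s + 1 < n → t s * x s = x (s + 1) * t s + 1
  slide_right : ∀ s, s + 1 < n → t s * x (s + 1) = x s * t s - 1

namespace NilCoxeter

variable {B : Type u} [Ring B]

/-- The product `t 0 * t 1 * ⋯ * t (k - 1)`. -/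
def chain (t : ℕ → B) (k : ℕ) : B := ((List.range k).map t).prod

@[simp] theorem chain_zero (t : ℕ → B) : chain t 0 = 1 := rfl

theorem chain_succ (t : ℕ → B) (k : ℕ) : chain t (k + 1) = chain t k * t k := by
  simp [chain, List.range_succ]

/-- The product `chain t (m - 1) * ⋯ * chain t 1 * chain t 0` for the longest permutation of `m`
letters. -/
def longest (t : ℕ → B) : ℕ → B
  | 0 => 1
  | m + 1 => chain t m * longest t m

variable {n : ℕ} {t : ℕ → B} (h : NilCoxeter n t)
include h

theorem mul_chain_comm {k s : ℕ} (hk : k < s) (hs : s + 1 < n) :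
    t s * chain t k = chain t k * t s := by
  induction k with
  | zero => simp
  | succ k ih =>
    rw [chain_succ, ← mul_assoc, ih (by omega), mul_assoc, mul_assoc, h.comm k s (by omega) hs]

theorem mul_chain {k s : ℕ} (hs : s + 1 < k) (hk : k < n) :
    t (s + 1) * chain t k = chain t k * t s := by
  induction k with
  | zero => omega
  | succ k ih =>
    rw [chain_succ]
    rcases Nat.lt_or_ge (s + 1) k with h1 | h1
    · rw [← mul_assoc, ih h1 (by omega), mul_assoc, mul_assoc, h.comm s k h1 (by omega)]
    · obtain rfl : k = s + 1 := by omega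
      rw [chain_succ]
      calc t (s + 1) * (chain t s * t s * t (s + 1))
          = t (s + 1) * chain t s * (t s * t (s + 1)) := by simp only [mul_assoc]
        _ = chain t s * (t (s + 1) * t s * t (s + 1)) := by
          rw [h.mul_chain_comm (by omega) (by omega)]; simp only [mul_assoc]
        _ = chain t s * t s * t (s + 1) * t s := by
          rw [← h.braid s (by omega)]; simp only [mul_assoc]

theorem zero_mul_chain {k : ℕ} (hk : k + 1 < n) : t 0 * chain t (k + 1) = 0 := by
  induction k with
  | zero => rw [chain_succ, chain_zero, one_mul, h.sq 0 (by omega)]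
  | succ k ih => rw [chain_succ, ← mul_assoc, ih (by omega), zero_mul]

theorem chain_mul_chain_self {k : ℕ} (hk : k + 1 < n) : chain t (k + 1) * chain t (k + 1) = 0 := by
  have : ∀ j, j ≤ k → chain t (j + 1) * chain t (k + 1) = t 0 * chain t (k + 1) * chain t j := by
    intro j hj
    induction j with
    | zero => simp [chain_succ]
    | succ j ih =>
      rw [chain_succ, mul_assoc, h.mul_chain (by omega) hk, ← mul_assoc, ih (by omega), mul_assoc,
        chain_succ t j]
  rw [this k le_rfl, h.zero_mul_chain hk, zero_mul]

theorem mul_longest_comm {m s : ℕ} (hm : m ≤ s) (hs : s + 1 < n) :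
    t s * longest t m = longest t m * t s := by
  induction m with
  | zero => simp [longest]
  | succ m ih =>
    rw [longest, ← mul_assoc, h.mul_chain_comm (by omega) hs, mul_assoc, ih (by omega), mul_assoc]

theorem longest_mul {m s : ℕ} (hs : s + 1 < m) (hm : m ≤ n) : longest t m * t s = 0 := by
  induction m with
  | zero => omega
  | succ m ih =>
    rcases Nat.lt_or_ge (s + 1) m with h1 | h1
    · rw [longest, mul_assoc, ih h1 (by omega), mul_zero]
    · obtain rfl : m = s + 1 := by omega
      rw [longest, longest, mul_assoc, mul_assoc, ← h.mul_longest_comm le_rfl (by omega),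
        ← mul_assoc (chain t s) (t s), ← chain_succ, ← mul_assoc, h.chain_mul_chain_self (by omega),
        zero_mul]

section Module

variable {Q : Type w} [AddCommGroup Q] [Module B Q]

theorem cross_smul_chain_smul {k s : ℕ} (hs : s < k) (hk : k < n) {v : Q}
    (hv : ∀ j, j + 1 < k → t j • v = 0) : t s • chain t k • v = 0 := by
  rw [← mul_smul]
  rcases s with _ | s
  · obtain ⟨k, rfl⟩ : ∃ k', k = k' + 1 := ⟨k - 1, by omega⟩
    rw [h.zero_mul_chain hk, zero_smul]
  · rw [h.mul_chain hs hk, mul_smul, hv s hs, smul_zero]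

theorem cross_smul_longest_smul {m s : ℕ} (hs : s + 1 < m) (hm : m ≤ n) (v : Q) :
    t s • longest t m • v = 0 := by
  induction m generalizing s with
  | zero => omega
  | succ m ih =>
    rw [longest, mul_smul]
    exact h.cross_smul_chain_smul (by omega) (by omega) fun j hj => ih hj (by omega)

/-- A nonzero module over the nilCoxeter algebra contains a nonzero vector killed by all the
generators. -/
theorem exists_ne_zero {S : Set Q} (hS : ∀ s, s + 1 < n → ∀ v ∈ S, t s • v ∈ S)
    {v : Q} (hv : v ∈ S) (hv0 : v ≠ 0) (m : ℕ) (hm : m ≤ n) :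
    ∃ v ∈ S, v ≠ 0 ∧ ∀ s, s + 1 < m → t s • v = 0 := by
  induction m with
  | zero => exact ⟨v, hv, hv0, fun s hs => by omega⟩
  | succ m ih =>
    obtain ⟨u, hu, hu0, hut⟩ := ih (by omega)
    by_contra hcon
    push Not at hcon
    let c : ℕ → Q := fun j => Nat.rec u (fun j z => t (m - 1 - j) • z) j
    have hc : ∀ j, c (j + 1) = t (m - 1 - j) • c j := fun _ => rfl
    have hkill : ∀ j, j ≤ m → ∀ s, s < m → s + j + 1 ≠ m → t s • c j = 0 := by
      intro j
      induction j using Nat.strong_induction_on with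
      | _ j ihj =>
      intro hj s hs hsj
      rcases j with _ | j
      · exact hut s (by omega)
      · obtain ⟨p, hp⟩ : ∃ p, m = p + 1 + j := ⟨m - 1 - j, by omega⟩
        have hpj : m - 1 - j = p := by omega
        rw [hc, hpj, ← mul_smul]
        rcases lt_trichotomy s p with h1 | rfl | h1
        · rw [h.comm s p (by omega) (by omega), mul_smul,
            ihj j (by omega) (by omega) s hs (by omega), smul_zero]
        · rw [h.sq s (by omega), zero_smul]
        · rcases Nat.lt_or_ge (p + 1) s with h2 | h2
          · rw [← h.comm p s h2 (by omega), mul_smul,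
              ihj j (by omega) (by omega) s hs (by omega), smul_zero]
          · obtain rfl : s = p + 1 := by omega
            obtain ⟨j, rfl⟩ : ∃ j', j = j' + 1 := ⟨j - 1, by omega⟩
            have hpj' : m - 1 - j = p + 1 := by omega
            rw [hc, hpj', ← mul_smul, ← h.braid p (by omega), mul_smul,
              ihj j (by omega) (by omega) p (by omega) (by omega), smul_zero]
    have hne : ∀ j, j ≤ m → c j ∈ S ∧ c j ≠ 0 := by
      intro j hj
      induction j with
      | zero => exact ⟨hu, hu0⟩
      | succ j ihj =>
        obtain ⟨h1, h2⟩ := ihj (by omega)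
        obtain ⟨s, hs, hs0⟩ := hcon (c j) h1 h2
        obtain rfl : s = m - 1 - j := by
          by_contra hne
          exact hs0 (hkill j (by omega) s (by omega) (by omega))
        exact ⟨hS _ (by omega) _ h1, hs0⟩
    obtain ⟨h1, h2⟩ := hne m le_rfl
    obtain ⟨s, hs, hs0⟩ := hcon (c m) h1 h2
    exact hs0 (hkill m le_rfl s (by omega) (by omega))

end Module

end NilCoxeter

namespace NilHecke

open NilCoxeter

variable {B : Type u} [Ring B]

/-- The elementary symmetric polynomial of degree `j` in `x 0, …, x (k - 1)`. -/
def esymm (x : ℕ → B) : ℕ → ℕ → B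
  | 0, 0 => 1
  | 0, _ + 1 => 0
  | _ + 1, 0 => 1
  | k + 1, j + 1 => esymm x k (j + 1) + x k * esymm x k j

@[simp] theorem esymm_zero_right (x : ℕ → B) (k : ℕ) : esymm x k 0 = 1 := by
  cases k <;> rfl

theorem esymm_succ (x : ℕ → B) (k j : ℕ) :
    esymm x (k + 1) (j + 1) = esymm x k (j + 1) + x k * esymm x k j := rfl

theorem esymm_eq_zero (x : ℕ → B) {k j : ℕ} (h : k < j) : esymm x k j = 0 := by
  induction k generalizing j with
  | zero => cases j with
    | zero => omega
    | succ j => rfl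
  | succ k ih => cases j with
    | zero => omega
    | succ j => rw [esymm_succ, ih (by omega), ih (by omega), mul_zero, add_zero]

theorem mul_esymm_comm (x : ℕ → B) (z : B) {k : ℕ} (h : ∀ s < k, z * x s = x s * z) (j : ℕ) :
    z * esymm x k j = esymm x k j * z := by
  induction k generalizing j with
  | zero => cases j <;> simp [esymm]
  | succ k ih => cases j with
    | zero => simp
    | succ j =>
      have ih' := fun j => ih (fun s hs => h s (by omega)) j
      rw [esymm_succ, mul_add, add_mul, ih', ← mul_assoc, h k (by omega), mul_assoc, ih', mul_assoc]

variable {n : ℕ} {x t : ℕ → B} (h : NilHecke n x t)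
include h

theorem dot_mul_esymm {s k : ℕ} (hs : s < n) (hk : k ≤ n) (j : ℕ) :
    x s * esymm x k j = esymm x k j * x s :=
  mul_esymm_comm x _ (fun s' hs' => h.dot_comm s s' hs (by omega)) j

theorem cross_mul_esymm_lt {s k : ℕ} (hs : s + 1 < n) (hk : k ≤ s) (j : ℕ) :
    t s * esymm x k j = esymm x k j * t s :=
  mul_esymm_comm x _ (fun s' hs' => h.cross_dot_comm s s' hs (by omega) (by omega) (by omega)) j

theorem cross_mul_esymm {s k : ℕ} (hs : s + 1 < k) (hk : k ≤ n) (j : ℕ) :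
    t s * esymm x k j = esymm x k j * t s := by
  induction k generalizing j with
  | zero => omega
  | succ k ih => cases j with
    | zero => simp
    | succ j =>
      rcases Nat.lt_or_ge (s + 1) k with h1 | h1
      · have ih' := fun j => ih h1 (by omega) j
        rw [esymm_succ, mul_add, add_mul, ih', ← mul_assoc,
          h.cross_dot_comm s k (by omega) (by omega) (by omega) (by omega), mul_assoc, ih',
          mul_assoc]
      · obtain rfl : k = s + 1 := by omega
        have hc := fun j => h.cross_mul_esymm_lt (show s + 1 < n by omega) le_rfl j
        have h1 : t s * (x s + x (s + 1)) = (x s + x (s + 1)) * t s := by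
          rw [mul_add, add_mul, h.slide_left s (by omega), h.slide_right s (by omega)]; abel
        have h2 : t s * (x (s + 1) * x s) = x (s + 1) * x s * t s := by
          rw [← mul_assoc, h.slide_right s (by omega), sub_mul, mul_assoc,
            h.slide_left s (by omega), mul_add, ← mul_assoc, one_mul, mul_one,
            h.dot_comm s (s + 1) (by omega) (by omega)]
          abel
        cases j with
        | zero =>
          have h3 : esymm x (s + 1 + 1) (0 + 1) = esymm x s 1 + (x s + x (s + 1)) := by
            simp only [esymm_succ, esymm_zero_right, mul_one]; abel
          rw [h3, mul_add, add_mul, hc, h1]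
        | succ j =>
          have h3 : esymm x (s + 1 + 1) (j + 1 + 1) = esymm x s (j + 2)
              + (x s + x (s + 1)) * esymm x s (j + 1) + x (s + 1) * x s * esymm x s j := by
            simp only [esymm_succ, mul_add, add_mul, mul_assoc]; abel
          generalize x s + x (s + 1) = y at h1 h3
          rw [h3, mul_add, mul_add, add_mul, add_mul, hc, ← mul_assoc, h1, ← mul_assoc, h2,
            mul_assoc _ (t s), hc, mul_assoc _ (t s), hc]
          simp only [mul_assoc]

theorem dot_mul_chain {k s : ℕ} (hk : k < s) (hs : s < n) :
    x s * chain t k = chain t k * x s := by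
  induction k with
  | zero => simp
  | succ k ih =>
    rw [chain_succ, ← mul_assoc, ih (by omega), mul_assoc, mul_assoc,
      h.cross_dot_comm k s (by omega) (by omega) (by omega) (by omega)]

theorem chain_mul_esymm {k m : ℕ} (hk : k < m) (hm : m ≤ n) (j : ℕ) :
    chain t k * esymm x m j = esymm x m j * chain t k := by
  induction k with
  | zero => simp
  | succ k ih =>
    rw [chain_succ, mul_assoc, h.cross_mul_esymm (by omega) hm, ← mul_assoc, ih (by omega),
      mul_assoc]

theorem dot_mul_longest {m s : ℕ} (hm : m ≤ s) (hs : s < n) :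
    x s * longest t m = longest t m * x s := by
  induction m with
  | zero => simp [longest]
  | succ m ih =>
    rw [longest, ← mul_assoc, h.dot_mul_chain (by omega) hs, mul_assoc, ih (by omega), mul_assoc]

section Module

variable {Q : Type w} [AddCommGroup Q] [Module B Q]

theorem cross_smul_pow_smul {k : ℕ} (hk : k + 1 < n) {v : Q} (hv : t k • v = 0) (c : ℕ) :
    t k • x (k + 1) ^ c • v
      = -∑ a ∈ Finset.range c, x k ^ a • x (k + 1) ^ (c - 1 - a) • v := by
  induction c with
  | zero => simp [hv]
  | succ c ih =>
    have h1 : ∑ a ∈ Finset.range c, x k ^ (a + 1) • x (k + 1) ^ (c + 1 - 1 - (a + 1)) • v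
        = x k • ∑ a ∈ Finset.range c, x k ^ a • x (k + 1) ^ (c - 1 - a) • v := by
      rw [Finset.smul_sum]
      refine Finset.sum_congr rfl fun a _ => ?_
      rw [pow_succ', mul_smul, show c + 1 - 1 - (a + 1) = c - 1 - a by omega]
    rw [pow_succ', mul_smul, ← mul_smul, h.slide_right k hk, sub_smul, mul_smul, ih, one_smul,
      Finset.sum_range_succ', h1, smul_neg, neg_add, ← sub_eq_add_neg]
    simp

/-- `chain t k` acts on `x k ^ c • u`, where `u` is invariant, as an iterated divided difference of
`x k ^ c`. -/
theorem chain_smul_pow_smul {k c : ℕ} (hk : k < n) (hc : c ≤ k) {u : Q}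
    (hu : ∀ s, s < k → t s • u = 0) :
    chain t k • x k ^ c • u = if c = k then (-1 : ℤ) ^ k • u else 0 := by
  induction k generalizing c u with
  | zero => obtain rfl : c = 0 := by omega
            simp
  | succ k ih =>
    rw [chain_succ, mul_smul, h.cross_smul_pow_smul hk (hu k (by omega)), smul_neg,
      Finset.smul_sum]
    have h1 : ∀ a b : ℕ, x k ^ a • x (k + 1) ^ b • u = x (k + 1) ^ b • x k ^ a • u := by
      intro a b
      rw [← mul_smul, ← mul_smul]
      congr 1
      exact (Commute.pow_pow (h.dot_comm k (k + 1) (by omega) hk) a b).eq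
    have h2 : ∀ a b : ℕ, chain t k • x k ^ a • x (k + 1) ^ b • u
        = x (k + 1) ^ b • chain t k • x k ^ a • u := by
      intro a b
      rw [h1, ← mul_smul, ← mul_smul (x (k + 1) ^ b)]
      congr 1
      exact (Commute.pow_right (h.dot_mul_chain (Nat.lt_succ_self k) hk).symm b).eq
    have h3 : ∀ a ∈ Finset.range c, chain t k • x k ^ a • x (k + 1) ^ (c - 1 - a) • u
        = if a = k then (-1 : ℤ) ^ k • u else 0 := by
      intro a ha
      rw [Finset.mem_range] at ha
      rw [h2, ih (by omega) (by omega) fun s hs => hu s (by omega)]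
      split_ifs with hak
      · obtain rfl : c = k + 1 := by omega
        subst hak
        simp
      · rw [smul_zero]
    rw [Finset.sum_congr rfl h3, Finset.sum_ite_eq' (Finset.range c) k]
    by_cases hck : c = k + 1
    · subst hck
      simp [pow_succ]
    · rw [if_neg (by simpa using by omega), if_neg hck, neg_zero]

theorem chain_smul_esymm_smul {k j : ℕ} (hk : k < n) (hj : j ≤ k) {u : Q}
    (hu : ∀ s, s < k → t s • u = 0) :
    chain t k • esymm x k j • u = if j = k then u else 0 := by
  induction k generalizing j u with
  | zero => obtain rfl : j = 0 := by omega
            simp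
  | succ k ih =>
    have hku := hu k (by omega)
    rcases j with _ | j
    · rw [chain_succ, mul_smul, esymm_zero_right, one_smul, hku, smul_zero, if_neg (by omega)]
    · have h1 : t k • esymm x (k + 1) (j + 1) • u = esymm x k j • u := by
        rw [esymm_succ, add_smul, smul_add, ← mul_smul, h.cross_mul_esymm_lt hk le_rfl, mul_smul,
          hku, smul_zero, zero_add, ← mul_smul, ← mul_assoc, h.slide_left k hk, add_mul, mul_assoc,
          h.cross_mul_esymm_lt hk le_rfl, one_mul, add_smul, mul_smul, mul_smul, hku]
        simp
      rw [chain_succ, mul_smul, h1, ih (by omega) (by omega) fun s hs => hu s (by omega)]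
      simp

/-- A vector killed by `t 0, …, t (k - 2)` is a combination of the powers of `x k` applied to vectors
killed by `t 0, …, t (k - 1)`. -/
theorem eq_sum_pow_smul {k : ℕ} (hk : k < n) {v : Q} (hv : ∀ s, s + 1 < k → t s • v = 0) :
    v = ∑ c ∈ Finset.range (k + 1),
      (-1 : ℤ) ^ c • x k ^ c • chain t k • esymm x k (k - c) • v := by
  rcases k with _ | k
  · simp
  have hck : ∀ (b : ℕ) (z : Q), chain t k • x (k + 1) ^ b • z = x (k + 1) ^ b • chain t k • z := by
    intro b z
    rw [← mul_smul, ← mul_smul]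
    congr 1
    exact (Commute.pow_right (h.dot_mul_chain (Nat.lt_succ_self k) hk).symm b).eq
  set u := t k • v with hu
  -- the telescoping part
  let f : ℕ → Q := fun c => (-1 : ℤ) ^ c • x (k + 1) ^ c • chain t k • esymm x k (k + 1 - c) • u
  have hterm : ∀ c ∈ Finset.range (k + 1),
      (-1 : ℤ) ^ c • x (k + 1) ^ c • chain t (k + 1) • esymm x (k + 1) (k + 1 - c) • v
        = (f c - f (c + 1)) + (-1 : ℤ) ^ c • x (k + 1) ^ c • chain t k • esymm x k (k - c) • v := by
    intro c hc
    rw [Finset.mem_range] at hc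
    obtain ⟨j, rfl⟩ : ∃ j, k = c + j := ⟨k - c, by omega⟩
    have e1 : c + j + 1 - c = j + 1 := by omega
    have e2 : c + j - c = j := by omega
    have e3 : c + j + 1 - (c + 1) = j := by omega
    have h1 : t (c + j) • esymm x (c + j + 1) (j + 1) • v
        = esymm x (c + j) (j + 1) • u + x (c + j + 1) • esymm x (c + j) j • u
          + esymm x (c + j) j • v := by
      rw [esymm_succ, add_smul, smul_add, ← mul_smul, h.cross_mul_esymm_lt hk le_rfl, mul_smul,
        ← hu, ← mul_smul (t (c + j)), ← mul_assoc, h.slide_left _ hk, add_mul, mul_assoc,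
        h.cross_mul_esymm_lt hk le_rfl, one_mul, add_smul, mul_smul, mul_smul, ← hu, ← add_assoc]
    simp only [f, e1, e2, e3]
    rw [chain_succ, mul_smul, h1, smul_add, smul_add, smul_add, smul_add, smul_add, smul_add]
    congr 1
    have := hck 1 (esymm x (c + j) j • u)
    rw [pow_one] at this
    rw [this, pow_succ (-1 : ℤ), mul_neg_one, neg_smul, sub_neg_eq_add, pow_succ (x (c + j + 1)),
      mul_smul (x (c + j + 1) ^ c)]
  have hf0 : f 0 = 0 := by
    simp only [f]
    rw [esymm_eq_zero x (by omega), zero_smul]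
    simp
  have hE : ∀ c ∈ Finset.range (k + 1),
      (-1 : ℤ) ^ c • x (k + 1) ^ c • chain t k • esymm x k (k - c) • v
        = if c = 0 then v else 0 := by
    intro c hc
    rw [Finset.mem_range] at hc
    rw [h.chain_smul_esymm_smul (by omega) (by omega) fun s hs => hv s (by omega)]
    by_cases hc0 : c = 0
    · subst hc0; simp
    · rw [if_neg (by omega), if_neg hc0]; simp
  rw [Finset.sum_range_succ, Finset.sum_congr rfl hterm, Finset.sum_add_distrib,
    Finset.sum_range_sub', hf0, Finset.sum_congr rfl hE, Finset.sum_ite_eq' (Finset.range (k + 1)) 0]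
  simp only [f, Nat.sub_self, esymm_zero_right, one_smul, chain_succ, mul_smul, ← hu]
  simp

theorem sum_pow_smul_eq_zero {k : ℕ} (hk : k < n) {u : ℕ → Q}
    (hu : ∀ c ≤ k, ∀ s, s < k → t s • u c = 0)
    (h0 : ∑ c ∈ Finset.range (k + 1), x k ^ c • u c = 0) : ∀ c ≤ k, u c = 0 := by
  have key : ∀ j, ∀ c ≤ k, k < c + j → u c = 0 := by
    intro j
    induction j with
    | zero => intro c hc hcj; omega
    | succ j ih =>
      intro c hc hcj
      rcases Nat.lt_or_ge k (c + j) with h1 | h1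
      · exact ih c hc h1
      have h2 : ∀ b ∈ Finset.range (k + 1), chain t k • x k ^ j • x k ^ b • u b
          = if b = c then (-1 : ℤ) ^ k • u c else 0 := by
        intro b hb
        rw [Finset.mem_range] at hb
        rw [← mul_smul (x k ^ j), ← pow_add]
        rcases lt_trichotomy b c with h3 | rfl | h3
        · rw [h.chain_smul_pow_smul hk (by omega) (hu b (by omega)), if_neg (by omega),
            if_neg (by omega)]
        · rw [h.chain_smul_pow_smul hk (by omega) (hu b (by omega)), if_pos (by omega), if_pos rfl]
        · rw [ih b (by omega) (by omega), smul_zero, smul_zero, if_neg (by omega)]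
      have h3 : chain t k • x k ^ j • ∑ b ∈ Finset.range (k + 1), x k ^ b • u b
          = (-1 : ℤ) ^ k • u c := by
        rw [Finset.smul_sum, Finset.smul_sum, Finset.sum_congr rfl h2,
          Finset.sum_ite_eq' (Finset.range (k + 1)) c, if_pos (by simp; omega)]
      rw [h0, smul_zero, smul_zero] at h3
      rcases neg_one_pow_eq_or ℤ k with h4 | h4
      · rw [h4, one_smul] at h3; exact h3.symm
      · rw [h4, neg_smul, one_smul, zero_eq_neg] at h3; exact h3
  exact fun c hc => key (k + 1) c hc (by omega)

theorem longest_smul_aux {m : ℕ} (hm : m ≤ n) {v : Q} (hv : ∀ s < n, x s • v = 0) :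
    (∀ j, esymm x m (j + 1) • longest t m • v = 0) ∧ (longest t m • v = 0 → v = 0) := by
  induction m with
  | zero => simp [longest, esymm]
  | succ m ih =>
    obtain ⟨ih1, ih2⟩ := ih (by omega)
    have hx : x m • longest t m • v = 0 := by
      rw [← mul_smul, h.dot_mul_longest le_rfl (by omega), mul_smul, hv m (by omega), smul_zero]
    constructor
    · intro j
      have h1 : x m • esymm x m j • longest t m • v = 0 := by
        rw [← mul_smul, h.dot_mul_esymm (by omega) (by omega), mul_smul, hx, smul_zero]
      rw [longest, mul_smul, ← mul_smul, ← h.chain_mul_esymm (Nat.lt_succ_self m) hm, mul_smul,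
        esymm_succ, add_smul, ih1, mul_smul, h1, add_zero, smul_zero]
    · intro h0
      apply ih2
      rw [h.eq_sum_pow_smul (k := m) (by omega)
        (fun s hs => h.cross_smul_longest_smul hs (by omega) v)]
      refine Finset.sum_eq_zero fun c hc => ?_
      rw [Finset.mem_range] at hc
      rcases Nat.lt_or_ge c m with h1 | h1
      · obtain ⟨j, hj⟩ : ∃ j, m - c = j + 1 := ⟨m - c - 1, by omega⟩
        rw [hj, ih1]; simp
      · obtain rfl : c = m := by omega
        rw [longest, mul_smul] at h0
        rw [Nat.sub_self, esymm_zero_right, one_smul, h0, smul_zero, smul_zero]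

/-- The symmetric polynomials without constant term kill the image of a vector killed by the dots
under the longest permutation. -/
theorem longest_smul_injective {m : ℕ} (hm : m ≤ n) {v : Q} (hv : ∀ s < n, x s • v = 0)
    (h0 : longest t m • v = 0) : v = 0 :=
  (h.longest_smul_aux hm hv).2 h0

end Module

/-- The monomial `∏ s < m, (x s) ^ s`. -/
def staircase (x : ℕ → B) : ℕ → B
  | 0 => 1
  | m + 1 => staircase x m * x m ^ m

section Module

variable {Q : Type w} [AddCommGroup Q] [Module B Q]

theorem staircase_smul {m : ℕ} (hm : m ≤ n) {u : Q} (ht : ∀ s, s + 1 < m → t s • u = 0)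
    (he : ∀ j, esymm x m (j + 1) • u = 0) (hx : ∀ s, m ≤ s → s < n → x s • u = 0) :
    (∀ s < n, x s • staircase x m • u = 0) ∧
      ∃ c : ℤ, c * c = 1 ∧ longest t m • staircase x m • u = c • u := by
  induction m generalizing u with
  | zero => exact ⟨fun s hs => by simpa [staircase] using hx s (by omega) hs, 1, by simp, by
      simp [staircase, longest]⟩
  | succ m ih =>
    have hej : ∀ j, esymm x m j • u = (-1 : ℤ) ^ j • x m ^ j • u := by
      intro j
      induction j with
      | zero => simp
      | succ j ihj =>
        have := he j
        rw [esymm_succ, add_smul, mul_smul, ihj, add_eq_zero_iff_eq_neg] at this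
        rw [this, smul_comm, ← mul_smul, ← pow_succ', pow_succ (-1 : ℤ)]
        simp
    have hpow : ∀ j, x m ^ j • x m ^ (m + 1) • u = 0 := by
      intro j
      have := hej (m + 1)
      rw [esymm_eq_zero x (by omega), zero_smul] at this
      rcases neg_one_pow_eq_or ℤ (m + 1) with h4 | h4
      · rw [h4, one_smul] at this; rw [← this, smul_zero]
      · rw [h4, neg_smul, one_smul, zero_eq_neg] at this; rw [this, smul_zero]
    have hxm : ∀ z : B, z * x m = x m * z → z • x m ^ m • u = x m ^ m • z • u := by
      intro z hz
      rw [← mul_smul, ← mul_smul, (Commute.pow_right hz m).eq]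
    obtain ⟨h1, c, hc, h2⟩ := ih (u := x m ^ m • u) (by omega)
      (fun s hs => by
        rw [hxm _ (h.cross_dot_comm s m (by omega) (by omega) (by omega) (by omega)),
          ht s (by omega), smul_zero])
      (fun j => by
        rw [hxm _ (h.dot_mul_esymm (by omega) (by omega) _).symm, hej, smul_comm, ← mul_smul,
          ← pow_add, show m + (j + 1) = j + (m + 1) by omega, pow_add (x m), mul_smul, hpow, smul_zero])
      (fun s hs hsn => by
        rcases hs.eq_or_lt with rfl | hs
        · have := hpow 0
          rwa [pow_zero, one_smul, pow_succ', mul_smul] at this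
        · rw [hxm _ (h.dot_comm s m hsn (by omega)), hx s hs hsn, smul_zero])
    rw [staircase, mul_smul]
    refine ⟨h1, c * (-1) ^ m, ?_, ?_⟩
    · rw [mul_mul_mul_comm, hc, ← mul_pow]; simp
    · rw [longest, mul_smul, h2, smul_comm, h.chain_smul_pow_smul (by omega) le_rfl
        (fun s hs => ht s (by omega)), if_pos rfl, mul_smul]

end Module

omit h

/-- The index set of the basis `∏ s < m, (x s) ^ (c s)`, `c s ≤ s`, of the polynomials over the
symmetric polynomials. -/
def Code : ℕ → Type
  | 0 => Unit
  | m + 1 => Code m × Fin (m + 1)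

/-- `Code m` is finite. -/
instance codeFintype : ∀ m, Fintype (Code m)
  | 0 => inferInstanceAs (Fintype Unit)
  | m + 1 => letI := codeFintype m; inferInstanceAs (Fintype (Code m × Fin (m + 1)))

/-- The monomial `∏ s < m, (x s) ^ (c s)`. -/
def monomial (x : ℕ → B) : ∀ m, Code m → B
  | 0, _ => 1
  | m + 1, p => monomial x m p.1 * x m ^ (p.2 : ℕ)

/-- The projection to the coefficient of a monomial. -/
def coeff (x t : ℕ → B) : ∀ m, Code m → B
  | 0, _ => 1
  | m + 1, p =>
    (-1) ^ (p.2 : ℕ) * (chain t m * (esymm x m (m - (p.2 : ℕ)) * coeff x t m p.1))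

section Module

variable {Q : Type w} [AddCommGroup Q] [Module B Q]

theorem neg_one_pow_mul_smul (c : ℕ) (b : B) (v : Q) :
    ((-1 : B) ^ c * b) • v = (-1 : ℤ) ^ c • b • v := by
  rcases neg_one_pow_eq_or ℤ c with h4 | h4
  · have : (-1 : B) ^ c = 1 := by exact_mod_cast congrArg (Int.cast : ℤ → B) h4
    rw [this, h4]; simp
  · have : (-1 : B) ^ c = -1 := by exact_mod_cast congrArg (Int.cast : ℤ → B) h4
    rw [this, h4]; simp

include h

theorem cross_smul_coeff_smul {m : ℕ} (hm : m ≤ n) (p : Code m) (v : Q) {s : ℕ} (hs : s + 1 < m) :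
    t s • coeff x t m p • v = 0 := by
  induction m generalizing s with
  | zero => omega
  | succ m ih =>
    rw [coeff, neg_one_pow_mul_smul, smul_comm, mul_smul, h.cross_smul_chain_smul (by omega) hm,
      smul_zero]
    intro j hj
    rw [mul_smul, ← mul_smul, h.cross_mul_esymm hj (by omega), mul_smul, ih (by omega) _ hj,
      smul_zero]

theorem eq_sum_monomial_smul {m : ℕ} (hm : m ≤ n) (v : Q) :
    v = ∑ p : Code m, monomial x m p • coeff x t m p • v := by
  induction m with
  | zero =>
    change v = ∑ p : Unit, (1 : B) • (1 : B) • v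
    simp
  | succ m ih =>
    change v = ∑ p : Code m × Fin (m + 1), (monomial x m p.1 * x m ^ (p.2 : ℕ)) •
      ((-1) ^ (p.2 : ℕ) * (chain t m * (esymm x m (m - (p.2 : ℕ)) * coeff x t m p.1))) • v
    rw [Fintype.sum_prod_type]
    nth_rw 1 [ih (by omega)]
    refine Finset.sum_congr rfl fun p _ => ?_
    nth_rw 1 [h.eq_sum_pow_smul (k := m) (v := coeff x t m p • v) (by omega)
      (fun s hs => h.cross_smul_coeff_smul (by omega) p v hs)]
    rw [Finset.smul_sum, Finset.sum_range]
    refine Finset.sum_congr rfl fun c _ => ?_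
    rw [neg_one_pow_mul_smul, mul_smul, mul_smul (chain t m), mul_smul (esymm x m _),
      smul_comm ((-1 : ℤ) ^ (c : ℕ)) (x m ^ (c : ℕ))]

theorem sum_monomial_smul_eq_zero {m : ℕ} (hm : m ≤ n) {u : Code m → Q}
    (hu : ∀ p s, s + 1 < m → t s • u p = 0) (h0 : ∑ p, monomial x m p • u p = 0) (p : Code m) :
    u p = 0 := by
  induction m with
  | zero =>
    have h1 : ∑ p : Unit, (1 : B) • u p = 0 := h0
    rw [Fintype.sum_unique, one_smul] at h1
    exact h1
  | succ m ih =>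
    change ∑ p : Code m × Fin (m + 1), (monomial x m p.1 * x m ^ (p.2 : ℕ)) • u p = 0 at h0
    rw [Fintype.sum_prod_type] at h0
    simp only [mul_smul, ← Finset.smul_sum] at h0
    have h1 := ih (u := fun p => ∑ c : Fin (m + 1), x m ^ (c : ℕ) • u (p, c)) (by omega) ?_ h0 p.1
    · let f : ℕ → Q := fun c => if hc : c < m + 1 then u (p.1, ⟨c, hc⟩) else 0
      have h2 : ∑ c ∈ Finset.range (m + 1), x m ^ c • f c = 0 := by
        rw [Finset.sum_range]
        simpa only [f, dif_pos (Fin.is_lt _)] using h1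
      have h3 := h.sum_pow_smul_eq_zero (k := m) (by omega) (u := f) ?_ h2 p.2 (by omega)
      · simp only [f, dif_pos (Fin.is_lt _)] at h3
        exact h3
      · intro c hc s hs
        simp only [f]
        split_ifs
        · exact hu _ _ (by omega)
        · simp
    · intro p s hs
      rw [Finset.smul_sum]
      refine Finset.sum_eq_zero fun c _ => ?_
      have h2 : t s * x m = x m * t s :=
        h.cross_dot_comm s m (by omega) (by omega) (by omega) (by omega)
      rw [← mul_smul, (Commute.pow_right h2 (c : ℕ)).eq, mul_smul]
      exact (congrArg _ (hu _ s (by omega))).trans (smul_zero _)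

end Module

end NilHecke

noncomputable section

namespace KLR

variable {I : Type u} [DecidableEq I] (D : BorcherdsCartanDatum I) (K : Type v) [Field K]
  (ν : Multiset I) (i : I)

theorem tailDot_mul_idem (s : ℕ) (l : List I) :
    tailDot D K ν i s * gen D K ν (.idem (l ++ List.replicate (s + 1) i))
      = gen D K ν (.dot l i (List.replicate s i)) := by
  simpa [tailDot, List.replicate_succ] using
    rightOp_mul_idem D K ν (.dot [] i (List.replicate s i)) l

theorem tailCross_mul_idem (s : ℕ) (l : List I) :
    tailCross D K ν i s * gen D K ν (.idem (l ++ List.replicate (s + 2) i))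
      = gen D K ν (.cross l i i (List.replicate s i)) := by
  simpa [tailCross, List.replicate_succ] using
    rightOp_mul_idem D K ν (.cross [] i i (List.replicate s i)) l

variable {i}

theorem idem_mul_tailDot {s n : ℕ} (h : s < n) (l : List I) :
    gen D K ν (.idem (l ++ List.replicate n i)) * tailDot D K ν i s
      = tailDot D K ν i s * gen D K ν (.idem (l ++ List.replicate n i)) :=
  GrMod.gen_app_mul_tailDot (.idem l) h

theorem idem_mul_tailCross {s n : ℕ} (h : s + 1 < n) (l : List I) :
    gen D K ν (.idem (l ++ List.replicate n i)) * tailCross D K ν i s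
      = tailCross D K ν i s * gen D K ν (.idem (l ++ List.replicate n i)) :=
  GrMod.gen_app_mul_tailCross (.idem l) h

theorem tailDot_mul_tailDot {s s' : ℕ} (h : s < s') (l : List I) :
    tailDot D K ν i s * tailDot D K ν i s' * gen D K ν (.idem (l ++ List.replicate (s' + 1) i))
      = tailDot D K ν i s' * tailDot D K ν i s
        * gen D K ν (.idem (l ++ List.replicate (s' + 1) i)) := by
  have h1 := GrMod.gen_app_mul_tailDot (D := D) (K := K) (ν := ν) (i := i) (.dot l i []) h
  rw [KLRGen.app_dot, List.nil_append] at h1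
  rw [mul_assoc, tailDot_mul_idem, ← h1, mul_assoc, ← idem_mul_tailDot D K ν (by omega : s < s' + 1),
    ← mul_assoc, tailDot_mul_idem]

theorem tailDot_mul_tailCross {s s' : ℕ} (h : s < s') (l : List I) :
    tailDot D K ν i s * tailCross D K ν i s' * gen D K ν (.idem (l ++ List.replicate (s' + 2) i))
      = tailCross D K ν i s' * tailDot D K ν i s
        * gen D K ν (.idem (l ++ List.replicate (s' + 2) i)) := by
  have h1 := GrMod.gen_app_mul_tailDot (D := D) (K := K) (ν := ν) (i := i) (.cross l i i []) h
  rw [KLRGen.app_cross, List.nil_append] at h1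
  rw [mul_assoc, tailCross_mul_idem, ← h1, mul_assoc,
    ← idem_mul_tailDot D K ν (by omega : s < s' + 2), ← mul_assoc, tailCross_mul_idem]

theorem tailCross_mul_tailDot {s s' : ℕ} (h : s + 1 < s') (l : List I) :
    tailCross D K ν i s * tailDot D K ν i s' * gen D K ν (.idem (l ++ List.replicate (s' + 1) i))
      = tailDot D K ν i s' * tailCross D K ν i s
        * gen D K ν (.idem (l ++ List.replicate (s' + 1) i)) := by
  have h1 := GrMod.gen_app_mul_tailCross (D := D) (K := K) (ν := ν) (i := i) (.dot l i []) h
  rw [KLRGen.app_dot, List.nil_append] at h1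
  rw [mul_assoc, tailDot_mul_idem, ← h1, mul_assoc,
    ← idem_mul_tailCross D K ν (by omega : s + 1 < s' + 1), ← mul_assoc, tailDot_mul_idem]

theorem tailCross_mul_tailCross {s s' : ℕ} (h : s + 1 < s') (l : List I) :
    tailCross D K ν i s * tailCross D K ν i s'
        * gen D K ν (.idem (l ++ List.replicate (s' + 2) i))
      = tailCross D K ν i s' * tailCross D K ν i s
        * gen D K ν (.idem (l ++ List.replicate (s' + 2) i)) := by
  have h1 := GrMod.gen_app_mul_tailCross (D := D) (K := K) (ν := ν) (i := i) (.cross l i i []) h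
  rw [KLRGen.app_cross, List.nil_append] at h1
  rw [mul_assoc, tailCross_mul_idem, ← h1, mul_assoc,
    ← idem_mul_tailCross D K ν (by omega : s + 1 < s' + 2), ← mul_assoc, tailCross_mul_idem]

theorem tailDot_mul_gen_cross (s : ℕ) (l : List I) :
    tailDot D K ν i s * gen D K ν (.cross l i i (List.replicate s i))
      = gen D K ν (.dot (l ++ [i]) i (List.replicate s i))
        * gen D K ν (.cross l i i (List.replicate s i)) := by
  simpa [tailDot, List.replicate_succ] using
    rightOp_mul_gen D K ν (h := .dot [] i (List.replicate s i))
    (x := .cross l i i (List.replicate s i)) (l := l ++ [i]) (by simp)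

theorem tailDot_succ_mul_gen_cross (s : ℕ) (l : List I) :
    tailDot D K ν i (s + 1) * gen D K ν (.cross l i i (List.replicate s i))
      = gen D K ν (.dot l i (i :: List.replicate s i))
        * gen D K ν (.cross l i i (List.replicate s i)) := by
  simpa [tailDot, List.replicate_succ] using
    rightOp_mul_gen D K ν (h := .dot [] i (List.replicate (s + 1) i))
    (x := .cross l i i (List.replicate s i)) (l := l) (by simp [List.replicate_succ])

theorem tailCross_mul_gen (s : ℕ) (l : List I) {j : KLRGen I}
    (hj : j.top = l ++ List.replicate (s + 2) i) :
    tailCross D K ν i s * gen D K ν j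
      = gen D K ν (.cross l i i (List.replicate s i)) * gen D K ν j := by
  simpa [tailCross, List.replicate_succ] using
    rightOp_mul_gen D K ν (h := .cross [] i i (List.replicate s i))
    (x := j) (l := l) (by simpa [List.replicate_succ] using hj)

theorem mk_slideTerm_self (l b : List I) :
    mk D K ν (slideTerm D K l i i b)
      = (open Classical in if D.IsReal i then 1 else 0) * gen D K ν (.idem (l ++ i :: i :: b)) := by
  unfold slideTerm
  by_cases h : D.IsReal i
  · rw [if_pos ⟨rfl, h⟩, if_pos h, one_mul]; rfl
  · rw [if_neg (fun h' => h h'.2), if_neg h, zero_mul, map_zero]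

theorem tailDot_mul_idem_two (s : ℕ) (l : List I) :
    tailDot D K ν i s * gen D K ν (.idem (l ++ List.replicate (s + 2) i))
      = gen D K ν (.dot (l ++ [i]) i (List.replicate s i)) := by
  rw [← tailDot_mul_idem, List.append_assoc]; rfl

theorem tailDot_succ_mul_tailCross (s : ℕ) (l : List I) :
    tailDot D K ν i (s + 1) * tailCross D K ν i s
        * gen D K ν (.idem (l ++ List.replicate (s + 2) i))
      = (tailCross D K ν i s * tailDot D K ν i s
        + (open Classical in if D.IsReal i then 1 else 0))
        * gen D K ν (.idem (l ++ List.replicate (s + 2) i)) := by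
  rw [mul_assoc, tailCross_mul_idem, tailDot_succ_mul_gen_cross, slide_left, mk_slideTerm_self,
    add_mul, mul_assoc (tailCross D K ν i s), tailDot_mul_idem_two,
    tailCross_mul_gen D K ν (l := l) _ (by simp [List.replicate_succ])]
  rfl

theorem tailDot_mul_tailCross_self (s : ℕ) (l : List I) :
    tailDot D K ν i s * tailCross D K ν i s
        * gen D K ν (.idem (l ++ List.replicate (s + 2) i))
      = (tailCross D K ν i s * tailDot D K ν i (s + 1)
        - (open Classical in if D.IsReal i then 1 else 0))
        * gen D K ν (.idem (l ++ List.replicate (s + 2) i)) := by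
  rw [mul_assoc, tailCross_mul_idem, tailDot_mul_gen_cross, slide_right, mk_slideTerm_self,
    sub_mul, mul_assoc (tailCross D K ν i s), tailDot_mul_idem,
    tailCross_mul_gen D K ν (l := l) _ (by simp [List.replicate_succ])]
  rfl

theorem tailCross_mul_self (s : ℕ) (l : List I) :
    tailCross D K ν i s * tailCross D K ν i s
      * gen D K ν (.idem (l ++ List.replicate (s + 2) i)) = 0 := by
  rw [mul_assoc, tailCross_mul_idem,
    tailCross_mul_gen D K ν (l := l) _ (by simp [List.replicate_succ]), quadratic]
  simp [doubleCross]

theorem tailCross_braid (s : ℕ) (l : List I) :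
    tailCross D K ν i s * tailCross D K ν i (s + 1) * tailCross D K ν i s
        * gen D K ν (.idem (l ++ List.replicate (s + 3) i))
      = tailCross D K ν i (s + 1) * tailCross D K ν i s * tailCross D K ν i (s + 1)
        * gen D K ν (.idem (l ++ List.replicate (s + 3) i)) := by
  have hb := braid D K ν l (List.replicate s i) i i i
  have h0 : braidTerm D K l i i i (List.replicate s i) = 0 := by
    unfold braidTerm
    exact if_neg fun h => h.2.2.1 rfl
  have e : l ++ List.replicate (s + 3) i = (l ++ [i]) ++ List.replicate (s + 2) i := by
    rw [List.append_assoc]; rfl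
  have h1 : tailCross D K ν i s * gen D K ν (.idem (l ++ List.replicate (s + 3) i))
      = gen D K ν (.cross (l ++ [i]) i i (List.replicate s i)) := by
    rw [e, tailCross_mul_idem]
  have h2 : tailCross D K ν i (s + 1) * gen D K ν (.idem (l ++ List.replicate (s + 3) i))
      = gen D K ν (.cross l i i (List.replicate (s + 1) i)) :=
    tailCross_mul_idem D K ν i (s + 1) l
  have ht : ∀ j : KLRGen I, j.top = l ++ List.replicate (s + 3) i →
      tailCross D K ν i s * gen D K ν j
        = gen D K ν (.cross (l ++ [i]) i i (List.replicate s i)) * gen D K ν j := by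
    intro j hj
    exact tailCross_mul_gen D K ν s (l ++ [i]) (by rw [hj, e])
  have ht' : ∀ j : KLRGen I, j.top = l ++ List.replicate (s + 3) i →
      tailCross D K ν i (s + 1) * gen D K ν j
        = gen D K ν (.cross l i i (List.replicate (s + 1) i)) * gen D K ν j := by
    intro j hj
    exact tailCross_mul_gen D K ν (s + 1) l hj
  rw [h0, map_zero, sub_zero] at hb
  rw [mul_assoc, h1, mul_assoc, ht' _ (by simp [List.replicate_succ]), mul_assoc _ _ (gen D K ν _),
    h2, mul_assoc _ _ (gen D K ν _), ht _ (by simp [List.replicate_succ]), ← mul_assoc, ← mul_assoc]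
  have hs : ∀ z, tailCross D K ν i s * gen D K ν (.cross l i i (List.replicate (s + 1) i)) * z
      = gen D K ν (.cross (l ++ [i]) i i (List.replicate s i))
        * gen D K ν (.cross l i i (List.replicate (s + 1) i)) * z := by
    intro z
    rw [ht _ (by simp [List.replicate_succ])]
  have hs' : ∀ z, tailCross D K ν i (s + 1)
        * gen D K ν (.cross (l ++ [i]) i i (List.replicate s i)) * z
      = gen D K ν (.cross l i i (List.replicate (s + 1) i))
        * gen D K ν (.cross (l ++ [i]) i i (List.replicate s i)) * z := by
    intro z
    rw [ht' _ (by simp [List.replicate_succ])]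
  rw [hs, hs']
  exact hb

end KLR

end

noncomputable section

namespace GrMod

open KLR

variable {I : Type u} [DecidableEq I] {D : BorcherdsCartanDatum I} {K : Type v} [Field K]
variable {μ ν : Multiset I}

/-- A realization of a graded `R(μ)`-module as a subspace of the graded `R(ν)`-module `M`, on which
diagrams act with additional vertical strands `w` at the right. -/
structure GrEmb (P : GrMod.{u, v, w} D K μ) (M : GrMod.{u, v, w} D K ν) (w : List I) where
  toFun : P.carrier →ₗ[K] M.carrier
  injective : Function.Injective toFun
  map_gen : ∀ g p, toFun (gen D K μ g • p) = gen D K ν (g.app w) • toFun p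
  map_gr : ∀ d p, toFun p ∈ M.gr d ↔ p ∈ P.gr d

/-- A subspace which is stable under the elementary diagrams is a submodule. -/
def submoduleOfGen (P : GrMod.{u, v, w} D K μ) (S : Submodule K P.carrier)
    (h : ∀ g, ∀ p ∈ S, gen D K μ g • p ∈ S) : Submodule (KLR D K μ) P.carrier where
  carrier := S
  zero_mem' := S.zero_mem
  add_mem' := S.add_mem
  smul_mem' z := by
    induction z using KLR.induction with
    | h0 c => intro p hp; rw [algebraMap_smul]; exact S.smul_mem c hp
    | hg g => intro p hp; exact h g p hp
    | hm y z hy hz => intro p hp; rw [mul_smul]; exact hy (hz hp)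
    | ha y z hy hz => intro p hp; rw [add_smul]; exact S.add_mem (hy hp) (hz hp)

namespace GrEmb

variable {P : GrMod.{u, v, w} D K μ} {M : GrMod.{u, v, w} D K ν} {w : List I}

theorem range_le (φ : GrEmb P M w) : LinearMap.range φ.toFun ≤ M.tailSpan w := by
  rintro _ ⟨p, rfl⟩
  rw [eq_sum_idem p, map_sum]
  refine sum_mem fun u _ => ?_
  rw [φ.map_gen]
  exact idem_smul_mem_tailSpan _ _ _

/-- Composition of realizations. -/
def comp {ρ : Multiset I} {N : GrMod.{u, v, w} D K ρ} {u' : List I} (φ : GrEmb P M w)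
    (ψ : GrEmb N P u') : GrEmb N M (u' ++ w) where
  toFun := φ.toFun ∘ₗ ψ.toFun
  injective := φ.injective.comp ψ.injective
  map_gen g p := by
    rw [LinearMap.comp_apply, ψ.map_gen, φ.map_gen, KLRGen.app_app, LinearMap.comp_apply]
  map_gr d p := by rw [LinearMap.comp_apply, φ.map_gr, ψ.map_gr]

/-- The identity realization. -/
def refl (M : GrMod.{u, v, w} D K ν) : GrEmb M M [] where
  toFun := LinearMap.id
  injective := Function.injective_id
  map_gen g p := by rw [KLRGen.app_nil]; rfl
  map_gr d p := Iff.rfl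

/-- The socle of `M` in `M`. -/
def ofSoc (M : GrMod.{u, v, w} D K ν) : GrEmb M.soc M [] where
  toFun := (M.socle.restrictScalars K).subtype
  injective := Submodule.subtype_injective _
  map_gen g p := by rw [KLRGen.app_nil]; rfl
  map_gr d p := Iff.rfl

/-- The module `e_i M` in `M`. -/
def ofE (M : GrMod.{u, v, w} D K ν) (i : I) : GrEmb (M.e i) M [i] where
  toFun := (M.tailSpace i).subtype
  injective := Submodule.subtype_injective _
  map_gen g p := by
    rw [← KLRGen.addStrand_eq_app]
    change ((M.tailAction i (gen D K _ g) p : M.tailSpace i) : M.carrier) = _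
    rw [tailAction_gen]
    rfl
  map_gr d p := Iff.rfl

theorem range_ofSoc (M : GrMod.{u, v, w} D K ν) :
    LinearMap.range (ofSoc M).toFun = M.socle.restrictScalars K :=
  Submodule.range_subtype _

theorem range_ofE (M : GrMod.{u, v, w} D K ν) (i : I) :
    LinearMap.range (ofE M i).toFun = M.tailSpan [i] := by
  refine le_antisymm (ofE M i).range_le ?_
  change _ ≤ LinearMap.range (M.tailSpace i).subtype
  rw [Submodule.range_subtype]
  refine Submodule.span_le.mpr ?_
  rintro _ ⟨l, m, rfl⟩
  change _ • _ • _ = _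
  rw [← mul_smul]
  exact congrArg (· • m) (tailIdem_mul_gen D K ν i (.idem l))

theorem map_tailSpan (φ : GrEmb P M w) (hφ : LinearMap.range φ.toFun = M.tailSpan w)
    (u' : List I) : (P.tailSpan u').map φ.toFun = M.tailSpan (u' ++ w) := by
  apply le_antisymm
  · rw [Submodule.map_le_iff_le_comap]
    refine Submodule.span_le.mpr ?_
    rintro _ ⟨l, m, rfl⟩
    change φ.toFun _ ∈ M.tailSpan (u' ++ w)
    rw [φ.map_gen, KLRGen.app_idem, List.append_assoc]
    exact idem_smul_mem_tailSpan _ _ _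
  · refine Submodule.span_le.mpr ?_
    rintro _ ⟨l, m, rfl⟩
    have h1 : gen D K ν (.idem (l ++ (u' ++ w))) • m ∈ LinearMap.range φ.toFun := by
      rw [hφ, ← List.append_assoc]
      exact idem_smul_mem_tailSpan _ _ _
    obtain ⟨p, hp⟩ := h1
    refine ⟨gen D K μ (.idem (l ++ u')) • p, idem_smul_mem_tailSpan _ _ _, ?_⟩
    rw [φ.map_gen, hp, KLRGen.app_idem, List.append_assoc, ← mul_smul, idem_mul_self]

theorem range_comp {ρ : Multiset I} {N : GrMod.{u, v, w} D K ρ} {u' : List I} (φ : GrEmb P M w)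
    (ψ : GrEmb N P u') (hφ : LinearMap.range φ.toFun = M.tailSpan w)
    (hψ : LinearMap.range ψ.toFun = P.tailSpan u') :
    LinearMap.range (φ.comp ψ).toFun = M.tailSpan (u' ++ w) := by
  rw [← φ.map_tailSpan hφ, ← hψ]
  exact LinearMap.range_comp _ _

/-- The subspace of `M` which realizes a submodule of `P`. -/
def image (φ : GrEmb P M w) (S : Submodule (KLR D K μ) P.carrier) : Submodule K M.carrier :=
  (S.restrictScalars K).map φ.toFun

theorem mem_image (φ : GrEmb P M w) {S : Submodule (KLR D K μ) P.carrier} {p : P.carrier} :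
    φ.toFun p ∈ φ.image S ↔ p ∈ S := by
  refine ⟨?_, fun h => ⟨p, h, rfl⟩⟩
  rintro ⟨q, hq, h⟩
  rw [← φ.injective h]
  exact hq

theorem image_le_image (φ : GrEmb P M w) {S T : Submodule (KLR D K μ) P.carrier} :
    φ.image S ≤ φ.image T ↔ S ≤ T :=
  ⟨fun h _ hp => φ.mem_image.mp (h (φ.mem_image.mpr hp)), fun h => Submodule.map_mono h⟩

theorem image_inj (φ : GrEmb P M w) {S T : Submodule (KLR D K μ) P.carrier} :
    φ.image S = φ.image T ↔ S = T := by
  simp only [le_antisymm_iff, φ.image_le_image]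

@[simp] theorem image_bot (φ : GrEmb P M w) : φ.image ⊥ = ⊥ := by
  rw [image, Submodule.restrictScalars_bot, Submodule.map_bot]

theorem image_top (φ : GrEmb P M w) : φ.image ⊤ = LinearMap.range φ.toFun := by
  rw [image, Submodule.restrictScalars_top, Submodule.map_top]

theorem isGraded_iff (φ : GrEmb P M w) {S : Submodule (KLR D K μ) P.carrier} :
    P.IsGraded S ↔ M.IsHomog (φ.image S) := by
  have h : ∀ d, (S.restrictScalars K ⊓ P.gr d).map φ.toFun = φ.image S ⊓ M.gr d := by
    intro d
    ext x
    constructor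
    · rintro ⟨p, ⟨h1, h2⟩, rfl⟩
      exact ⟨⟨p, h1, rfl⟩, (φ.map_gr d p).mpr h2⟩
    · rintro ⟨⟨p, h1, rfl⟩, h2⟩
      exact ⟨p, ⟨h1, (φ.map_gr d p).mp h2⟩, rfl⟩
  rw [IsGraded, IsHomog, ← Submodule.map_le_map_iff_of_injective φ.injective, Submodule.map_iSup]
  simp only [h]
  rfl

theorem isLevelSub_image (φ : GrEmb P M w) {S : Submodule (KLR D K μ) P.carrier}
    (hS : P.IsGraded S) : M.IsLevelSub w (φ.image S) where
  le := by
    refine le_trans ?_ φ.range_le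
    exact LinearMap.map_le_range
  stable g := by
    rintro _ ⟨p, hp, rfl⟩
    rw [← φ.map_gen]
    exact ⟨_, S.smul_mem _ hp, rfl⟩
  homog := φ.isGraded_iff.mp hS

theorem exists_image_eq (φ : GrEmb P M w) {T : Submodule K M.carrier} (hT : M.IsLevelSub w T)
    (hle : T ≤ LinearMap.range φ.toFun) :
    ∃ S : Submodule (KLR D K μ) P.carrier, P.IsGraded S ∧ φ.image S = T := by
  let S := submoduleOfGen P (T.comap φ.toFun) (fun g p hp => by
    change φ.toFun _ ∈ T
    rw [φ.map_gen]
    exact hT.stable g _ hp)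
  have hS : φ.image S = T := Submodule.map_comap_eq_of_le hle
  exact ⟨S, by rw [φ.isGraded_iff, hS]; exact hT.homog, hS⟩

end GrEmb

/-- The subspaces which correspond to the gr-irreducible submodules of the restriction of `M` to
diagrams with vertical strands labelled `w` at the far right. -/
structure IsLevelSimple (M : GrMod.{u, v, w} D K ν) (w : List I)
    (S : Submodule K M.carrier) : Prop where
  isLevelSub : M.IsLevelSub w S
  ne_bot : S ≠ ⊥
  eq_bot_or_eq : ∀ T ≤ S, M.IsLevelSub w T → T = ⊥ ∨ T = S

namespace GrEmb

variable {P : GrMod.{u, v, w} D K μ} {M : GrMod.{u, v, w} D K ν} {w : List I}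

theorem isGrIrreducibleSub_iff (φ : GrEmb P M w) {S : Submodule (KLR D K μ) P.carrier} :
    P.IsGrIrreducibleSub S ↔ M.IsLevelSimple w (φ.image S) := by
  constructor
  · rintro ⟨h1, h2, h3⟩
    refine ⟨φ.isLevelSub_image h1, ?_, ?_⟩
    · rwa [← φ.image_bot, Ne, φ.image_inj]
    · intro T hT hT'
      obtain ⟨T, hTg, rfl⟩ := φ.exists_image_eq hT' (hT.trans LinearMap.map_le_range)
      rw [φ.image_le_image] at hT
      rw [← φ.image_bot, φ.image_inj, φ.image_inj]
      exact h3 T hT hTg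
  · rintro ⟨h1, h2, h3⟩
    refine ⟨φ.isGraded_iff.mpr h1.homog, ?_, ?_⟩
    · rwa [← φ.image_bot, Ne, φ.image_inj] at h2
    · intro T hT hTg
      have := h3 _ (φ.image_le_image.mpr hT) (φ.isLevelSub_image hTg)
      rwa [← φ.image_bot, φ.image_inj, φ.image_inj] at this

/-- An element of `R(ν)` which commutes with the action of the diagrams with strands `w` at the
right gives a linear map. -/
theorem exists_lift {P' : GrMod.{u, v, w} D K μ} (φ : GrEmb P M w)
    (ψ : GrEmb P' M w) (z : KLR D K ν)
    (hz : ∀ p, z • ψ.toFun p ∈ LinearMap.range φ.toFun)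
    (hc : ∀ g p, z • gen D K ν (KLRGen.app w g) • ψ.toFun p
      = gen D K ν (KLRGen.app w g) • z • ψ.toFun p) :
    ∃ f : P'.carrier →ₗ[KLR D K μ] P.carrier, ∀ p, φ.toFun (f p) = z • ψ.toFun p := by
  choose f hf using hz
  have hadd : ∀ p q, f (p + q) = f p + f q := fun p q => φ.injective (by
    simp only [map_add, hf, smul_add])
  have hsmul : ∀ (c : K) p, f (c • p) = c • f p := fun c p => φ.injective (by
    rw [hf, map_smul, map_smul, hf, smul_comm])
  refine ⟨⟨⟨f, hadd⟩, fun a => ?_⟩, hf⟩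
  induction a using KLR.induction with
  | h0 c =>
    intro p
    rw [RingHom.id_apply, algebraMap_smul]
    exact (hsmul c p).trans (algebraMap_smul _ c (f p)).symm
  | hg g =>
    intro p
    apply φ.injective
    simp only [RingHom.id_apply, φ.map_gen, ψ.map_gen, hf, hc]
  | hm y z hy hz =>
    intro p
    simp only [RingHom.id_apply, mul_smul] at hy hz ⊢
    rw [hy, hz]
  | ha y z hy hz =>
    intro p
    simp only [RingHom.id_apply, add_smul] at hy hz ⊢
    rw [hadd, hy, hz]

end GrEmb

theorem exists_grEmb_ePow (i : I) (n : ℕ) (M : GrMod.{u, v, w} D K ν) :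
    ∃ φ : GrEmb (ePow i n M) M (List.replicate n i),
      LinearMap.range φ.toFun = M.tailSpan (List.replicate n i) := by
  induction n generalizing ν with
  | zero =>
    refine ⟨GrEmb.refl M, ?_⟩
    refine le_antisymm (GrEmb.range_le _) fun x _ => ⟨x, rfl⟩
  | succ n ih =>
    obtain ⟨φ, hφ⟩ := ih (M.e i)
    have h := (GrEmb.ofE M i).range_comp φ (GrEmb.range_ofE M i) hφ
    rw [List.replicate_succ']
    exact ⟨(GrEmb.ofE M i).comp φ, h⟩

section Operators

variable {M : GrMod.{u, v, w} D K ν} {i : I} {n : ℕ}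

theorem smul_mem_tailSpan_of_comm {w : List I} {z : KLR D K ν}
    (hz : ∀ l, gen D K ν (.idem (l ++ w)) * z = z * gen D K ν (.idem (l ++ w))) {x : M.carrier}
    (hx : x ∈ M.tailSpan w) : z • x ∈ M.tailSpan w := by
  refine smul_mem_span_of_forall D K ν z ?_ hx
  rintro _ ⟨l, m, rfl⟩
  rw [← mul_smul, ← hz, mul_smul]
  exact idem_smul_mem_tailSpan _ _ _

theorem tailDot_smul_mem {s : ℕ} (hs : s < n) {x : M.carrier}
    (hx : x ∈ M.tailSpan (List.replicate n i)) :
    tailDot D K ν i s • x ∈ M.tailSpan (List.replicate n i) :=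
  smul_mem_tailSpan_of_comm (fun l => idem_mul_tailDot D K ν hs l) hx

theorem tailCross_smul_mem {s : ℕ} (hs : s + 1 < n) {x : M.carrier}
    (hx : x ∈ M.tailSpan (List.replicate n i)) :
    tailCross D K ν i s • x ∈ M.tailSpan (List.replicate n i) :=
  smul_mem_tailSpan_of_comm (fun l => idem_mul_tailCross D K ν hs l) hx

variable {Q : GrMod.{u, v, w} D K μ} (φ : GrEmb Q M (List.replicate n i))
  (hφ : LinearMap.range φ.toFun = M.tailSpan (List.replicate n i))
include hφ

/-- The dots on the last `n` strands, with a sign, and the crossings of these strands act on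
`e_i^n M`. -/
theorem exists_operators : ∃ x t : ℕ → Module.End (KLR D K μ) Q.carrier,
    (∀ s < n, ∀ p, φ.toFun (x s p) = (-tailDot D K ν i s) • φ.toFun p) ∧
    (∀ s, s + 1 < n → ∀ p, φ.toFun (t s p) = tailCross D K ν i s • φ.toFun p) := by
  have hx : ∀ s, ∃ f : Module.End (KLR D K μ) Q.carrier,
      s < n → ∀ p, φ.toFun (f p) = (-tailDot D K ν i s) • φ.toFun p := by
    intro s
    by_cases hs : s < n
    · obtain ⟨f, hf⟩ := φ.exists_lift φ (-tailDot D K ν i s)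
        (fun p => by
          rw [hφ, neg_smul]
          exact neg_mem (tailDot_smul_mem hs (φ.range_le ⟨p, rfl⟩)))
        (fun g p => by
          rw [← mul_smul, ← mul_smul, mul_neg, gen_app_mul_tailDot g hs, neg_mul])
      exact ⟨f, fun _ => hf⟩
    · exact ⟨0, fun h => absurd h hs⟩
  have ht : ∀ s, ∃ f : Module.End (KLR D K μ) Q.carrier,
      s + 1 < n → ∀ p, φ.toFun (f p) = tailCross D K ν i s • φ.toFun p := by
    intro s
    by_cases hs : s + 1 < n
    · obtain ⟨f, hf⟩ := φ.exists_lift φ (tailCross D K ν i s)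
        (fun p => by
          rw [hφ]
          exact tailCross_smul_mem hs (φ.range_le ⟨p, rfl⟩))
        (fun g p => by
          rw [← mul_smul, ← mul_smul, gen_app_mul_tailCross g hs])
      exact ⟨f, fun _ => hf⟩
    · exact ⟨0, fun h => absurd h hs⟩
  choose x hx using hx
  choose t ht using ht
  exact ⟨x, t, hx, ht⟩

theorem eq_of_smul_idem {f g : Module.End (KLR D K μ) Q.carrier} {y z : KLR D K ν} {m : ℕ}
    (hm : m ≤ n) (hf : ∀ p, φ.toFun (f p) = y • φ.toFun p)
    (hg : ∀ p, φ.toFun (g p) = z • φ.toFun p)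
    (h : ∀ l, y * gen D K ν (.idem (l ++ List.replicate m i))
      = z * gen D K ν (.idem (l ++ List.replicate m i))) : f = g := by
  ext p
  apply φ.injective
  rw [hf, hg]
  refine smul_congr_of_mem_tailSpan h (tailSpan_replicate_le i hm ?_)
  rw [← hφ]
  exact ⟨p, rfl⟩

variable {x t : ℕ → Module.End (KLR D K μ) Q.carrier}
  (hx : ∀ s < n, ∀ p, φ.toFun (x s p) = (-tailDot D K ν i s) • φ.toFun p)
  (ht : ∀ s, s + 1 < n → ∀ p, φ.toFun (t s p) = tailCross D K ν i s • φ.toFun p)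
include hx ht

theorem nilCoxeter_operators : NilCoxeter n t where
  sq s hs := by
    refine eq_of_smul_idem φ hφ (y := tailCross D K ν i s * tailCross D K ν i s) (z := 0)
      (m := s + 2) (by omega) ?_ ?_ ?_
    · intro p; rw [Module.End.mul_apply, ht s hs, ht s hs, mul_smul]
    · intro p; simp
    · intro l; rw [tailCross_mul_self, zero_mul]
  comm s s' hs hs' := by
    refine eq_of_smul_idem φ hφ (y := tailCross D K ν i s * tailCross D K ν i s')
      (z := tailCross D K ν i s' * tailCross D K ν i s)
      (m := s' + 2) (by omega) ?_ ?_ ?_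
    · intro p; rw [Module.End.mul_apply, ht s (by omega), ht s' hs', mul_smul]
    · intro p; rw [Module.End.mul_apply, ht s' hs', ht s (by omega), mul_smul]
    · intro l; exact tailCross_mul_tailCross D K ν hs l
  braid s hs := by
    refine eq_of_smul_idem φ hφ
      (y := tailCross D K ν i s * tailCross D K ν i (s + 1) * tailCross D K ν i s)
      (z := tailCross D K ν i (s + 1) * tailCross D K ν i s * tailCross D K ν i (s + 1))
      (m := s + 3) (by omega) ?_ ?_ ?_
    · intro p
      rw [Module.End.mul_apply, Module.End.mul_apply, ht s (by omega), ht _ hs, ht s (by omega),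
        mul_smul, mul_smul]
    · intro p
      rw [Module.End.mul_apply, Module.End.mul_apply, ht _ hs, ht s (by omega), ht _ hs,
        mul_smul, mul_smul]
    · intro l; exact tailCross_braid D K ν s l

theorem nilHecke_operators (hi : D.IsReal i) : NilHecke n x t where
  toNilCoxeter := nilCoxeter_operators φ hφ hx ht
  dot_comm := by
    have key : ∀ s s', s < s' → s' < n → x s * x s' = x s' * x s := by
      intro s s' hs hs'
      refine eq_of_smul_idem φ hφ (y := tailDot D K ν i s * tailDot D K ν i s')
        (z := tailDot D K ν i s' * tailDot D K ν i s) (m := s' + 1) (by omega) ?_ ?_ ?_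
      · intro p
        rw [Module.End.mul_apply, hx s (by omega), hx s' hs', ← mul_smul, neg_mul_neg]
      · intro p
        rw [Module.End.mul_apply, hx s' hs', hx s (by omega), ← mul_smul, neg_mul_neg]
      · intro l; exact tailDot_mul_tailDot D K ν hs l
    intro s s' hs hs'
    rcases lt_trichotomy s s' with h | rfl | h
    · exact key s s' h hs'
    · rfl
    · exact (key s' s h hs).symm
  cross_dot_comm s s' hs hs' h1 h2 := by
    have hl : ∀ p, φ.toFun ((t s * x s') p) = (tailCross D K ν i s * -tailDot D K ν i s') •
        φ.toFun p := by
      intro p; rw [Module.End.mul_apply, ht s hs, hx s' hs', mul_smul]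
    have hr : ∀ p, φ.toFun ((x s' * t s) p) = (-tailDot D K ν i s' * tailCross D K ν i s) •
        φ.toFun p := by
      intro p; rw [Module.End.mul_apply, hx s' hs', ht s hs, mul_smul]
    rcases Nat.lt_or_ge s' s with h3 | h3
    · refine eq_of_smul_idem φ hφ (m := s + 2) (by omega) hl hr fun l => ?_
      rw [mul_neg, neg_mul, neg_mul, neg_mul, tailDot_mul_tailCross D K ν h3 l]
    · refine eq_of_smul_idem φ hφ (m := s' + 1) (by omega) hl hr fun l => ?_
      rw [mul_neg, neg_mul, neg_mul, neg_mul, tailCross_mul_tailDot D K ν (by omega) l]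
  slide_left s hs := by
    refine eq_of_smul_idem φ hφ (y := tailCross D K ν i s * -tailDot D K ν i s)
      (z := -tailDot D K ν i (s + 1) * tailCross D K ν i s + 1) (m := s + 2) (by omega) ?_ ?_ ?_
    · intro p; rw [Module.End.mul_apply, ht s hs, hx s (by omega), mul_smul]
    · intro p
      rw [LinearMap.add_apply, map_add, Module.End.mul_apply, hx _ hs, ht s hs, add_smul, mul_smul,
        one_smul, Module.End.one_apply]
    · intro l
      have := tailDot_succ_mul_tailCross D K ν (i := i) s l
      rw [if_pos hi, add_mul, one_mul] at this
      rw [add_mul, neg_mul, neg_mul, this, mul_neg, neg_mul, one_mul]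
      abel
  slide_right s hs := by
    refine eq_of_smul_idem φ hφ (y := tailCross D K ν i s * -tailDot D K ν i (s + 1))
      (z := -tailDot D K ν i s * tailCross D K ν i s - 1) (m := s + 2) (by omega) ?_ ?_ ?_
    · intro p; rw [Module.End.mul_apply, ht s hs, hx _ hs, mul_smul]
    · intro p
      rw [LinearMap.sub_apply, map_sub, Module.End.mul_apply, hx s (by omega), ht s hs, sub_smul,
        mul_smul, one_smul, Module.End.one_apply]
    · intro l
      have := tailDot_mul_tailCross_self D K ν (i := i) s l
      rw [if_pos hi, sub_mul, one_mul] at this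
      rw [sub_mul, neg_mul, neg_mul, this, mul_neg, neg_mul, one_mul]
      abel

end Operators

end GrMod

end

noncomputable section

namespace GrMod

open KLR

variable {I : Type u} [DecidableEq I] {D : BorcherdsCartanDatum I} {K : Type v} [Field K]
variable {ν : Multiset I} {M : GrMod.{u, v, w} D K ν}

variable (M) in
/-- The homogeneous component of degree `d`. -/
def comp (d : ℤ) : M.carrier →ₗ[K] M.carrier :=
  (M.gr d).subtype ∘ₗ DirectSum.component K ℤ (fun d => M.gr d) d ∘ₗ
    (LinearEquiv.ofBijective (DirectSum.coeLinearMap M.gr) M.isInternal).symm.toLinearMap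

theorem comp_mem (d : ℤ) (x : M.carrier) : M.comp d x ∈ M.gr d := Subtype.property _

theorem comp_of_mem {d e : ℤ} {x : M.carrier} (hx : x ∈ M.gr e) :
    M.comp d x = if e = d then x else 0 := by
  have h : (LinearEquiv.ofBijective (DirectSum.coeLinearMap M.gr) M.isInternal).symm x
      = DirectSum.lof K ℤ (fun d => M.gr d) e ⟨x, hx⟩ := by
    rw [LinearEquiv.symm_apply_eq]
    exact (DirectSum.coeLinearMap_lof M.gr e ⟨x, hx⟩).symm
  simp only [comp, LinearMap.comp_apply, LinearEquiv.coe_coe, h]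
  by_cases hd : e = d
  · subst hd
    rw [DirectSum.component.lof_self, if_pos rfl]; rfl
  · rw [DirectSum.component.of, dif_neg hd, if_neg hd, map_zero]

theorem IsHomog.comp_mem {S : Submodule K M.carrier} (hS : M.IsHomog S) (d : ℤ) {x : M.carrier}
    (hx : x ∈ S) : M.comp d x ∈ S := by
  have hx' := hS hx
  clear hx
  induction hx' using Submodule.iSup_induction' with
  | zero => simp
  | mem e x hx' =>
    rw [comp_of_mem hx'.2]
    split_ifs
    · exact hx'.1
    · exact zero_mem _
  | add x y _ _ hx hy =>
    rw [map_add]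
    exact add_mem hx hy

theorem mem_iSup_of_comp_mem {S : Submodule K M.carrier} {x : M.carrier}
    (h : ∀ d, M.comp d x ∈ S) : x ∈ ⨆ d, S ⊓ M.gr d := by
  classical
  set e := LinearEquiv.ofBijective (DirectSum.coeLinearMap M.gr) M.isInternal with he
  have hx : x = DirectSum.coeLinearMap M.gr (e.symm x) :=
    (e.apply_symm_apply x).symm
  rw [hx, DirectSum.coeLinearMap_eq_dfinsuppSum]
  refine Submodule.dfinsuppSum_mem _ _ _ fun d _ => ?_
  exact Submodule.mem_iSup_of_mem d ⟨h d, Subtype.property _⟩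

theorem isHomog_iff {S : Submodule K M.carrier} :
    M.IsHomog S ↔ ∀ x ∈ S, ∀ d, M.comp d x ∈ S :=
  ⟨fun hS _ hx d => hS.comp_mem d hx, fun h x hx => mem_iSup_of_comp_mem (h x hx)⟩

theorem IsHomog.inf {S T : Submodule K M.carrier} (hS : M.IsHomog S) (hT : M.IsHomog T) :
    M.IsHomog (S ⊓ T) :=
  isHomog_iff.mpr fun _ hx d => ⟨hS.comp_mem d hx.1, hT.comp_mem d hx.2⟩

theorem smul_comp {e : ℤ} {z : KLR D K ν} (hz : z ∈ homogeneous D K ν e) (d : ℤ) (x : M.carrier) :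
    z • M.comp d x = M.comp (e + d) (z • x) := by
  have hx : x ∈ ⨆ d, M.gr d := by rw [iSup_gr]; exact Submodule.mem_top
  induction hx using Submodule.iSup_induction' with
  | zero => simp
  | mem f x hx =>
    rw [comp_of_mem hx, comp_of_mem (M.smul_mem e f z x hz hx)]
    simp only [add_right_inj]
    split_ifs <;> simp
  | add x y _ _ hx hy => simp only [map_add, smul_add, hx, hy]

theorem IsLevelSub.inf {w : List I} {S T : Submodule K M.carrier} (hS : M.IsLevelSub w S)
    (hT : M.IsLevelSub w T) : M.IsLevelSub w (S ⊓ T) where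
  le := inf_le_left.trans hS.le
  stable g m hm := ⟨hS.stable g m hm.1, hT.stable g m hm.2⟩
  homog := hS.homog.inf hT.homog

theorem IsLevelSimple.eq_of_inf_ne_bot {w : List I} {S T : Submodule K M.carrier}
    (hS : M.IsLevelSimple w S) (hT : M.IsLevelSimple w T) (h : S ⊓ T ≠ ⊥) : S = T := by
  have h1 := hS.isLevelSub.inf hT.isLevelSub
  rw [← (hS.eq_bot_or_eq _ inf_le_left h1).resolve_left h]
  exact (hT.eq_bot_or_eq _ inf_le_right h1).resolve_left h

/-- The vectors of `S` which are killed by the first `m` members of a family of elements. -/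
def killed (S : Submodule K M.carrier) (f : ℕ → KLR D K ν) (m : ℕ) : Submodule K M.carrier where
  carrier := {x | x ∈ S ∧ ∀ s < m, f s • x = 0}
  zero_mem' := ⟨zero_mem _, fun _ _ => smul_zero _⟩
  add_mem' hx hy := ⟨add_mem hx.1 hy.1, fun s hs => by rw [smul_add, hx.2 s hs, hy.2 s hs, add_zero]⟩
  smul_mem' c x hx := ⟨S.smul_mem c hx.1, fun s hs => by rw [smul_comm, hx.2 s hs, smul_zero]⟩

theorem mem_killed {S : Submodule K M.carrier} {f : ℕ → KLR D K ν} {m : ℕ} {x : M.carrier} :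
    x ∈ killed S f m ↔ x ∈ S ∧ ∀ s < m, f s • x = 0 := Iff.rfl

theorem killed_le (S : Submodule K M.carrier) (f : ℕ → KLR D K ν) (m : ℕ) : killed S f m ≤ S :=
  fun _ hx => hx.1

theorem IsLevelSub.killed {w : List I} {S : Submodule K M.carrier} (hS : M.IsLevelSub w S)
    {f : ℕ → KLR D K ν} {m : ℕ} {e : ℤ} (hf : ∀ s, f s ∈ homogeneous D K ν e)
    (hc : ∀ s < m, ∀ g, gen D K ν (KLRGen.app w g) * f s = f s * gen D K ν (KLRGen.app w g)) :
    M.IsLevelSub w (killed S f m) where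
  le := (killed_le S f m).trans hS.le
  stable g x hx := ⟨hS.stable g x hx.1, fun s hs => by
    rw [← mul_smul, ← hc s hs, mul_smul, hx.2 s hs, smul_zero]⟩
  homog := isHomog_iff.mpr fun x hx d => ⟨hS.homog.comp_mem d hx.1, fun s hs => by
    rw [smul_comp (hf s), hx.2 s hs, map_zero]⟩

theorem IsLevelSub.killed_tailDot {i : I} {n : ℕ} {S : Submodule K M.carrier}
    (hS : M.IsLevelSub (List.replicate n i) S) :
    M.IsLevelSub (List.replicate n i) (GrMod.killed S (tailDot D K ν i) n) :=
  hS.killed (tailDot_mem D K ν i) fun _ hs g => gen_app_mul_tailDot g hs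

/-- A finite-dimensional nonzero graded subspace contains a nonzero vector which is killed by all
homogeneous elements of positive degree stabilizing the subspace. -/
theorem IsHomog.exists_top_degree [FiniteDimensional K M.carrier] {S : Submodule K M.carrier}
    (hS : M.IsHomog S) (h0 : S ≠ ⊥) :
    ∃ x ∈ S, x ≠ 0 ∧ ∀ e > 0, ∀ z ∈ homogeneous D K ν e, z • x ∈ S → z • x = 0 := by
  have hind := ((DirectSum.isInternal_submodule_iff_iSupIndep_and_iSup_eq_top _).mp
    M.isInternal).1
  have hfin : {d | S ⊓ M.gr d ≠ ⊥}.Finite :=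
    (Submodule.finite_ne_bot_of_iSupIndep hind).subset fun d hd h => hd (by rw [h, inf_bot_eq])
  have hne : {d | S ⊓ M.gr d ≠ ⊥}.Nonempty := by
    by_contra hcon
    rw [Set.not_nonempty_iff_eq_empty, Set.eq_empty_iff_forall_notMem] at hcon
    apply h0
    rw [eq_bot_iff]
    refine le_trans hS (iSup_le fun d => ?_)
    have := hcon d
    simp only [Set.mem_ofPred_eq, not_not] at this
    rw [this]
  obtain ⟨d, hd, hmax⟩ := hfin.exists_maximal hne
  obtain ⟨x, hx, hx0⟩ := Submodule.exists_mem_ne_zero_of_ne_bot hd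
  refine ⟨x, hx.1, hx0, fun e he z hz hzx => ?_⟩
  have h1 : z • x ∈ S ⊓ M.gr (e + d) := ⟨hzx, M.smul_mem e d z x hz hx.2⟩
  by_contra hcon
  have h2 : e + d ∈ {d | S ⊓ M.gr d ≠ ⊥} := fun h => hcon (by rwa [h, Submodule.mem_bot] at h1)
  have := hmax h2 (by omega)
  omega

theorem IsLevelSub.exists_isLevelSimple [FiniteDimensional K M.carrier] {w : List I}
    {S : Submodule K M.carrier} (hS : M.IsLevelSub w S) (h0 : S ≠ ⊥) :
    ∃ T ≤ S, M.IsLevelSimple w T := by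
  obtain ⟨T, ⟨hT1, hT2, hT3⟩, hmin⟩ := wellFounded_lt.has_min
    {T : Submodule K M.carrier | M.IsLevelSub w T ∧ T ≠ ⊥ ∧ T ≤ S} ⟨S, hS, h0, le_rfl⟩
  refine ⟨T, hT3, hT1, hT2, fun T' hT' hl => ?_⟩
  by_contra hcon
  push Not at hcon
  exact hmin T' ⟨hl, hcon.1, hT'.trans hT3⟩ (lt_of_le_of_ne hT' hcon.2)

theorem tailDot_deg_pos (i : I) : 0 < 2 * (D.r i : ℤ) := by
  have := D.r_pos i
  omega

theorem IsLevelSub.killed_tailDot_ne_bot [FiniteDimensional K M.carrier] {i : I} {n : ℕ}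
    {S : Submodule K M.carrier} (hS : M.IsLevelSub (List.replicate n i) S) (h0 : S ≠ ⊥) {a b : ℕ}
    (hd : ∀ s, a ≤ s → s < b → ∀ x ∈ S, tailDot D K ν i s • x ∈ S) :
    ∃ x ∈ S, x ≠ 0 ∧ ∀ s, a ≤ s → s < b → tailDot D K ν i s • x = 0 := by
  obtain ⟨x, hx, hx0, h⟩ := hS.homog.exists_top_degree h0
  exact ⟨x, hx, hx0, fun s hs hs' =>
    h _ (tailDot_deg_pos i) _ (tailDot_mem D K ν i s) (hd s hs hs' x hx)⟩

section Irreducible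

variable (hM : M.IsGrIrreducible)
include hM

theorem IsGrIrreducible.eq_bot_or_eq_top {T : Submodule K M.carrier} (hT : M.IsLevelSub [] T) :
    T = ⊥ ∨ T = ⊤ := by
  have hr : LinearMap.range (GrEmb.refl M).toFun = ⊤ := LinearMap.range_id
  obtain ⟨S, hS, rfl⟩ := (GrEmb.refl M).exists_image_eq hT (by rw [hr]; exact le_top)
  rcases hM.2 S hS with rfl | rfl
  · left; exact GrEmb.image_bot _
  · right; rw [GrEmb.image_top, hr]

variable {i : I}

/-- A nonzero submodule of `e_i^n M` is not killed by `e_i^(q - n)` unless `e_i^q M = 0`. -/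
theorem IsGrIrreducible.exists_idem_smul_ne_zero {n q : ℕ} (hnq : n ≤ q)
    (hq : M.tailSpan (List.replicate q i) ≠ ⊥) {S : Submodule K M.carrier}
    (hS : M.IsLevelSub (List.replicate n i) S) (h0 : S ≠ ⊥) :
    ∃ l, ∃ m ∈ S, gen D K ν (.idem (l ++ List.replicate q i)) • m ≠ 0 := by
  by_contra hcon
  push Not at hcon
  rcases hnq.eq_or_lt with rfl | hlt
  · apply h0
    rw [eq_bot_iff]
    intro x hx
    rw [Submodule.mem_bot]
    exact eq_zero_of_idem_smul (hS.le hx) fun l => hcon l x hx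
  · obtain ⟨T, hT, hST, hT0⟩ := exists_isLevelSub_nil_of_idem_smul_eq_zero hlt hS hcon
    rcases hM.eq_bot_or_eq_top hT with rfl | rfl
    · exact h0 (le_bot_iff.mp hST)
    · apply hq
      rw [eq_bot_iff]
      refine Submodule.span_le.mpr ?_
      rintro _ ⟨l, m, rfl⟩
      exact (Submodule.mem_bot K).mpr (hT0 l m Submodule.mem_top)

/-- If `e_i^(n+1) M = 0`, then `e_i^n M` has no proper nonzero submodule which is stable under dots
and crossings of the last `n` strands. -/
theorem IsGrIrreducible.eq_tailSpan {n : ℕ} (hn : M.tailSpan (List.replicate (n + 1) i) = ⊥)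
    {N : Submodule K M.carrier} (hN : M.IsLevelSub (List.replicate n i) N) (h0 : N ≠ ⊥)
    (hd : ∀ s < n, ∀ m ∈ N, tailDot D K ν i s • m ∈ N)
    (hc : ∀ s, s + 1 < n → ∀ m ∈ N, tailCross D K ν i s • m ∈ N) :
    N = M.tailSpan (List.replicate n i) := by
  obtain ⟨T, hT, hNT, h⟩ := exists_isLevelSub_nil_of_idem_smul_mem hN hc le_rfl hN hd
    (fun l m _ => by
      have := M.idem_smul_mem_tailSpan l (List.replicate (n + 1) i) m
      rwa [hn, Submodule.mem_bot] at this)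
    (fun l m hm => hN.idem_smul_mem _ hm)
  rcases hM.eq_bot_or_eq_top hT with rfl | rfl
  · exact absurd (le_bot_iff.mp hNT) h0
  · exact le_antisymm hN.le fun x hx => mem_of_idem_smul_mem hx fun l => h l x Submodule.mem_top

end Irreducible

/-- The subspace of `S` spanned by the components for the words ending in `w`. -/
def restrict (S : Submodule K M.carrier) (w : List I) : Submodule K M.carrier :=
  Submodule.span K {x | ∃ l, ∃ m ∈ S, x = gen D K ν (.idem (l ++ w)) • m}

theorem restrict_le_tailSpan (S : Submodule K M.carrier) (w : List I) :
    restrict S w ≤ M.tailSpan w := by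
  refine Submodule.span_le.mpr ?_
  rintro _ ⟨l, m, -, rfl⟩
  exact idem_smul_mem_tailSpan _ _ _

theorem IsLevelSub.restrict_le {w w' : List I} {S : Submodule K M.carrier}
    (hS : M.IsLevelSub w S) : restrict S w' ≤ S := by
  refine Submodule.span_le.mpr ?_
  rintro _ ⟨l, m, hm, rfl⟩
  exact hS.idem_smul_mem _ hm

theorem smul_mem_restrict {S : Submodule K M.carrier} {w : List I} {z : KLR D K ν}
    (hz : ∀ x ∈ S, z • x ∈ S)
    (hc : ∀ l, gen D K ν (.idem (l ++ w)) * z = z * gen D K ν (.idem (l ++ w)))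
    {x : M.carrier} (hx : x ∈ restrict S w) : z • x ∈ restrict S w := by
  refine smul_mem_span_of_forall D K ν z ?_ hx
  rintro _ ⟨l, m, hm, rfl⟩
  rw [← mul_smul, ← hc, mul_smul]
  exact Submodule.subset_span ⟨l, _, hz m hm, rfl⟩

theorem IsLevelSub.restrict {u w : List I} {S : Submodule K M.carrier} (hS : M.IsLevelSub w S) :
    M.IsLevelSub (u ++ w) (GrMod.restrict S (u ++ w)) where
  le := restrict_le_tailSpan S _
  stable g x hx := by
    have hx' := restrict_le_tailSpan S _ hx
    have h1 := hS.stable (g.app u) x (hS.restrict_le hx)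
    rw [KLRGen.app_app] at h1
    rw [← top_mul_gen, mul_smul, KLRGen.top_app]
    exact Submodule.subset_span ⟨_, _, h1, rfl⟩
  homog := by
    apply isHomog_span
    rintro _ ⟨l, m, hm, rfl⟩
    exact hS.homog.smul_mem_iSup (T := GrMod.restrict S (u ++ w)) (gen_mem_homogeneous D K ν _)
      (fun m hm => Submodule.subset_span ⟨l, m, hm, rfl⟩) hm

theorem IsLevelSub.restrict_replicate {i : I} {n q : ℕ} (hnq : n ≤ q) {S : Submodule K M.carrier}
    (hS : M.IsLevelSub (List.replicate n i) S) :
    M.IsLevelSub (List.replicate q i) (GrMod.restrict S (List.replicate q i)) := by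
  have := hS.restrict (u := List.replicate (q - n) i)
  rwa [List.replicate_append_replicate, Nat.sub_add_cancel hnq] at this

theorem IsGrIrreducible.restrict_ne_bot (hM : M.IsGrIrreducible) {i : I} {n q : ℕ} (hnq : n ≤ q)
    (hq : M.tailSpan (List.replicate q i) ≠ ⊥) {S : Submodule K M.carrier}
    (hS : M.IsLevelSub (List.replicate n i) S) (h0 : S ≠ ⊥) :
    restrict S (List.replicate q i) ≠ ⊥ := by
  obtain ⟨l, m, hm, hne⟩ := hM.exists_idem_smul_ne_zero hnq hq hS h0
  intro h
  apply hne
  rw [← Submodule.mem_bot K, ← h]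
  exact Submodule.subset_span ⟨l, m, hm, rfl⟩

/-- A submodule of `e_i^n M` is stable under the dots on the strands `n, n + 1, …`. -/
theorem IsLevelSub.tailDot_smul_mem {i : I} {n s : ℕ} (hns : n ≤ s) {S : Submodule K M.carrier}
    (hS : M.IsLevelSub (List.replicate n i) S) {x : M.carrier} (hx : x ∈ S) :
    tailDot D K ν i s • x ∈ S := by
  rw [tailDot, rightOp, Finset.sum_smul]
  refine sum_mem fun l _ => ?_
  have := hS.stable (.dot l i (List.replicate (s - n) i)) x hx
  rw [KLRGen.app_dot, List.replicate_append_replicate, Nat.sub_add_cancel hns] at this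
  simpa using this

end GrMod

end

noncomputable section

namespace GrMod

open KLR

variable {I : Type u} [DecidableEq I] {D : BorcherdsCartanDatum I} {K : Type v} [Field K]
variable {μ ν : Multiset I} {P Q : GrMod.{u, v, w} D K μ}

theorem isGraded_iff_comp {S : Submodule (KLR D K μ) Q.carrier} :
    Q.IsGraded S ↔ ∀ x ∈ S, ∀ d, Q.comp d x ∈ S :=
  isHomog_iff (S := S.restrictScalars K)

/-- Linear maps which are homogeneous of degree `e`. -/
def IsHomogMap (f : P.carrier →ₗ[KLR D K μ] Q.carrier) (e : ℤ) : Prop :=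
  ∀ d, ∀ p ∈ P.gr d, f p ∈ Q.gr (e + d)

theorem IsHomogMap.map_comp {f : P.carrier →ₗ[KLR D K μ] Q.carrier} {e : ℤ}
    (hf : IsHomogMap f e) (d : ℤ) (x : P.carrier) : f (P.comp d x) = Q.comp (e + d) (f x) := by
  have hx : x ∈ ⨆ d, P.gr d := by rw [iSup_gr]; exact Submodule.mem_top
  induction hx using Submodule.iSup_induction' with
  | zero => simp
  | mem c x hx =>
    rw [comp_of_mem hx, comp_of_mem (hf c x hx)]
    simp only [add_right_inj]
    split_ifs <;> simp
  | add x y _ _ hx hy => simp only [map_add, hx, hy]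

theorem isHomogMap_id : IsHomogMap (1 : Module.End (KLR D K μ) Q.carrier) 0 :=
  fun d p hp => by rw [zero_add]; exact hp

theorem isHomogMap_zero (e : ℤ) : IsHomogMap (0 : P.carrier →ₗ[KLR D K μ] Q.carrier) e :=
  fun _ _ _ => zero_mem _

theorem IsHomogMap.comp {N : GrMod.{u, v, w} D K μ} {f : P.carrier →ₗ[KLR D K μ] Q.carrier}
    {g : N.carrier →ₗ[KLR D K μ] P.carrier} {a b : ℤ} (hf : IsHomogMap f a)
    (hg : IsHomogMap g b) : IsHomogMap (f ∘ₗ g) (a + b) := fun d p hp => by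
  rw [add_assoc]
  exact hf _ _ (hg d p hp)

theorem IsHomogMap.mul {f g : Module.End (KLR D K μ) Q.carrier} {a b : ℤ} (hf : IsHomogMap f a)
    (hg : IsHomogMap g b) : IsHomogMap (f * g) (a + b) := hf.comp hg

theorem IsHomogMap.pow {f : Module.End (KLR D K μ) Q.carrier} {a : ℤ} (hf : IsHomogMap f a)
    (k : ℕ) : IsHomogMap (f ^ k) (k * a) := by
  induction k with
  | zero => simpa using isHomogMap_id
  | succ k ih =>
    rw [pow_succ, Nat.cast_succ, add_mul, one_mul]
    exact ih.mul hf

theorem IsHomogMap.add {f g : P.carrier →ₗ[KLR D K μ] Q.carrier} {a : ℤ} (hf : IsHomogMap f a)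
    (hg : IsHomogMap g a) : IsHomogMap (f + g) a :=
  fun d p hp => add_mem (hf d p hp) (hg d p hp)

theorem IsHomogMap.isGraded_comap {f : P.carrier →ₗ[KLR D K μ] Q.carrier} {e : ℤ}
    (hf : IsHomogMap f e) {S : Submodule (KLR D K μ) Q.carrier} (hS : Q.IsGraded S) :
    P.IsGraded (S.comap f) := by
  rw [isGraded_iff_comp] at hS ⊢
  intro x hx d
  rw [Submodule.mem_comap, hf.map_comp]
  exact hS _ hx _

theorem IsHomogMap.isGraded_map {f : P.carrier →ₗ[KLR D K μ] Q.carrier} {e : ℤ}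
    (hf : IsHomogMap f e) {S : Submodule (KLR D K μ) P.carrier} (hS : P.IsGraded S) :
    Q.IsGraded (S.map f) := by
  rw [isGraded_iff_comp] at hS ⊢
  rintro _ ⟨x, hx, rfl⟩ d
  have := hf.map_comp (d - e) x
  rw [add_sub_cancel] at this
  rw [← this]
  exact ⟨_, hS x hx _, rfl⟩

theorem isGraded_bot : Q.IsGraded ⊥ := by
  rw [isGraded_iff_comp]
  rintro x hx d
  rw [(Submodule.mem_bot _).mp hx, map_zero]
  exact zero_mem _

theorem isGraded_top : Q.IsGraded ⊤ := by
  rw [isGraded_iff_comp]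
  exact fun _ _ _ => Submodule.mem_top

theorem isGraded_sInf {A : Set (Submodule (KLR D K μ) Q.carrier)} (hA : ∀ S ∈ A, Q.IsGraded S) :
    Q.IsGraded (sInf A) := by
  rw [isGraded_iff_comp]
  intro x hx d
  rw [Submodule.mem_sInf] at hx ⊢
  exact fun S hS => isGraded_iff_comp.mp (hA S hS) x (hx S hS) d

theorem isGraded_inf {S T : Submodule (KLR D K μ) Q.carrier} (hS : Q.IsGraded S)
    (hT : Q.IsGraded T) : Q.IsGraded (S ⊓ T) := by
  rw [isGraded_iff_comp] at *
  exact fun x hx d => ⟨hS x hx.1 d, hT x hx.2 d⟩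

theorem isGraded_iInf {ι : Sort*} {S : ι → Submodule (KLR D K μ) Q.carrier}
    (hS : ∀ j, Q.IsGraded (S j)) : Q.IsGraded (⨅ j, S j) :=
  isGraded_sInf (by rintro _ ⟨j, rfl⟩; exact hS j)

/-- The image of a gr-irreducible submodule under a homogeneous map is zero or gr-irreducible. -/
theorem IsGrIrreducibleSub.map {f : P.carrier →ₗ[KLR D K μ] Q.carrier} {e : ℤ}
    (hf : IsHomogMap f e) {S : Submodule (KLR D K μ) P.carrier} (hS : P.IsGrIrreducibleSub S) :
    S.map f = ⊥ ∨ Q.IsGrIrreducibleSub (S.map f) := by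
  rw [or_iff_not_imp_left]
  refine fun h0 => ⟨hf.isGraded_map hS.1, h0, fun T hT hTg => ?_⟩
  have hST : (S ⊓ T.comap f).map f = T := by
    apply le_antisymm
    · rintro _ ⟨x, hx, rfl⟩
      exact hx.2
    · intro y hy
      obtain ⟨x, hx, rfl⟩ := hT hy
      exact ⟨x, ⟨hx, hy⟩, rfl⟩
  rcases hS.2.2 _ inf_le_left (isGraded_inf hS.1 (hf.isGraded_comap hTg)) with h | h
  · left
    rw [← hST, h, Submodule.map_bot]
  · right
    rw [← hST, h]

theorem isGrIrreducible_iff_top : Q.IsGrIrreducible ↔ Q.IsGrIrreducibleSub ⊤ := by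
  constructor
  · rintro ⟨h1, h2⟩
    exact ⟨isGraded_top, top_ne_bot, fun T _ hT => h2 T hT⟩
  · rintro ⟨-, h1, h2⟩
    refine ⟨?_, fun T hT => h2 T le_top hT⟩
    rw [← Submodule.nontrivial_iff (KLR D K μ)]
    exact ⟨⊤, ⊥, h1⟩

theorem GrEmb.isGrIrreducible_iff {M : GrMod.{u, v, w} D K ν} {u : List I} (φ : GrEmb P M u) :
    P.IsGrIrreducible ↔ M.IsLevelSimple u (LinearMap.range φ.toFun) := by
  rw [isGrIrreducible_iff_top, φ.isGrIrreducibleSub_iff, φ.image_top]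

section NilHecke

open NilCoxeter NilHecke

variable {n : ℕ} {x t : ℕ → Module.End (KLR D K μ) Q.carrier}

/-- The vectors killed by `x 0, …, x (n - 1)`. -/
def commonKer (x : ℕ → Module.End (KLR D K μ) Q.carrier) (n : ℕ) :
    Submodule (KLR D K μ) Q.carrier :=
  ⨅ s : Fin n, LinearMap.ker (x s)

theorem mem_commonKer {v : Q.carrier} : v ∈ commonKer x n ↔ ∀ s < n, x s v = 0 := by
  simp only [commonKer, Submodule.mem_iInf, LinearMap.mem_ker]
  exact ⟨fun h s hs => h ⟨s, hs⟩, fun h s => h s s.2⟩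

theorem isGraded_ker {f : P.carrier →ₗ[KLR D K μ] Q.carrier} {e : ℤ} (hf : IsHomogMap f e) :
    P.IsGraded (LinearMap.ker f) :=
  hf.isGraded_comap isGraded_bot

theorem isGraded_commonKer {e : ℤ} (hx : ∀ s < n, IsHomogMap (x s) e) :
    Q.IsGraded (commonKer x n) :=
  isGraded_iInf fun s => isGraded_ker (hx s s.2)

theorem isHomogMap_chain {e : ℤ} {k : ℕ} (ht : ∀ s < k, IsHomogMap (t s) e) :
    IsHomogMap (chain t k) (k * e) := by
  induction k with
  | zero => simpa using isHomogMap_id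
  | succ k ih =>
    rw [chain_succ, Nat.cast_succ, add_mul, one_mul]
    exact (ih fun s hs => ht s (by omega)).mul (ht k (by omega))

theorem isHomogMap_longest {e : ℤ} {m : ℕ} (ht : ∀ s, s + 1 < m → IsHomogMap (t s) e) :
    IsHomogMap (longest t m) (m.choose 2 * e) := by
  induction m with
  | zero => simpa [longest] using isHomogMap_id
  | succ m ih =>
    rw [longest, Nat.choose_succ_succ' m 1, Nat.choose_one_right, Nat.cast_add, add_mul]
    exact (isHomogMap_chain fun s hs => ht s (by omega)).mul (ih fun s hs => ht s (by omega))

theorem isHomogMap_esymm {e : ℤ} {k : ℕ} (hx : ∀ s < k, IsHomogMap (x s) e) (j : ℕ) :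
    IsHomogMap (esymm x k j) (j * e) := by
  induction k generalizing j with
  | zero => cases j with
    | zero => simpa using isHomogMap_id
    | succ j => rw [esymm_eq_zero x (Nat.succ_pos j)]; exact isHomogMap_zero _
  | succ k ih => cases j with
    | zero => simpa using isHomogMap_id
    | succ j =>
      rw [esymm_succ]
      refine (ih (fun s hs => hx s (by omega)) _).add ?_
      rw [Nat.cast_succ, add_mul, one_mul, add_comm]
      exact (hx k (by omega)).mul (ih (fun s hs => hx s (by omega)) _)

theorem esymm_apply_eq_zero (h : NilHecke n x t) {k : ℕ} (hk : k ≤ n) {v : Q.carrier}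
    (hv : ∀ s < k, x s v = 0) (j : ℕ) : esymm x k (j + 1) v = 0 := by
  induction k generalizing j with
  | zero => rw [esymm_eq_zero x (Nat.succ_pos j)]; rfl
  | succ k ih =>
    rw [esymm_succ, LinearMap.add_apply, ih (by omega) fun s hs => hv s (by omega),
      h.dot_mul_esymm (by omega) (by omega), Module.End.mul_apply, hv k (by omega), map_zero,
      add_zero]

theorem esymm_apply_eq_zero_of_le (h : NilHecke n x t) {k : ℕ} (hk : k ≤ n) {v : Q.carrier}
    (hv : ∀ s, k ≤ s → s < n → x s v = 0) (h0 : ∀ j, esymm x n (j + 1) v = 0) (j : ℕ) :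
    esymm x k (j + 1) v = 0 := by
  have : ∀ m, k ≤ m → m ≤ n → esymm x m (j + 1) v = esymm x k (j + 1) v := by
    intro m hm
    induction m, hm using Nat.le_induction with
    | base => exact fun _ => rfl
    | succ m hm ih =>
      intro hmn
      rw [esymm_succ, LinearMap.add_apply, h.dot_mul_esymm (by omega) (by omega),
        Module.End.mul_apply, hv m hm (by omega), map_zero, add_zero, ih (by omega)]
  rw [← this n hk le_rfl, h0]

variable {e a : ℤ} (h : NilHecke n x t) (hx : ∀ s < n, IsHomogMap (x s) e)
  (ht : ∀ s, s + 1 < n → IsHomogMap (t s) a)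
  (hQ : ∀ T : Submodule (KLR D K μ) Q.carrier, Q.IsGraded T → T ≠ ⊥ →
    (∀ s < n, ∀ v ∈ T, x s v ∈ T) → (∀ s, s + 1 < n → ∀ v ∈ T, t s v ∈ T) → T = ⊤)
  {F : Submodule (KLR D K μ) Q.carrier} (hF : Q.IsGraded F) (hF0 : F ≠ ⊥)
  (hFx : F ≤ commonKer x n)
include h hx ht hQ hF hF0 hFx

/-- Vectors killed by the `x s` generate the module under the operators `t s`. -/
theorem eq_top_of_le_of_cross_mem {T : Submodule (KLR D K μ) Q.carrier} (hT : Q.IsGraded T)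
    (hFT : F ≤ T) (hTt : ∀ s, s + 1 < n → ∀ v ∈ T, t s v ∈ T) : T = ⊤ := by
  let A : Set (Submodule (KLR D K μ) Q.carrier) :=
    {T | Q.IsGraded T ∧ F ≤ T ∧ ∀ s, s + 1 < n → ∀ v ∈ T, t s v ∈ T}
  have hN : Q.IsGraded (sInf A) := isGraded_sInf fun S hS => hS.1
  have hFN : F ≤ sInf A := le_sInf fun S hS => hS.2.1
  have hNt : ∀ s, s + 1 < n → ∀ v ∈ sInf A, t s v ∈ sInf A := by
    intro s hs v hv
    rw [Submodule.mem_sInf] at hv ⊢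
    exact fun S hS => hS.2.2 s hs v (hv S hS)
  have hNx : sInf A ⊓ ⨅ s : Fin n, (sInf A).comap (x s) ∈ A := by
    refine ⟨isGraded_inf hN (isGraded_iInf fun s => (hx s s.2).isGraded_comap hN),
      le_inf hFN (le_iInf fun s v hv => ?_), fun s hs v hv => ⟨hNt s hs v hv.1, ?_⟩⟩
    · rw [Submodule.mem_comap, mem_commonKer.mp (hFx hv) s s.2]
      exact zero_mem _
    · have hv2 : ∀ s < n, x s v ∈ sInf A := fun s hs =>
        (Submodule.mem_iInf _).mp hv.2 ⟨s, hs⟩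
      rw [SetLike.mem_coe, Submodule.mem_iInf]
      rintro ⟨s', hs'⟩
      rw [Submodule.mem_comap, ← Module.End.mul_apply]
      change (x s' * t s) v ∈ _
      by_cases h1 : s' = s
      · subst h1
        have := h.slide_right s' hs
        rw [eq_sub_iff_add_eq] at this
        rw [← this, LinearMap.add_apply, Module.End.mul_apply]
        exact add_mem (hNt _ hs _ (hv2 _ hs)) hv.1
      by_cases h2 : s' = s + 1
      · subst h2
        have := h.slide_left s hs
        rw [← sub_eq_iff_eq_add] at this
        rw [← this, LinearMap.sub_apply, Module.End.mul_apply]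
        exact sub_mem (hNt _ hs _ (hv2 _ (by omega))) hv.1
      · rw [← h.cross_dot_comm s s' hs hs' h1 h2, Module.End.mul_apply]
        exact hNt s hs _ (hv2 s' hs')
  have hle : sInf A ≤ T := sInf_le ⟨hT, hFT, hTt⟩
  have htop : sInf A = ⊤ := by
    refine hQ _ hN (fun h0 => hF0 (le_bot_iff.mp (h0 ▸ hFN))) (fun s hs v hv => ?_) hNt
    exact (Submodule.mem_iInf _).mp ((sInf_le hNx) hv).2 ⟨s, hs⟩
  exact top_le_iff.mp (htop ▸ hle)

theorem esymm_eq_zero_of_generated (j : ℕ) : esymm x n (j + 1) = 0 := by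
  rw [← LinearMap.ker_eq_top]
  refine eq_top_of_le_of_cross_mem h hx ht hQ hF hF0 hFx (isGraded_ker (isHomogMap_esymm hx _))
    (fun v hv => ?_) fun s hs v hv => ?_
  · exact esymm_apply_eq_zero h le_rfl (mem_commonKer.mp (hFx hv)) j
  · rw [LinearMap.mem_ker, ← Module.End.mul_apply, ← h.cross_mul_esymm hs le_rfl,
      Module.End.mul_apply, LinearMap.mem_ker.mp hv, map_zero]

theorem commonKer_eq : F = commonKer x n := by
  refine le_antisymm hFx fun v hv => ?_
  have hl : (F.map (longest t n)).comap (longest t n) = ⊤ := by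
    refine eq_top_of_le_of_cross_mem h hx ht hQ hF hF0 hFx
      ((isHomogMap_longest ht).isGraded_comap ((isHomogMap_longest ht).isGraded_map hF))
      (Submodule.le_comap_map _ _) fun s hs v _ => ?_
    rw [Submodule.mem_comap, ← Module.End.mul_apply, h.longest_mul hs le_rfl]
    exact zero_mem _
  have hv' : v ∈ (F.map (longest t n)).comap (longest t n) := hl ▸ Submodule.mem_top
  obtain ⟨f, hf, hfv⟩ := hv'
  have : v - f = 0 := by
    refine h.longest_smul_injective le_rfl (fun s hs => ?_) (v := v - f) ?_
    · change x s (v - f) = 0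
      rw [map_sub, mem_commonKer.mp hv s hs, mem_commonKer.mp (hFx hf) s hs, sub_zero]
    · change longest t n (v - f) = 0
      rw [map_sub, hfv, sub_self]
  rwa [sub_eq_zero.mp this]

end NilHecke

end GrMod

end

noncomputable section

namespace GrMod

open KLR NilCoxeter NilHecke

variable {I : Type u} [DecidableEq I] {D : BorcherdsCartanDatum I} {K : Type v} [Field K]
variable {μ ν : Multiset I} {M : GrMod.{u, v, w} D K ν} {Q : GrMod.{u, v, w} D K μ} {i : I} {n : ℕ}

theorem GrEmb.isHomogMap {P : GrMod.{u, v, w} D K μ} {u' : List I} (φ : GrEmb Q M u')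
    (ψ : GrEmb P M u') {e : ℤ} {z : KLR D K ν} (hz : z ∈ homogeneous D K ν e)
    {f : P.carrier →ₗ[KLR D K μ] Q.carrier} (hf : ∀ p, φ.toFun (f p) = z • ψ.toFun p) :
    IsHomogMap f e := by
  intro d p hp
  rw [← φ.map_gr, hf]
  exact M.smul_mem _ _ _ _ hz ((ψ.map_gr d p).mpr hp)

theorem GrEmb.map_longest {u' : List I} (φ : GrEmb Q M u')
    {t : ℕ → Module.End (KLR D K μ) Q.carrier} {y : ℕ → KLR D K ν} {m : ℕ}
    (ht : ∀ s, s + 1 < m → ∀ p, φ.toFun (t s p) = y s • φ.toFun p) (p : Q.carrier) :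
    φ.toFun (longest t m p) = longest y m • φ.toFun p := by
  have hc : ∀ k < m, ∀ p, φ.toFun (chain t k p) = chain y k • φ.toFun p := by
    intro k
    induction k with
    | zero => intro _ p; simp
    | succ k ih =>
      intro hk p
      rw [chain_succ, chain_succ, Module.End.mul_apply, ih (by omega), ht k hk, mul_smul]
  induction m generalizing p with
  | zero => simp [longest]
  | succ m ih =>
    rw [longest, longest, Module.End.mul_apply, hc m (by omega),
      ih (fun s hs => ht s (by omega)) p fun k hk => hc k (by omega), mul_smul]

theorem tailSpan_replicate_eq_bot (hn : ν.card < n) : M.tailSpan (List.replicate n i) = ⊥ := by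
  rw [eq_bot_iff]
  refine Submodule.span_le.mpr ?_
  rintro _ ⟨l, m, rfl⟩
  rw [idem_outside, zero_smul]
  · exact zero_mem _
  · rw [mem_wordsOf]
    rintro rfl
    simp at hn

/-- The largest number of trailing letters `i`. -/
theorem exists_max_tailSpan (h : M.tailSpan (List.replicate n i) ≠ ⊥) :
    ∃ q, n ≤ q ∧ M.tailSpan (List.replicate q i) ≠ ⊥ ∧
      M.tailSpan (List.replicate (q + 1) i) = ⊥ := by
  classical
  have hex : ∃ k, M.tailSpan (List.replicate (n + k) i) = ⊥ :=
    ⟨ν.card + 1, tailSpan_replicate_eq_bot (by omega)⟩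
  obtain ⟨k, hk⟩ : ∃ k, Nat.find hex = k + 1 := by
    refine Nat.exists_eq_succ_of_ne_zero fun h0 => h ?_
    have := Nat.find_spec hex
    rwa [h0] at this
  refine ⟨n + k, by omega, Nat.find_min hex (by omega), ?_⟩
  have := Nat.find_spec hex
  rwa [hk] at this

theorem GrEmb.finiteDimensional [FiniteDimensional K M.carrier] {u' : List I}
    (φ : GrEmb Q M u') : FiniteDimensional K Q.carrier :=
  FiniteDimensional.of_injective φ.toFun φ.injective

/-- If `e_i^(n+1) M = 0`, then a nonzero graded submodule of `e_i^n M` which is stable under the dots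
and crossings of the last `n` strands is all of `e_i^n M`. -/
theorem IsGrIrreducible.eq_top (hM : M.IsGrIrreducible)
    (hn : M.tailSpan (List.replicate (n + 1) i) = ⊥)
    (φ : GrEmb Q M (List.replicate n i))
    (hφ : LinearMap.range φ.toFun = M.tailSpan (List.replicate n i))
    {x t : ℕ → Module.End (KLR D K μ) Q.carrier}
    (hx : ∀ s < n, ∀ p, φ.toFun (x s p) = (-tailDot D K ν i s) • φ.toFun p)
    (ht : ∀ s, s + 1 < n → ∀ p, φ.toFun (t s p) = tailCross D K ν i s • φ.toFun p)
    {T : Submodule (KLR D K μ) Q.carrier} (hT : Q.IsGraded T) (h0 : T ≠ ⊥)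
    (hTx : ∀ s < n, ∀ v ∈ T, x s v ∈ T) (hTt : ∀ s, s + 1 < n → ∀ v ∈ T, t s v ∈ T) : T = ⊤ := by
  rw [← φ.image_inj, φ.image_top, hφ]
  refine hM.eq_tailSpan hn (φ.isLevelSub_image hT) ?_ ?_ ?_
  · rwa [← φ.image_bot, Ne, φ.image_inj]
  · rintro s hs _ ⟨p, hp, rfl⟩
    rw [← neg_neg (tailDot D K ν i s), neg_smul, ← hx s hs]
    exact neg_mem ⟨_, hTx s hs p hp, rfl⟩
  · rintro s hs _ ⟨p, hp, rfl⟩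
    rw [← ht s hs]
    exact ⟨_, hTt s hs p hp, rfl⟩

section Real

variable (hM : M.IsGrIrreducible) (hi : D.IsReal i) (q : ℕ)

/-- The vectors of `e_i^q M` which are killed by all dots on the last `q` strands. -/
abbrev dotKilled (M : GrMod.{u, v, w} D K ν) (i : I) (q : ℕ) : Submodule K M.carrier :=
  killed (M.tailSpan (List.replicate q i)) (tailDot D K ν i) q

theorem GrEmb.image_commonKer (φ : GrEmb Q M (List.replicate n i))
    (hφ : LinearMap.range φ.toFun = M.tailSpan (List.replicate n i))
    {x : ℕ → Module.End (KLR D K μ) Q.carrier}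
    (hx : ∀ s < n, ∀ p, φ.toFun (x s p) = (-tailDot D K ν i s) • φ.toFun p) :
    φ.image (commonKer x n) = dotKilled M i n := by
  have key : ∀ p, φ.toFun p ∈ dotKilled M i n ↔ p ∈ commonKer x n := by
    intro p
    rw [mem_killed, mem_commonKer, ← hφ]
    refine ⟨fun h s hs => φ.injective ?_, fun h => ⟨⟨p, rfl⟩, fun s hs => ?_⟩⟩
    · rw [hx s hs, neg_smul, h.2 s hs, neg_zero, map_zero]
    · rw [← neg_eq_zero, ← neg_smul, ← hx s hs, h s hs, map_zero]
  apply le_antisymm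
  · rintro _ ⟨p, hp, rfl⟩
    exact (key p).mpr hp
  · intro y hy
    have hy' : y ∈ LinearMap.range φ.toFun := hφ ▸ hy.1
    obtain ⟨p, rfl⟩ := hy'
    exact φ.mem_image.mpr ((key p).mp hy)

theorem form_self_of_isReal (hi : D.IsReal i) : -D.form i i = -(2 * (D.r i : ℤ)) := by
  rw [BorcherdsCartanDatum.form, show D.a i i = 2 from hi, mul_comm]

include hM hi in
/-- In the extremal case, the vectors killed by the dots form a simple module, and the symmetric
functions of the dots act by zero. -/
theorem IsGrIrreducible.isLevelSimple_dotKilled [FiniteDimensional K M.carrier]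
    (hq : M.tailSpan (List.replicate q i) ≠ ⊥) (hq' : M.tailSpan (List.replicate (q + 1) i) = ⊥)
    (φ : GrEmb Q M (List.replicate q i))
    (hφ : LinearMap.range φ.toFun = M.tailSpan (List.replicate q i))
    {x t : ℕ → Module.End (KLR D K μ) Q.carrier}
    (hx : ∀ s < q, ∀ p, φ.toFun (x s p) = (-tailDot D K ν i s) • φ.toFun p)
    (ht : ∀ s, s + 1 < q → ∀ p, φ.toFun (t s p) = tailCross D K ν i s • φ.toFun p) :
    M.IsLevelSimple (List.replicate q i) (dotKilled M i q) ∧ ∀ j, esymm x q (j + 1) = 0 := by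
  have h := nilHecke_operators φ hφ hx ht hi
  have hx' : ∀ s < q, IsHomogMap (x s) (2 * (D.r i : ℤ)) := fun s hs =>
    φ.isHomogMap φ (neg_mem (tailDot_mem D K ν i s)) (hx s hs)
  have ht' : ∀ s, s + 1 < q → IsHomogMap (t s) (-D.form i i) := fun s hs =>
    φ.isHomogMap φ (tailCross_mem D K ν i s) (ht s hs)
  have him := φ.image_commonKer hφ hx
  have h0 : commonKer x q ≠ ⊥ := by
    intro h0
    obtain ⟨v, hv, hv0, hv'⟩ := (isLevelSub_tailSpan (M := M) (List.replicate q i)).killed_tailDot_ne_bot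
      hq (a := 0) (b := q) fun s _ hs v hv => tailDot_smul_mem hs hv
    have : v ∈ dotKilled M i q := ⟨hv, fun s hs => hv' s (Nat.zero_le _) hs⟩
    rw [← him, h0, φ.image_bot] at this
    exact hv0 this
  have hQ := fun T hT h0 => hM.eq_top hq' φ hφ hx ht (T := T) hT h0
  refine ⟨?_, esymm_eq_zero_of_generated h hx' ht' hQ (isGraded_commonKer hx') h0 le_rfl⟩
  rw [← him, ← φ.isGrIrreducibleSub_iff]
  refine ⟨isGraded_commonKer hx', h0, fun T hT hTg => or_iff_not_imp_left.mpr fun hT0 => ?_⟩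
  exact commonKer_eq h hx' ht' hQ hTg hT0 hT

end Real

end GrMod

end

noncomputable section

namespace GrMod

open KLR NilCoxeter NilHecke

variable {I : Type u} [DecidableEq I] {D : BorcherdsCartanDatum I} {K : Type v} [Field K]
variable {μ ν : Multiset I} {M : GrMod.{u, v, w} D K ν} {Q : GrMod.{u, v, w} D K μ} {i : I} {n : ℕ}

theorem IsLevelSub.killed_tailDot_restrict_ne_bot [FiniteDimensional K M.carrier]
    (hM : M.IsGrIrreducible) {q : ℕ} (hnq : n ≤ q) (hq : M.tailSpan (List.replicate q i) ≠ ⊥)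
    {S : Submodule K M.carrier} (hS : M.IsLevelSub (List.replicate n i) S) (h0 : S ≠ ⊥) :
    ∃ v ∈ GrMod.restrict S (List.replicate q i), v ≠ 0 ∧
      ∀ s, n ≤ s → s < q → tailDot D K ν i s • v = 0 :=
  (hS.restrict_replicate hnq).killed_tailDot_ne_bot (hM.restrict_ne_bot hnq hq hS h0)
    fun _ hs hs' _ hy => smul_mem_restrict (fun _ hx => hS.tailDot_smul_mem hs hx)
      (fun l => idem_mul_tailDot D K ν hs' l) hy

/-- For a real index `i`, the operator of the longest permutation maps a simple submodule of `e_i^n M`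
killed by the dots onto each simple submodule killed by the crossings. -/
theorem IsGrIrreducible.le_map_longest [FiniteDimensional K M.carrier] (hM : M.IsGrIrreducible)
    (hi : D.IsReal i) (φ : GrEmb Q M (List.replicate n i))
    {t : ℕ → Module.End (KLR D K μ) Q.carrier}
    (ht : ∀ s, s + 1 < n → ∀ p, φ.toFun (t s p) = tailCross D K ν i s • φ.toFun p)
    {N S : Submodule (KLR D K μ) Q.carrier} (hN : Q.IsGrIrreducibleSub N)
    (hNx : ∀ s < n, ∀ p ∈ N, tailDot D K ν i s • φ.toFun p = 0)
    (hS : Q.IsGrIrreducibleSub S) (hSt : ∀ s, s + 1 < n → ∀ p ∈ S, t s p = 0) :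
    S ≤ N.map (longest t n) := by
  have hSM := φ.isGrIrreducibleSub_iff.mp hS
  have hNM := φ.isGrIrreducibleSub_iff.mp hN
  have hW : M.tailSpan (List.replicate n i) ≠ ⊥ := fun h0 =>
    hSM.ne_bot (le_bot_iff.mp (h0 ▸ hSM.isLevelSub.le))
  obtain ⟨q, hnq, hq, hq'⟩ := exists_max_tailSpan hW
  obtain ⟨ψ, hψ⟩ := exists_grEmb_ePow i q M
  obtain ⟨x, y, hx, hy⟩ := exists_operators ψ hψ
  have h := nilHecke_operators ψ hψ hx hy hi
  obtain ⟨hX, he⟩ := hM.isLevelSimple_dotKilled hi q hq hq' ψ hψ hx hy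
  obtain ⟨v, hv, hv0, hvx⟩ := hSM.isLevelSub.killed_tailDot_restrict_ne_bot hM hnq hq hSM.ne_bot
  obtain ⟨p', hp', hpv'⟩ := hSM.isLevelSub.restrict_le hv
  have hvW : v ∈ LinearMap.range ψ.toFun := hψ ▸ restrict_le_tailSpan _ _ hv
  obtain ⟨p, rfl⟩ := hvW
  have hpx : ∀ s, n ≤ s → s < q → x s p = 0 := fun s hs hs' => ψ.injective (by
    rw [hx s hs', neg_smul, hvx s hs hs', neg_zero, map_zero])
  obtain ⟨hw, c, hc, hcw⟩ := h.staircase_smul hnq (u := p)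
    (fun s hs => ψ.injective (by
      rw [Module.End.smul_def, hy s (by omega), ← hpv', ← ht s hs, hSt s hs p' hp', map_zero,
        map_zero]))
    (fun j => esymm_apply_eq_zero_of_le h hnq hpx (fun j => by rw [he]; rfl) j) hpx
  set z := staircase x n • p with hz
  have hzX : ψ.toFun z ∈ dotKilled M i q := by
    rw [← ψ.image_commonKer hψ hx, ψ.mem_image, mem_commonKer]
    exact hw
  have hXN : GrMod.killed (restrict (φ.image N) (List.replicate q i)) (tailDot D K ν i) q
      = dotKilled M i q := by
    refine (hX.eq_bot_or_eq _
      (fun a (ha : a ∈ GrMod.killed _ _ _) => ⟨restrict_le_tailSpan _ _ ha.1, ha.2⟩)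
      (hNM.isLevelSub.restrict_replicate hnq).killed_tailDot).resolve_left fun h0 => ?_
    obtain ⟨a, ha, ha0, hax⟩ := hNM.isLevelSub.killed_tailDot_restrict_ne_bot hM hnq hq hNM.ne_bot
    apply ha0
    rw [← Submodule.mem_bot K, ← h0]
    refine ⟨ha, fun s hs => ?_⟩
    rcases lt_or_ge s n with hsn | hsn
    · obtain ⟨b, hb, rfl⟩ := hNM.isLevelSub.restrict_le ha
      exact hNx s hsn b hb
    · exact hax s hsn hs
  rw [← hXN] at hzX
  obtain ⟨p₀, hp₀, hpz⟩ := hNM.isLevelSub.restrict_le hzX.1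
  have hl : longest t n p₀ = c • p' := φ.injective (by
    rw [φ.map_longest ht, hpz, ← ψ.map_longest fun s hs => hy s (by omega), map_zsmul, hpv',
      ← map_zsmul]
    exact congrArg ψ.toFun hcw)
  have hg : Q.IsGraded (S ⊓ N.map (longest t n)) :=
    isGraded_inf hS.1 ((isHomogMap_longest fun s hs =>
      φ.isHomogMap φ (tailCross_mem D K ν i s) (ht s hs)).isGraded_map hN.1)
  rcases hS.2.2 _ inf_le_left hg with h0 | h0
  · exfalso
    have h1 : c • p' ∈ S ⊓ N.map (longest t n) :=
      ⟨S.smul_of_tower_mem c hp', ⟨p₀, hp₀, hl⟩⟩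
    rw [h0, Submodule.mem_bot] at h1
    have h2 : c • c • p' = 0 := by rw [h1, smul_zero]
    rw [smul_smul, hc, one_smul] at h2
    exact hv0 (by rw [← hpv', h2, map_zero])
  · rw [← h0]
    exact inf_le_right

/-- For an imaginary index, the dots and crossings act by zero on the extremal part. -/
theorem IsGrIrreducible.isLevelSimple_tailSpan [FiniteDimensional K M.carrier]
    (hM : M.IsGrIrreducible) (hi : ¬ D.IsReal i) {q : ℕ}
    (hq : M.tailSpan (List.replicate q i) ≠ ⊥)
    (hq' : M.tailSpan (List.replicate (q + 1) i) = ⊥) :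
    M.IsLevelSimple (List.replicate q i) (M.tailSpan (List.replicate q i)) := by
  obtain ⟨ψ, hψ⟩ := exists_grEmb_ePow i q M
  obtain ⟨x, t, hx, ht⟩ := exists_operators ψ hψ
  have h := nilCoxeter_operators ψ hψ hx ht
  obtain ⟨v, hv, hv0, hvx⟩ := (isLevelSub_tailSpan (M := M) (List.replicate q i)).killed_tailDot_ne_bot
      hq (a := 0) (b := q) fun s _ hs v hv => tailDot_smul_mem hs hv
  have hstable : ∀ s, s + 1 < q → ∀ v ∈ dotKilled M i q,
      tailCross D K ν i s • v ∈ dotKilled M i q := by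
    intro s hs v hv
    refine ⟨tailCross_smul_mem hs hv.1, fun s' hs' => ?_⟩
    have hW : ∀ m ≤ q, v ∈ M.tailSpan (List.replicate m i) := fun m hm =>
      tailSpan_replicate_le i hm hv.1
    have hz : tailCross D K ν i s • tailDot D K ν i s' • v = 0 := by rw [hv.2 s' hs', smul_zero]
    rw [← mul_smul] at hz ⊢
    rcases lt_trichotomy s' s with h1 | rfl | h1
    · rw [← hz]
      exact smul_congr_of_mem_tailSpan (tailDot_mul_tailCross D K ν h1) (hW _ hs)
    · rw [smul_congr_of_mem_tailSpan (z := tailCross D K ν i s' * tailDot D K ν i (s' + 1))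
        (fun l => ?_) (hW _ hs), mul_smul, hv.2 _ hs, smul_zero]
      have := tailDot_mul_tailCross_self D K ν (i := i) s' l
      rwa [if_neg hi, sub_zero] at this
    · rcases (Nat.succ_le_of_lt h1).eq_or_lt with h2 | h2
      · obtain rfl : s' = s + 1 := h2.symm
        rw [smul_congr_of_mem_tailSpan (z := tailCross D K ν i s * tailDot D K ν i s)
          (fun l => ?_) (hW _ hs), mul_smul, hv.2 _ (by omega), smul_zero]
        have := tailDot_succ_mul_tailCross D K ν (i := i) s l
        rwa [if_neg hi, add_zero] at this
      · rw [← hz]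
        exact (smul_congr_of_mem_tailSpan (tailCross_mul_tailDot D K ν h2) (hW _ hs')).symm
  have hvW : v ∈ LinearMap.range ψ.toFun := hψ ▸ hv
  obtain ⟨p, rfl⟩ := hvW
  obtain ⟨r, hr, hr0, hrt⟩ := h.exists_ne_zero
    (S := {p : (ePow i q M).carrier | ψ.toFun p ∈ dotKilled M i q}) (v := p) (fun s hs p hp => by
      change ψ.toFun (t s p) ∈ dotKilled M i q
      rw [ht s hs]
      exact hstable s hs _ hp) ⟨hv, fun s hs => hvx s (Nat.zero_le _) hs⟩
    (fun h0 => hv0 (by rw [h0, map_zero])) q le_rfl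
  have hker : (commonKer x q ⊓ commonKer t (q - 1)) = ⊤ := by
    refine hM.eq_top hq' ψ hψ hx ht (isGraded_inf
      (isGraded_commonKer fun s hs => ψ.isHomogMap ψ (neg_mem (tailDot_mem D K ν i s)) (hx s hs))
      (isGraded_commonKer fun s hs => ψ.isHomogMap ψ (tailCross_mem D K ν i s)
        (ht s (by omega)))) ?_ ?_ ?_
    · intro h0
      apply hr0
      have hmem : r ∈ commonKer x q ⊓ commonKer t (q - 1) := ?_
      · rwa [h0, Submodule.mem_bot] at hmem
      refine ⟨?_, mem_commonKer.mpr fun s hs => hrt s (by omega)⟩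
      rw [SetLike.mem_coe, ← ψ.mem_image, ψ.image_commonKer hψ hx]
      exact hr
    · intro s hs v hv
      rw [mem_commonKer.mp hv.1 s hs]
      exact zero_mem _
    · intro s hs v hv
      rw [mem_commonKer.mp hv.2 s (by omega)]
      exact zero_mem _
  rw [← hψ, ← ψ.image_top, ← ψ.isGrIrreducibleSub_iff]
  refine ⟨isGraded_top, ?_, fun T _ hT => or_iff_not_imp_left.mpr fun hT0 => ?_⟩
  · rwa [Ne, ← ψ.image_inj, ψ.image_top, ψ.image_bot, hψ]
  · refine hM.eq_top hq' ψ hψ hx ht hT hT0 (fun s hs v _ => ?_) fun s hs v _ => ?_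
    · have hv : v ∈ commonKer x q ⊓ commonKer t (q - 1) := hker ▸ Submodule.mem_top
      rw [mem_commonKer.mp hv.1 s hs]
      exact zero_mem _
    · have hv : v ∈ commonKer x q ⊓ commonKer t (q - 1) := hker ▸ Submodule.mem_top
      rw [mem_commonKer.mp hv.2 s (by omega)]
      exact zero_mem _

/-- For an imaginary index, `e_i^n M` has at most one simple submodule. -/
theorem IsGrIrreducible.isLevelSimple_unique [FiniteDimensional K M.carrier]
    (hM : M.IsGrIrreducible) (hi : ¬ D.IsReal i) {S T : Submodule K M.carrier}
    (hS : M.IsLevelSimple (List.replicate n i) S) (hT : M.IsLevelSimple (List.replicate n i) T) :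
    S = T := by
  have hW : M.tailSpan (List.replicate n i) ≠ ⊥ := fun h0 =>
    hS.ne_bot (le_bot_iff.mp (h0 ▸ hS.isLevelSub.le))
  obtain ⟨q, hnq, hq, hq'⟩ := exists_max_tailSpan hW
  have key : ∀ S, M.IsLevelSimple (List.replicate n i) S →
      M.tailSpan (List.replicate q i) ≤ S := fun S hS => by
    rw [← ((hM.isLevelSimple_tailSpan hi hq hq').eq_bot_or_eq _ (restrict_le_tailSpan S _)
      (hS.isLevelSub.restrict_replicate hnq)).resolve_left
        (hM.restrict_ne_bot hnq hq hS.isLevelSub hS.ne_bot)]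
    exact hS.isLevelSub.restrict_le
  exact hS.eq_of_inf_ne_bot hT fun h0 => hq (le_bot_iff.mp (h0 ▸ le_inf (key S hS) (key T hT)))

end GrMod

end

noncomputable section

namespace GrMod

open KLR NilCoxeter NilHecke

variable {I : Type u} [DecidableEq I] {D : BorcherdsCartanDatum I} {K : Type v} [Field K]
variable {μ ν : Multiset I} {M : GrMod.{u, v, w} D K ν} {Q : GrMod.{u, v, w} D K μ} {i : I} {n : ℕ}

theorem socle_eq_of_forall_le {N : Submodule (KLR D K μ) Q.carrier} (hN : Q.IsGrIrreducibleSub N)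
    (h : ∀ S, Q.IsGrIrreducibleSub S → S ≤ N) : Q.socle = N :=
  le_antisymm (sSup_le h) (le_sSup hN)

/-- A nonzero `e_i^n M` has a simple submodule which is killed by the dots on the last `n` strands. -/
theorem exists_isLevelSimple_dotKilled [FiniteDimensional K M.carrier]
    (h : M.tailSpan (List.replicate n i) ≠ ⊥) :
    ∃ N ≤ dotKilled M i n, M.IsLevelSimple (List.replicate n i) N := by
  have h1 := isLevelSub_tailSpan (M := M) (List.replicate n i)
  obtain ⟨v, hv, hv0, hvx⟩ := h1.killed_tailDot_ne_bot h (a := 0) (b := n)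
    fun s _ hs v hv => tailDot_smul_mem hs hv
  refine h1.killed_tailDot.exists_isLevelSimple fun h0 => hv0 ?_
  rw [← Submodule.mem_bot K, ← h0]
  exact ⟨hv, fun s hs => hvx s (Nat.zero_le _) hs⟩

/-- The crystal operator `ẽ_i` sends an irreducible module to zero or to an irreducible module. -/
theorem IsGrIrreducible.exists_grEmb_eTilde [FiniteDimensional K M.carrier]
    (hM : M.IsGrIrreducible) (h : M.tailSpan [i] ≠ ⊥) :
    ∃ φ : GrEmb (M.eTilde i) M [i], M.IsLevelSimple [i] (LinearMap.range φ.toFun) ∧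
      (D.IsReal i → ∀ p, tailDot D K ν i 0 • φ.toFun p = 0) := by
  let φ : GrEmb (M.e i) M (List.replicate 1 i) := GrEmb.ofE M i
  obtain ⟨N, hNx, hN⟩ := exists_isLevelSimple_dotKilled (n := 1) h
  obtain ⟨N', -, rfl⟩ := φ.exists_image_eq hN.isLevelSub
    (hN.isLevelSub.le.trans (GrEmb.range_ofE M i).ge)
  have hN' := φ.isGrIrreducibleSub_iff.mpr hN
  have hsoc : (M.e i).socle = N' := by
    refine socle_eq_of_forall_le hN' fun S hS => ?_
    by_cases hi : D.IsReal i
    · have := hM.le_map_longest hi φ (t := 0) (fun s hs => by omega) hN'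
        (fun s hs p hp => (hNx ⟨p, hp, rfl⟩).2 s hs) hS (fun s hs => by omega)
      rw [longest, longest, chain_zero, one_mul] at this
      exact this.trans (Submodule.map_id N').le
    · exact (φ.image_inj.mp (hM.isLevelSimple_unique hi (φ.isGrIrreducibleSub_iff.mp hS) hN)).le
  let ψ : GrEmb (M.eTilde i) M [i] := φ.comp (GrEmb.ofSoc (M.e i))
  have hr : LinearMap.range ψ.toFun = φ.image N' := by
    change LinearMap.range (φ.toFun ∘ₗ (GrEmb.ofSoc (M.e i)).toFun) = _
    rw [LinearMap.range_comp, GrEmb.range_ofSoc, hsoc]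
    rfl
  refine ⟨ψ, ?_, fun _ p => ?_⟩
  · rw [hr]
    exact hN
  · have hp : ψ.toFun p ∈ φ.image N' := hr ▸ ⟨p, rfl⟩
    exact (hNx hp).2 0 zero_lt_one

theorem GrEmb.map_rightOp {u' : List I} (φ : GrEmb Q M u') (h : KLRGen I) {p : Q.carrier}
    (hp : p ∈ Q.tailSpan h.bot) :
    φ.toFun (rightOp D K μ h • p) = rightOp D K ν (h.app u') • φ.toFun p := by
  induction hp using Submodule.span_induction with
  | zero => simp
  | add x y _ _ hx hy => simp only [smul_add, map_add, hx, hy]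
  | smul c x _ hx => rw [smul_comm, φ.toFun.map_smul, φ.toFun.map_smul, hx, smul_comm]
  | mem x hx =>
    obtain ⟨l, m, rfl⟩ := hx
    have h1 := rightOp_mul_idem D K ν (h.app u') l
    rw [KLRGen.bot_app, ← List.append_assoc] at h1
    rw [← mul_smul, rightOp_mul_idem, φ.map_gen, φ.map_gen, KLRGen.app_idem, ← mul_smul, h1,
      KLRGen.app_pre]

theorem exists_grEmb_eTildePow (i : I) (n : ℕ) (M : GrMod.{u, v, w} D K ν) :
    Nonempty (GrEmb (eTildePow i n M) M (List.replicate n i)) := by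
  induction n generalizing ν with
  | zero => exact ⟨GrEmb.refl M⟩
  | succ n ih =>
    obtain ⟨φ⟩ := ih (M.eTilde i)
    rw [List.replicate_succ']
    exact ⟨((GrEmb.ofE M i).comp (GrEmb.ofSoc (M.e i))).comp φ⟩

/-- If `e_i^n M` is nonzero, then `ẽ_i^n M` is an irreducible submodule of `e_i^n M`; for a real index
it is killed by the dots on the last `n` strands. -/
theorem IsGrIrreducible.exists_grEmb_eTildePow [FiniteDimensional K M.carrier]
    (hM : M.IsGrIrreducible) (h : M.tailSpan (List.replicate n i) ≠ ⊥) :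
    (eTildePow i n M).IsGrIrreducible ∧
      ∃ φ : GrEmb (eTildePow i n M) M (List.replicate n i),
        D.IsReal i → ∀ s < n, ∀ p, tailDot D K ν i s • φ.toFun p = 0 := by
  induction n generalizing ν with
  | zero =>
    let φ : GrEmb (eTildePow i 0 M) M (List.replicate 0 i) := GrEmb.refl M
    exact ⟨hM, φ, fun _ s hs => absurd hs (Nat.not_lt_zero s)⟩
  | succ n ih =>
    have h1 : M.tailSpan [i] ≠ ⊥ := fun h0 => by
      have h2 := tailSpan_replicate_le (M := M) i (Nat.succ_pos n)
      exact h (le_bot_iff.mp (h2.trans h0.le))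
    obtain ⟨φ, hφ, hφx⟩ := hM.exists_grEmb_eTilde h1
    have hP := φ.isGrIrreducible_iff.mpr hφ
    have hPfin := φ.finiteDimensional
    have hPn : (M.eTilde i).tailSpan (List.replicate n i) ≠ ⊥ := by
      obtain ⟨l, _, ⟨p, rfl⟩, hp⟩ := hM.exists_idem_smul_ne_zero (n := 1) (Nat.succ_pos n) h
        hφ.isLevelSub hφ.ne_bot
      intro h0
      apply hp
      rw [List.replicate_succ', ← List.append_assoc, ← KLRGen.app_idem, ← φ.map_gen]
      have h2 := idem_smul_mem_tailSpan l (List.replicate n i) p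
      rw [h0, Submodule.mem_bot] at h2
      rw [h2, map_zero]
    obtain ⟨hirr, ψ, hψ⟩ := ih hP hPn
    refine ⟨hirr, ?_⟩
    rw [List.replicate_succ']
    refine ⟨φ.comp ψ, fun hi s hs p => ?_⟩
    rcases s with _ | s
    · exact hφx hi _
    · have h2 : ψ.toFun p ∈ (M.eTilde i).tailSpan (List.replicate (s + 1) i) :=
        tailSpan_replicate_le i (by omega) (ψ.range_le ⟨p, rfl⟩)
      have h3 := φ.map_rightOp (.dot [] i (List.replicate s i)) h2
      rw [KLRGen.app_dot, ← List.replicate_succ'] at h3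
      change tailDot D K ν i (s + 1) • φ.toFun (ψ.toFun p) = 0
      rw [tailDot, ← h3]
      exact (congrArg φ.toFun (hψ hi s (by omega) p)).trans (map_zero _)

end GrMod

end

noncomputable section

namespace NilHecke

/-- The degree of a monomial in dots of degree `2 * r`, normalized to be symmetric about zero. -/
def Code.weight (r : ℤ) : ∀ m, Code m → ℤ
  | 0, _ => 0
  | m + 1, p => Code.weight r m p.1 + r * (2 * ((p.2 : ℕ) : ℤ) - m)

end NilHecke

open NilHecke in
theorem BorcherdsCartanDatum.qFactorial_eq_sum {I : Type u} (D : BorcherdsCartanDatum I) (i : I)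
    (n : ℕ) : D.qFactorial i n = ∑ p : Code n, LaurentPolynomial.T (Code.weight (D.r i) n p) := by
  induction n with
  | zero =>
    change _ = ∑ p : Unit, LaurentPolynomial.T 0
    simp [qFactorial]
  | succ n ih =>
    change _ = ∑ p : Code n × Fin (n + 1), LaurentPolynomial.T
      (Code.weight (D.r i) n p.1 + D.r i * (2 * ((p.2 : ℕ) : ℤ) - n))
    rw [qFactorial, Finset.prod_range_succ, ← qFactorial, ih, qInt, Finset.sum_range,
      ← Equiv.sum_comp Fin.revPerm, Finset.sum_mul_sum, Fintype.sum_prod_type]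
    refine Finset.sum_congr rfl fun p _ => Finset.sum_congr rfl fun c _ => ?_
    rw [← LaurentPolynomial.T_add]
    congr 3
    have := c.2
    rw [Fin.revPerm_apply, Fin.val_rev]
    have h : ((n + 1 - ((c : ℕ) + 1) : ℕ) : ℤ) = n - c := by omega
    rw [h]
    push_cast
    ring

theorem LaurentPolynomial.exists_equiv_of_eq_sum {ι : Type*} [Fintype ι] (wt : ι → ℤ)
    {f : LaurentPolynomial ℕ} (hf : f = ∑ p, LaurentPolynomial.T (wt p)) :
    ∃ E : ι ≃ Σ s : ℤ, Fin (f.coeff s), ∀ p, (E p).1 = wt p := by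
  classical
  have hc : ∀ s, Fintype.card {p // wt p = s} = f.coeff s := by
    intro s
    rw [hf, Fintype.card_subtype]
    simp only [AddMonoidAlgebra.coeff_sum, Finsupp.finsetSum_apply, LaurentPolynomial.T,
      AddMonoidAlgebra.coeff_single, Finsupp.single_apply, Finset.sum_boole, Nat.cast_id]
  exact ⟨(Equiv.sigmaFiberEquiv wt).symm.trans
    (Equiv.sigmaCongrRight fun s => Fintype.equivFinOfCardEq (hc s)), fun p => rfl⟩

namespace GrMod

open KLR NilCoxeter NilHecke

variable {I : Type u} [DecidableEq I] {D : BorcherdsCartanDatum I} {K : Type v} [Field K]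
variable {μ ν : Multiset I} {M : GrMod.{u, v, w} D K ν} {P Q : GrMod.{u, v, w} D K μ} {i : I} {n : ℕ}

theorem IsHomogMap.mem_iff {f : P.carrier →ₗ[KLR D K μ] Q.carrier} (hf : IsHomogMap f 0)
    (hinj : Function.Injective f) (d : ℤ) (p : P.carrier) : f p ∈ Q.gr d ↔ p ∈ P.gr d := by
  refine ⟨fun h => ?_, fun h => by simpa using hf d p h⟩
  have h1 : p = P.comp d p := hinj (by
    rw [hf.map_comp, zero_add, comp_of_mem h, if_pos rfl])
  rw [h1]
  exact comp_mem d p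

theorem soc_iso {f : P.carrier →ₗ[KLR D K μ] Q.carrier} (hf : IsHomogMap f 0)
    (hinj : Function.Injective f) (hr : LinearMap.range f = Q.socle) : Q.soc.Iso P := by
  let E : P.carrier ≃ₗ[KLR D K μ] Q.socle :=
    (LinearEquiv.ofInjective f hinj).trans (LinearEquiv.ofEq _ _ hr)
  have hE : ∀ p, (E p : Q.carrier) = f p := fun p => rfl
  refine ⟨E.symm, fun d m => ?_⟩
  obtain ⟨p, rfl⟩ := E.surjective m
  have h1 : E.symm (E p) = p := E.symm_apply_apply p
  change f p ∈ Q.gr d ↔ E.symm (E p) ∈ P.gr d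
  rw [h1, hf.mem_iff hinj]

theorem soc_iso_multiple {f : LaurentPolynomial ℕ} {ι : Type} [Fintype ι]
    (E : ι ≃ Σ s : ℤ, Fin (f.coeff s)) (F : ι → P.carrier →ₗ[KLR D K μ] Q.carrier)
    (hF : ∀ p, IsHomogMap (F p) (E p).1)
    (hinj : ∀ u : ι → P.carrier, ∑ p, F p (u p) = 0 → u = 0)
    (hr : ∀ y, y ∈ Q.socle ↔ ∃ u : ι → P.carrier, ∑ p, F p (u p) = y) :
    Q.soc.Iso (P.multiple f) := by
  have : Finite (Σ s : ℤ, Fin (f.coeff s)) := Finite.of_equiv ι E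
  let H : ((Σ s : ℤ, Fin (f.coeff s)) →₀ P.carrier) →ₗ[KLR D K μ] Q.carrier :=
    ∑ p, F p ∘ₗ Finsupp.lapply (E p)
  have hH : ∀ u, H u = ∑ p, F p (u (E p)) := fun u => by
    simp only [H, LinearMap.sum_apply, LinearMap.comp_apply, Finsupp.lapply_apply]
  refine soc_iso (P := P.multiple f) (f := H) ?_ ?_ ?_
  · intro d (u : (Σ s : ℤ, Fin (f.coeff s)) →₀ P.carrier) hu
    rw [zero_add]
    change H u ∈ _
    rw [hH]
    have hu' : u ∈ ⨅ q : (Σ s : ℤ, Fin (f.coeff s)),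
        (P.gr (d - q.1)).comap (Finsupp.lapply (R := K) q) := hu
    refine sum_mem fun p _ => ?_
    have h1 : u (E p) ∈ P.gr (d - (E p).1) := (Submodule.mem_iInf _).mp hu' (E p)
    have := hF p _ _ h1
    rwa [add_sub_cancel] at this
  · change Function.Injective H
    rw [← LinearMap.ker_eq_bot, LinearMap.ker_eq_bot']
    intro u hu
    rw [hH] at hu
    have h1 := hinj (fun p => u (E p)) hu
    ext q
    obtain ⟨p, rfl⟩ := E.surjective q
    exact congrFun h1 p
  · ext y
    rw [hr]
    constructor
    · rintro ⟨(u : (Σ s : ℤ, Fin (f.coeff s)) →₀ P.carrier), rfl⟩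
      exact ⟨fun p => u (E p), (hH u).symm⟩
    · rintro ⟨u, rfl⟩
      refine ⟨Finsupp.equivFunOnFinite.symm (u ∘ E.symm), ?_⟩
      change H _ = _
      rw [hH]
      simp

theorem soc_iso_of_subsingleton [Subsingleton P.carrier] [Subsingleton Q.carrier] :
    Q.soc.Iso P :=
  soc_iso (isHomogMap_zero 0) (Function.injective_of_subsingleton _) (Subsingleton.elim _ _)

theorem isHomogMap_monomial {x : ℕ → Module.End (KLR D K μ) Q.carrier} {r : ℤ} {m : ℕ}
    (hx : ∀ s < m, IsHomogMap (x s) (2 * r)) (p : Code m) :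
    IsHomogMap (monomial x m p) (Code.weight r m p + m.choose 2 * r) := by
  induction m with
  | zero =>
    have : IsHomogMap (1 : Module.End (KLR D K μ) Q.carrier) (0 + (0 : ℕ) * r) := by
      simpa using isHomogMap_id
    exact this
  | succ m ih =>
    have h1 := (ih (fun s hs => hx s (by omega)) p.1).mul ((hx m (by omega)).pow (p.2 : ℕ))
    rw [monomial, Code.weight, Nat.choose_succ_succ' m 1, Nat.choose_one_right]
    convert h1 using 1
    push_cast
    ring

theorem exists_isHomogMap_coeff {x t : ℕ → Module.End (KLR D K μ) Q.carrier} {e a : ℤ} {m : ℕ}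
    (hx : ∀ s < m, IsHomogMap (x s) e) (ht : ∀ s, s + 1 < m → IsHomogMap (t s) a) (p : Code m) :
    ∃ b, IsHomogMap (coeff x t m p) b := by
  induction m with
  | zero => exact ⟨0, isHomogMap_id⟩
  | succ m ih =>
    obtain ⟨b, hb⟩ := ih (fun s hs => hx s (by omega)) (fun s hs => ht s (by omega)) p.1
    have h1 : IsHomogMap (-1 : Module.End (KLR D K μ) Q.carrier) 0 := fun d p hp => by
      rw [zero_add]
      exact neg_mem hp
    exact ⟨_, (h1.pow (p.2 : ℕ)).mul ((isHomogMap_chain fun s hs => ht s (by omega)).mul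
      ((isHomogMap_esymm (fun s hs => hx s (by omega)) _).mul hb))⟩

theorem IsHomogMap.shift {f : P.carrier →ₗ[KLR D K μ] Q.carrier} {e : ℤ} (hf : IsHomogMap f e)
    (s : ℤ) : IsHomogMap (P := P.shift s) f (e - s) := fun d p hp => by
  have := hf _ p hp
  rwa [show e + (d - s) = e - s + d by ring] at this

theorem exists_inclusion (φ : GrEmb Q M (List.replicate n i))
    (hφ : LinearMap.range φ.toFun = M.tailSpan (List.replicate n i))
    (ψ : GrEmb P M (List.replicate n i)) :
    ∃ θ : P.carrier →ₗ[KLR D K μ] Q.carrier, IsHomogMap θ 0 ∧ Function.Injective θ ∧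
      ∀ p, φ.toFun (θ p) = ψ.toFun p := by
  obtain ⟨θ, hθ⟩ := φ.exists_lift ψ 1 (fun p => by
    rw [one_smul, hφ]; exact ψ.range_le ⟨p, rfl⟩) (fun g p => by rw [one_smul, one_smul])
  simp only [one_smul] at hθ
  refine ⟨θ, φ.isHomogMap ψ (z := 1) (Submodule.subset_span ⟨[], rfl, rfl⟩)
    (fun p => by rw [hθ, one_smul]), fun p q hpq => ψ.injective ?_, hθ⟩
  rw [← hθ, ← hθ, hpq]

theorem subsingleton_of_tailSpan_eq_bot (φ : GrEmb Q M (List.replicate n i))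
    (h : M.tailSpan (List.replicate n i) = ⊥) : Subsingleton Q.carrier := by
  refine subsingleton_of_forall_eq 0 fun p => φ.injective ?_
  have := φ.range_le ⟨p, rfl⟩
  rw [h, Submodule.mem_bot] at this
  rw [this, map_zero]

theorem IsGrIrreducible.isGrIrreducibleSub_range (hP : P.IsGrIrreducible)
    {f : P.carrier →ₗ[KLR D K μ] Q.carrier} {e : ℤ} (hf : IsHomogMap f e) :
    LinearMap.range f = ⊥ ∨ Q.IsGrIrreducibleSub (LinearMap.range f) := by
  have := (isGrIrreducible_iff_top.mp hP).map hf
  rwa [Submodule.map_top] at this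

theorem IsGrIrreducible.isGrIrreducibleSub_range_of_injective (hP : P.IsGrIrreducible)
    {f : P.carrier →ₗ[KLR D K μ] Q.carrier} {e : ℤ} (hf : IsHomogMap f e)
    (hinj : Function.Injective f) : Q.IsGrIrreducibleSub (LinearMap.range f) := by
  refine (hP.isGrIrreducibleSub_range hf).resolve_left fun h0 => ?_
  obtain ⟨x, y, hxy⟩ := hP.1
  apply hxy
  rw [LinearMap.range_eq_bot] at h0
  exact hinj (by rw [h0]; rfl)

theorem IsGrIrreducible.soc_ePow_iso_of_not_isReal [FiniteDimensional K M.carrier]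
    (hM : M.IsGrIrreducible) (hi : ¬ D.IsReal i) (n : ℕ) :
    (ePow i n M).soc.Iso (eTildePow i n M) := by
  obtain ⟨φ, hφ⟩ := exists_grEmb_ePow i n M
  by_cases h : M.tailSpan (List.replicate n i) = ⊥
  · obtain ⟨ψ⟩ := GrMod.exists_grEmb_eTildePow i n M
    have := subsingleton_of_tailSpan_eq_bot φ h
    have := subsingleton_of_tailSpan_eq_bot ψ h
    exact soc_iso_of_subsingleton
  · obtain ⟨hP, ψ, -⟩ := hM.exists_grEmb_eTildePow h
    obtain ⟨θ, hθ, hinj, -⟩ := exists_inclusion φ hφ ψ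
    have hN := hP.isGrIrreducibleSub_range_of_injective hθ hinj
    refine soc_iso hθ hinj (socle_eq_of_forall_le hN fun S hS => ?_).symm
    exact (φ.image_inj.mp (hM.isLevelSimple_unique hi (φ.isGrIrreducibleSub_iff.mp hS)
      (φ.isGrIrreducibleSub_iff.mp hN))).le

theorem IsGrIrreducible.soc_ePow_iso_of_isReal [FiniteDimensional K M.carrier]
    (hM : M.IsGrIrreducible) (hi : D.IsReal i) (n : ℕ) :
    (ePow i n M).soc.Iso
      (((eTildePow i n M).shift (-((D.r i : ℤ) * (n.choose 2 : ℤ)))).multiple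
        (D.qFactorial i n)) := by
  obtain ⟨φ, hφ⟩ := exists_grEmb_ePow i n M
  by_cases h0 : M.tailSpan (List.replicate n i) = ⊥
  · obtain ⟨ψ⟩ := GrMod.exists_grEmb_eTildePow i n M
    have := subsingleton_of_tailSpan_eq_bot φ h0
    have h1 := subsingleton_of_tailSpan_eq_bot ψ h0
    have : Subsingleton (((eTildePow i n M).shift (-((D.r i : ℤ) * (n.choose 2 : ℤ)))).multiple
        (D.qFactorial i n)).carrier :=
      inferInstanceAs (Subsingleton ((Σ s : ℤ, Fin ((D.qFactorial i n).coeff s)) →₀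
        (eTildePow i n M).carrier))
    exact soc_iso_of_subsingleton
  obtain ⟨hP, ψ, hψ⟩ := hM.exists_grEmb_eTildePow h0
  obtain ⟨θ, hθ, hinj, hθφ⟩ := exists_inclusion φ hφ ψ
  obtain ⟨x, t, hx, ht⟩ := exists_operators φ hφ
  have h := nilHecke_operators φ hφ hx ht hi
  have hx' : ∀ s < n, IsHomogMap (x s) (2 * (D.r i : ℤ)) := fun s hs =>
    φ.isHomogMap φ (neg_mem (tailDot_mem D K ν i s)) (hx s hs)
  have ht' : ∀ s, s + 1 < n → IsHomogMap (t s) (-(2 * (D.r i : ℤ))) := fun s hs =>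
    φ.isHomogMap φ (form_self_of_isReal hi ▸ tailCross_mem D K ν i s) (ht s hs)
  have hN := hP.isGrIrreducibleSub_range_of_injective hθ hinj
  have hθx : ∀ s < n, ∀ p, x s (θ p) = 0 := fun s hs p => φ.injective (by
    rw [hx s hs, hθφ, neg_smul, hψ hi s hs, neg_zero, map_zero])
  let F : Code n → (eTildePow i n M).carrier →ₗ[KLR D K _] (ePow i n M).carrier := fun p =>
    (monomial x n p * longest t n) ∘ₗ θ
  have hF : ∀ p, IsHomogMap (F p)
      (Code.weight (D.r i) n p - (D.r i : ℤ) * (n.choose 2 : ℤ)) := fun p => by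
    have := ((isHomogMap_monomial hx' p).mul (isHomogMap_longest ht')).comp hθ
    convert this using 1
    ring
  obtain ⟨E, hE⟩ := LaurentPolynomial.exists_equiv_of_eq_sum _ (D.qFactorial_eq_sum i n)
  refine soc_iso_multiple (P := (eTildePow i n M).shift (-((D.r i : ℤ) * (n.choose 2 : ℤ)))) E F
    (fun p => ?_) (fun u hu => ?_) fun y => ⟨fun hy => ?_, ?_⟩
  · rw [hE]
    have := (hF p).shift (-((D.r i : ℤ) * (n.choose 2 : ℤ)))
    rwa [sub_neg_eq_add, sub_add_cancel] at this
  · funext p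
    have h1 : longest t n • θ (u p) = 0 := h.sum_monomial_smul_eq_zero le_rfl
      (u := fun p => longest t n • θ (u p))
      (fun p s hs => h.cross_smul_longest_smul hs le_rfl _) hu p
    have h2 := h.longest_smul_injective le_rfl (fun s hs => hθx s hs (u p)) h1
    exact hinj (h2.trans (map_zero θ).symm)
  · let G : (Code n → (eTildePow i n M).carrier) →ₗ[KLR D K _] (ePow i n M).carrier :=
      ∑ p, F p ∘ₗ LinearMap.proj p
    have hG : ∀ u, G u = ∑ p, F p (u p) := fun u => by
      simp only [G, LinearMap.sum_apply, LinearMap.comp_apply, LinearMap.proj_apply]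
    suffices hle : (ePow i n M).socle ≤ LinearMap.range G by
      obtain ⟨u, hu⟩ := hle hy
      exact ⟨u, (hG u).symm.trans hu⟩
    refine sSup_le fun S hS y hy => ?_
    have hc : ∀ p : Code n, ∃ q, longest t n • θ q = coeff x t n p • y := by
      intro p
      obtain ⟨b, hb⟩ := exists_isHomogMap_coeff hx' ht' p
      have hy' : coeff x t n p • y ∈ S.map (coeff x t n p) := ⟨y, hy, rfl⟩
      rcases hS.map hb with h1 | h1
      · rw [h1, Submodule.mem_bot] at hy'
        exact ⟨0, by rw [hy', map_zero, smul_zero]⟩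
      · obtain ⟨_, ⟨q, rfl⟩, hq⟩ := hM.le_map_longest hi φ ht hN
          (by rintro s hs _ ⟨q, rfl⟩; rw [hθφ]; exact hψ hi s hs q) h1
          (by rintro s hs _ ⟨z, -, rfl⟩; exact h.cross_smul_coeff_smul le_rfl p z hs) hy'
        exact ⟨q, hq⟩
    choose u hu using hc
    refine ⟨u, ?_⟩
    rw [hG, h.eq_sum_monomial_smul le_rfl y]
    refine Finset.sum_congr rfl fun p _ => ?_
    rw [← hu]
    rfl
  · rintro ⟨u, rfl⟩
    have hFs : ∀ p q, F p q ∈ (ePow i n M).socle := by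
      intro p q
      have hy : F p q ∈ LinearMap.range (F p) := ⟨_, rfl⟩
      rcases hP.isGrIrreducibleSub_range (hF p) with h1 | h1
      · rw [h1, Submodule.mem_bot] at hy
        rw [hy]
        exact zero_mem _
      · exact (le_sSup h1 : _ ≤ (ePow i n M).socle) hy
    exact sum_mem fun p _ => hFs p (u p)

end GrMod

end

theorem mainTheorem8 {I : Type u} [DecidableEq I] (D : BorcherdsCartanDatum I)
    (K : Type v) [Field K] [IsAlgClosed K] (ν : Multiset I) (M : GrMod.{u, v, w} D K ν)
    (hfin : FiniteDimensional K M.carrier) (hM : M.IsGrIrreducible) (i : I) (n : ℕ) :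
    (D.IsReal i →
      (GrMod.ePow i n M).soc.Iso
        (((GrMod.eTildePow i n M).shift (-((D.r i : ℤ) * (n.choose 2 : ℤ)))).multiple
          (D.qFactorial i n))) ∧
    (D.IsImaginary i → (GrMod.ePow i n M).soc.Iso (GrMod.eTildePow i n M)) := by
  refine ⟨fun hi => hM.soc_ePow_iso_of_isReal hi n, fun hi => hM.soc_ePow_iso_of_not_isReal ?_ n⟩
  intro hr
  rw [BorcherdsCartanDatum.IsImaginary, show D.a i i = 2 from hr] at hi
  omega
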